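/- Let $\Delta=\sum_{m\ge 0}q^{(2m+1)^2}\in\mathbf F_2[[q]]$ (the reduction modulo 2 of $\sum_{n\ge1}\tau(n)q^n$). For $n>0$ let $\mathcal F(n)\subset\mathbf F_2[[q]]$ be the $\mathbf F_2$-subspace spanned by $\Delta,\Delta^3,\dots,\Delta^{2n-1}$. For an odd prime $p$ let $T_p$ be the Hecke operator on $\mathbf F_2[[q]]$ which sends $\sum_m a_mq^m$ to $\sum_m b_mq^m$, where $b_m=a_{pm}$ if $p\nmid m$ and $b_m=a_{pm}+a_{m/p}$ if $p\mid m$. Then every $T_p$ maps every $\mathcal F(n)$ into itself. Let $A(n)$ be the (commutative) $\mathbf F_2$-subalgebra of $\mathrm{End}(\mathcal F(n))$ generated by the $T_p$, $p$ an odd prime, and let $A$ be the projective limit of the $A(n)$ for the restriction maps $A(n+1)\to A(n)$; write $T_p\in A$ also for the element given by the restrictions $(T_p|_{\mathcal F(n)})_n$. **Theorem.** There is exactly one homomorphism of $\mathbf F_2$-algebras $\psi:\mathbf F_2[[x,y]]\to A$ with $\psi(x)=T_3$ and $\psi(y)=T_5$. It is continuous for the $(x,y)$-adic topology on $\mathbf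 F_2[[x,y]]$ and the projective limit topology on $A$ (each $A(n)$ being discrete), i.e. it is obtained by passage to the limit from the homomorphisms $\mathbf F_2[x,y]\to A(n)$, $x\mapsto T_3$, $y\mapsto T_5$; and $\psi$ is an isomorphism. **Corollary.** $A$ is a regular local ring of dimension $2$. In particular, it is an integral domain. -/

import Mathlib

open scoped PowerSeries

namespace HeckeModTwo

/-- The series `Δ = ∑_{m ≥ 0} q^((2m+1)^2)` in `𝔽₂[[q]]`, i.e. the reduction modulo 2 of
`∑_{n ≥ 1} τ(n) q^n`. -/
noncomputable def Delta : (ZMod 2)⟦X⟧ :=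
  open Classical in
  PowerSeries.mk fun n => if ∃ m : ℕ, n = (2 * m + 1) ^ 2 then 1 else 0

/-- The space `F(n)` spanned by `Δ, Δ³, …, Δ^(2n-1)`. -/
noncomputable def F (n : ℕ) : Submodule (ZMod 2) (ZMod 2)⟦X⟧ :=
  Submodule.span (ZMod 2) {f | ∃ i < n, f = Delta ^ (2 * i + 1)}

/-- The Hecke operator `T_p` on `𝔽₂[[q]]` (for `p` an odd prime):
`a_m(T_p f) = a_{pm}(f) + a_{m/p}(f)`, where the second term is absent unless `p ∣ m`. -/
noncomputable def heckeT (p : ℕ) : (ZMod 2)⟦X⟧ →ₗ[ZMod 2] (ZMod 2)⟦X⟧ where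
  toFun f := PowerSeries.mk fun m =>
    PowerSeries.coeff (p * m) f + if p ∣ m then PowerSeries.coeff (m / p) f else 0
  map_add' f g := by
    ext m
    simp only [PowerSeries.coeff_mk, map_add]
    split_ifs <;> ring
  map_smul' c f := by
    ext m
    simp only [PowerSeries.coeff_mk, PowerSeries.coeff_smul, RingHom.id_apply, smul_eq_mul]
    split_ifs <;> ring

theorem coeff_heckeT (p m : ℕ) (f : (ZMod 2)⟦X⟧) :
    PowerSeries.coeff m (heckeT p f) =
      PowerSeries.coeff (p * m) f + if p ∣ m then PowerSeries.coeff (m / p) f else 0 := by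
  simp [heckeT]

theorem heckeT_comm {p l : ℕ} (hp : p.Prime) (hl : l.Prime) (f : (ZMod 2)⟦X⟧) :
    heckeT p (heckeT l f) = heckeT l (heckeT p f) := by
  by_cases h : p = l
  · rw [h]
  have hc : Nat.Coprime p l := (Nat.coprime_primes hp hl).2 h
  ext m
  simp only [coeff_heckeT]
  have e1 : l ∣ p * m ↔ l ∣ m :=
    ⟨fun h => hc.symm.dvd_of_dvd_mul_left h, fun h => h.mul_left p⟩
  have e2 : p ∣ l * m ↔ p ∣ m :=
    ⟨fun h => hc.dvd_of_dvd_mul_left h, fun h => h.mul_left l⟩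
  rw [← mul_assoc, ← mul_assoc, mul_comm l p]
  simp only [e1, e2]
  by_cases h1 : p ∣ m <;> by_cases h2 : l ∣ m
  · have e3 : p * m / l = p * (m / l) := Nat.mul_div_assoc _ h2
    have e4 : l * m / p = l * (m / p) := Nat.mul_div_assoc _ h1
    have e5 : l ∣ m / p := by
      obtain ⟨k, rfl⟩ := h1
      rw [Nat.mul_div_cancel_left _ hp.pos]
      exact hc.symm.dvd_of_dvd_mul_left h2
    have e6 : p ∣ m / l := by
      obtain ⟨k, rfl⟩ := h2
      rw [Nat.mul_div_cancel_left _ hl.pos]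
      exact hc.dvd_of_dvd_mul_left h1
    simp only [h1, h2, e5, e6, if_true, e3, e4, Nat.div_div_eq_div_mul, mul_comm l p]
    ring
  · have e4 : l * m / p = l * (m / p) := Nat.mul_div_assoc _ h1
    have e5 : ¬ l ∣ m / p := fun h => h2 (h.trans (Nat.div_dvd_of_dvd h1))
    simp [h1, h2, e4, e5]
  · have e3 : p * m / l = p * (m / l) := Nat.mul_div_assoc _ h2
    have e6 : ¬ p ∣ m / l := fun h => h1 (h.trans (Nat.div_dvd_of_dvd h2))
    simp [h1, h2, e3, e6]
  · simp [h1, h2]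

/-- The set of the endomorphisms of `F(n)` given by the Hecke operators `T_p`, `p` an odd prime. -/
def heckeOps (n : ℕ) : Set (Module.End (ZMod 2) (F n)) :=
  {u | ∃ p : ℕ, p.Prime ∧ p ≠ 2 ∧ ∀ f : F n, (u f : (ZMod 2)⟦X⟧) = heckeT p f}

/-- The Hecke algebra `A(n)`: the `𝔽₂`-subalgebra of `End(F(n))` generated by the `T_p`. -/
noncomputable def HeckeAlg (n : ℕ) : Subalgebra (ZMod 2) (Module.End (ZMod 2) (F n)) :=
  Algebra.adjoin (ZMod 2) (heckeOps n)

theorem heckeOps_comm (n : ℕ) : ∀ u ∈ heckeOps n, ∀ v ∈ heckeOps n, u * v = v * u := by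
  rintro u ⟨p, hp, -, hu⟩ v ⟨l, hl, -, hv⟩
  ext1 f
  apply Subtype.ext
  simp only [Module.End.mul_apply, hu, hv, heckeT_comm hp hl]

noncomputable instance (n : ℕ) : CommRing (HeckeAlg n) where
  __ := (inferInstance : Ring (HeckeAlg n))
  mul_comm := (Algebra.isMulCommutative_adjoin (ZMod 2) (heckeOps_comm n)).is_comm.comm

/-- The projective limit `A` of the algebras `A(n)`, `n > 0`, the transition maps being the
restriction of endomorphisms of `F(n)` to `F(m)` for `m ≤ n`: the compatible sequences
`(u n)` with `u n ∈ A(n)`. -/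
noncomputable def A : Subalgebra (ZMod 2) (∀ n : ℕ+, HeckeAlg n) where
  carrier := {u | ∀ m n : ℕ+, m ≤ n → ∀ (f : F m) (g : F n), (f : (ZMod 2)⟦X⟧) = g →
    (((u m : Module.End (ZMod 2) (F m)) f : F m) : (ZMod 2)⟦X⟧) =
      (((u n : Module.End (ZMod 2) (F n)) g : F n) : (ZMod 2)⟦X⟧)}
  mul_mem' := by
    intro u v hu hv m n hmn f g hfg
    exact hu m n hmn _ _ (hv m n hmn f g hfg)
  add_mem' := by
    intro u v hu hv m n hmn f g hfg
    exact congrArg₂ (· + ·) (hu m n hmn f g hfg) (hv m n hmn f g hfg)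
  algebraMap_mem' := by
    intro c m n hmn f g hfg
    exact congrArg (c • ·) hfg

/-- The component in `A(n)`, as an endomorphism of `F(n)`, of an element of `A`. -/
noncomputable def component (u : A) (n : ℕ+) : Module.End (ZMod 2) (F n) :=
  (u.1 n : Module.End (ZMod 2) (F n))

/-- `u ∈ A` is the Hecke operator `T_p`: each of its components acts as `T_p`. -/
def IsHecke (p : ℕ) (u : A) : Prop :=
  ∀ (n : ℕ+) (f : F n), (component u n f : (ZMod 2)⟦X⟧) = heckeT p f

/-- Continuity of `ψ : 𝔽₂[[x,y]] → A` for the `(x,y)`-adic topology and the projective limit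
topology: each component of `ψ` kills all series of sufficiently large order. Together with the
values at `x` and `y` this says that `ψ` is obtained from the homomorphisms
`𝔽₂[x,y] → A(n)` by passage to the limit. -/
def IsContinuousHom (ψ : MvPowerSeries (Fin 2) (ZMod 2) →ₐ[ZMod 2] A) : Prop :=
  ∀ n : ℕ+, ∃ N : ℕ, ∀ s : MvPowerSeries (Fin 2) (ZMod 2),
    (∀ d : Fin 2 →₀ ℕ, d 0 + d 1 < N → MvPowerSeries.coeff d s = 0) → component (ψ s) n = 0

end HeckeModTwo

open scoped PowerSeries

namespace HeckeModTwo

/-! ### Parity of the number of representations -/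

/-! The form sending (u, f) to the coefficient of q in u f pairs the Hecke algebra with the union of
the spaces F(n). The odd powers of Δ can be indexed by pairs (a, b), as Δ^(`expo a b`), in such a
way that, up to terms of lower weight, T_3 replaces a by a - 1 and T_5 replaces b by b - 1 (the
result being 0 when the index is already 0). Hence the matrix of the coefficients of q in T_3^i
T_5^j Δ^(`expo a b`) is unitriangular (`coeff_one_heckeT_pow_pow`).

The index interleaves binary digits: `expo a b` = 1 + 2 I(a, b). The weight `wt` gives the binary
places the values 2, 3, 4, 6, 8, 12, ..., so that `wt (expo a b)` = 2 + 3a + 4b. It satisfies wt(4n)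
= 2 wt(n), it is subadditive, and adding 2^i where the bit i is already set loses weight strictly.

The leading terms come from the modular equations modulo 2, with t = Δ(q): (t + y)^4 = t y for y =
Δ(q^3), and (t + y)^6 = t y for y = Δ(q^5). Their symmetry makes both halves of T_p, a_m ↦ a_{pm}
and f(q) ↦ f(q^p), satisfy the same linear recurrence on powers of Δ. Raised to the power 2^r, and
up to lower weight, both recurrences read T(Δ^(m + 2^(i+2))) = Δ^(2^(i+2)) T(Δ^m) + Δ^(2^i) T(Δ^(m +
2^i)); `leading_term` extracts the leading term from this by induction on binary digits. The modular
equations themselves are parity statements on representations by x² + d y² with d = 2, 3, 5, proved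
by involutions: multiplication of the conjugate of x + y√-d by an element of norm 1.

Stability of F(n) is obtained by lifting to characteristic 0: the Hecke operators act on level 1
forms, and an integral form of weight 12k reduces to a polynomial of degree at most k in Δ.
Exponents modulo 8 show that odd powers go to odd powers.

Since T_3 and T_5 lower the weight, they are nilpotent on each F(n). A series in them acts there as
a finite sum, which gives existence, uniqueness and continuity of ψ. Triangularity gives
injectivity, and allows one to solve for a series s such that ψ(s) and a given u in A have the same
coefficients of q on all powers Δ^(`expo a b`). Their difference vanishes because A is commutative
and the pairing is nondegenerate on F(n). The other T_p play no role beyond commuting with T_3 and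
T_5. -/

theorem ncard_eq_ncard_fixed {α : Type*} {S : Set α} (hS : S.Finite) (g : α → α)
    (hg : ∀ a ∈ S, g a ∈ S) (hgg : ∀ a ∈ S, g (g a) = a) :
    (S.ncard : ZMod 2) = ({a ∈ S | g a = a}.ncard : ZMod 2) := by
  classical
  lift S to Finset α using hS
  have h0 : ∑ a ∈ S.filter (fun a => ¬ g a = a), (1 : ZMod 2) = 0 := by
    refine Finset.sum_involution (fun a _ => g a) (fun _ _ => by decide) ?_ ?_ ?_
    · intro a ha _
      exact (Finset.mem_filter.1 ha).2
    · intro a ha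
      obtain ⟨h1, h2⟩ := Finset.mem_filter.1 ha
      refine Finset.mem_filter.2 ⟨hg a h1, ?_⟩
      rw [hgg a h1]
      exact fun h => h2 h.symm
    · intro a ha
      exact hgg a (Finset.mem_filter.1 ha).1
  have h1 : {a ∈ (S : Set α) | g a = a} = ((S.filter (fun a => g a = a) : Finset α) : Set α) := by
    ext; simp
  rw [h1, Set.ncard_coe_finset, Set.ncard_coe_finset,
    ← Finset.card_filter_add_card_filter_not (s := S) (fun a => g a = a), Nat.cast_add]
  simp only [Finset.sum_const, nsmul_eq_mul, mul_one] at h0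
  rw [h0, add_zero]

theorem ncard_eq_ite_of_subsingleton {α : Type*} {S : Set α} (hS : S.Subsingleton) (P : Prop)
    [Decidable P] (hP : S.Nonempty ↔ P) : (S.ncard : ZMod 2) = if P then 1 else 0 := by
  rcases hS.eq_empty_or_singleton with rfl | ⟨a, rfl⟩
  · rw [if_neg (by simpa using hP)]
    simp
  · rw [if_pos (by simpa using hP)]
    simp

/-- The series `∑ q^(φ i)`, the sum being over `i ∈ S`. -/
noncomputable def theta {ι : Type*} (S : Set ι) (φ : ι → ℤ) : (ZMod 2)⟦X⟧ :=
  PowerSeries.mk fun n => (({i ∈ S | φ i = n}.ncard : ℕ) : ZMod 2)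

/-- Finiteness of the fibres is essential, since `Set.ncard` takes the value 0 on infinite sets. -/
theorem theta_mul {ι κ : Type*} {S : Set ι} {T : Set κ} {φ : ι → ℤ} {ψ : κ → ℤ}
    (hφ : ∀ i, 0 ≤ φ i) (hψ : ∀ i, 0 ≤ ψ i) (hS : ∀ n : ℕ, {i ∈ S | φ i = n}.Finite)
    (hT : ∀ n : ℕ, {i ∈ T | ψ i = n}.Finite) :
    theta S φ * theta T ψ = theta (S ×ˢ T) fun p => φ p.1 + ψ p.2 := by
  ext n
  rw [PowerSeries.coeff_mul]
  simp only [theta, PowerSeries.coeff_mk]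
  have h1 : {i ∈ S ×ˢ T | φ i.1 + ψ i.2 = n} = ⋃ a ∈ (Finset.HasAntidiagonal.antidiagonal n : Set (ℕ × ℕ)),
      {i ∈ S | φ i = a.1} ×ˢ {i ∈ T | ψ i = a.2} := by
    ext ⟨i, j⟩
    simp only [Set.mem_ofPred_eq, Set.mem_prod, Set.mem_iUnion, Finset.mem_coe,
      Finset.HasAntidiagonal.mem_antidiagonal, exists_prop, Prod.exists]
    constructor
    · rintro ⟨⟨hi, hj⟩, h⟩
      have := hφ i
      have := hψ j
      exact ⟨(φ i).toNat, (ψ j).toNat, by omega, ⟨hi, by omega⟩, ⟨hj, by omega⟩⟩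
    · rintro ⟨a, b, hab, ⟨hi, h1⟩, ⟨hj, h2⟩⟩
      exact ⟨⟨hi, hj⟩, by omega⟩
  rw [h1, Set.Finite.ncard_biUnion (Finset.finite_toSet _)
    (fun a _ => (hS a.1).prod (hT a.2)), finsum_mem_coe_finset, Nat.cast_sum]
  · refine Finset.sum_congr rfl fun a _ => ?_
    rw [Set.ncard_prod, Nat.cast_mul]
  · rintro ⟨a, b⟩ _ ⟨c, d⟩ _ hne
    refine Set.disjoint_left.2 ?_
    rintro ⟨i, j⟩ ⟨⟨_, h1⟩, ⟨_, h2⟩⟩ ⟨⟨_, h3⟩, ⟨_, h4⟩⟩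
    apply hne
    simp only at h1 h2 h3 h4
    ext <;> simp <;> omega

theorem expand_theta {ι : Type*} (S : Set ι) (φ : ι → ℤ) (p : ℕ) (hp : p ≠ 0) :
    PowerSeries.expand p hp (theta S φ) = theta S fun i => p * φ i := by
  ext n
  rw [PowerSeries.coeff_expand]
  simp only [theta, PowerSeries.coeff_mk]
  have hp' : (p : ℤ) ≠ 0 := by exact_mod_cast hp
  split_ifs with h
  · obtain ⟨m, rfl⟩ := h
    rw [Nat.mul_div_cancel_left _ (Nat.pos_of_ne_zero hp)]
    congr 3
    ext i
    simp only [Nat.cast_mul, mul_right_inj' hp']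
  · have : {i ∈ S | (p : ℤ) * φ i = n} = ∅ := by
      ext i
      simp only [Set.mem_ofPred_eq, Set.mem_empty_iff_false, iff_false, not_and]
      intro _ h1
      exact h (Int.natCast_dvd_natCast.1 ⟨_, h1.symm⟩)
    rw [this]
    simp

theorem expand_two (f : (ZMod 2)⟦X⟧) : PowerSeries.expand 2 two_ne_zero f = f ^ 2 := by
  have h := MvPowerSeries.map_frobenius_expand (σ := Unit) (R := ZMod 2) (p := 2) two_ne_zero
    (f := f)
  have h2 : frobenius (ZMod 2) 2 = RingHom.id _ := by
    ext x
    exact ZMod.frobenius_zmod 2 ▸ rfl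
  rw [h2, MvPowerSeries.map_id] at h
  exact h

theorem expand_injective {R : Type*} [CommRing R] (p : ℕ) (hp : p ≠ 0) :
    Function.Injective (PowerSeries.expand (R := R) p hp) := by
  intro f g h
  ext n
  rw [← PowerSeries.coeff_expand_mul p hp f n, h, PowerSeries.coeff_expand_mul]

theorem finite_sq (S : Set ℤ) (n : ℕ) : {i ∈ S | i ^ 2 = (n : ℤ)}.Finite := by
  refine (Set.finite_Icc (-(n : ℤ)) n).subset ?_
  rintro i ⟨_, hi⟩
  constructor <;> nlinarith [sq_nonneg (i - 1), sq_nonneg (i + 1), sq_nonneg i]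

theorem finite_mul_sq (S : Set ℤ) (d : ℕ) (hd : d ≠ 0) (n : ℕ) :
    {i ∈ S | d * i ^ 2 = (n : ℤ)}.Finite := by
  refine (Set.finite_Icc (-(n : ℤ)) n).subset ?_
  have h1 : (1 : ℤ) ≤ d := by exact_mod_cast Nat.one_le_iff_ne_zero.2 hd
  rintro i ⟨_, hi⟩
  have h2 : i ^ 2 ≤ n := by nlinarith [sq_nonneg i]
  constructor <;> nlinarith [sq_nonneg (i - 1), sq_nonneg (i + 1), sq_nonneg i]

/-- The pairs `(x, y)` with `x ≡ y ≡ 1 (mod c)` and `x² + d y² = n`. -/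
def reps (c : ℤ) (d n : ℕ) : Set (ℤ × ℤ) :=
  {p | (p.1 % c = 1 ∧ p.2 % c = 1) ∧ p.1 ^ 2 + d * p.2 ^ 2 = n}

theorem finite_reps (c : ℤ) (d n : ℕ) (hd : d ≠ 0) : (reps c d n).Finite := by
  refine ((Set.finite_Icc (-(n : ℤ)) n).prod (Set.finite_Icc (-(n : ℤ)) n)).subset ?_
  have h1 : (1 : ℤ) ≤ d := by exact_mod_cast Nat.one_le_iff_ne_zero.2 hd
  rintro ⟨x, y⟩ ⟨_, hi⟩
  simp only at hi
  have h2 : x ^ 2 ≤ n := by nlinarith [sq_nonneg x, sq_nonneg y]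
  have h3 : y ^ 2 ≤ n := by nlinarith [sq_nonneg x, sq_nonneg y]
  refine ⟨⟨?_, ?_⟩, ⟨?_, ?_⟩⟩ <;> simp only <;>
    nlinarith [sq_nonneg (x - 1), sq_nonneg (x + 1), sq_nonneg (y - 1), sq_nonneg (y + 1)]

/-- The series `∑ q^(x²)` over the integers `x ≡ 1 (mod c)`. -/
noncomputable def sqSeries (c : ℤ) : (ZMod 2)⟦X⟧ := theta {x : ℤ | x % c = 1} fun x => x ^ 2

theorem coeff_sqSeries_mul_expand (c : ℤ) (d n : ℕ) (hd : d ≠ 0) :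
    PowerSeries.coeff n (sqSeries c * PowerSeries.expand d hd (sqSeries c)) =
      ((reps c d n).ncard : ZMod 2) := by
  rw [sqSeries, expand_theta, theta_mul (fun i => sq_nonneg i)
    (fun i => mul_nonneg (Int.natCast_nonneg d) (sq_nonneg i)) (finite_sq _)
    (finite_mul_sq _ d hd)]
  simp only [theta, PowerSeries.coeff_mk]
  rfl

theorem emod_four_sign {x : ℤ} (hx : x % 2 = 1) : x % 4 = 1 ∨ (-x) % 4 = 1 := by omega

/-- Of the two roots of an odd square exactly one is 1 modulo 4, so each odd square is counted once.
-/
theorem Delta_eq_sqSeries : Delta = sqSeries 4 := by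
  classical
  ext n
  simp only [Delta, sqSeries, theta, PowerSeries.coeff_mk]
  symm
  apply ncard_eq_ite_of_subsingleton
  · rintro x ⟨hx, h1⟩ y ⟨hy, h2⟩
    simp only [Set.mem_ofPred_eq] at hx hy
    rcases sq_eq_sq_iff_eq_or_eq_neg.1 (h1.trans h2.symm) with h | h <;> omega
  · constructor
    · rintro ⟨x, hx, h1⟩
      simp only [Set.mem_ofPred_eq] at hx
      refine ⟨x.natAbs / 2, ?_⟩
      rw [show 2 * (x.natAbs / 2) + 1 = x.natAbs by omega]
      zify
      rw [sq_abs, h1]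
    · rintro ⟨m, rfl⟩
      rcases emod_four_sign (x := 2 * m + 1) (by omega) with h | h
      · exact ⟨_, h, by push_cast; ring⟩
      · exact ⟨_, h, by push_cast; ring⟩

theorem coeff_expand_Delta (d : ℕ) (hd : d ≠ 0) (n : ℕ) [Decidable (∃ m : ℕ, n = d * (2 * m + 1) ^ 2)] :
    PowerSeries.coeff n (PowerSeries.expand d hd Delta) =
      if ∃ m : ℕ, n = d * (2 * m + 1) ^ 2 then 1 else 0 := by
  classical
  rw [PowerSeries.coeff_expand]
  split_ifs with h1 h2 h2
  · obtain ⟨m, rfl⟩ := h2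
    rw [Nat.mul_div_cancel_left _ (Nat.pos_of_ne_zero hd)]
    simp [Delta]
  · obtain ⟨k, rfl⟩ := h1
    rw [Nat.mul_div_cancel_left _ (Nat.pos_of_ne_zero hd)]
    simp only [mul_right_inj' hd] at h2
    simp [Delta, h2]
  · obtain ⟨m, rfl⟩ := h2
    exact absurd (Dvd.intro _ rfl) h1
  · rfl

theorem mem_reps {c : ℤ} {d n : ℕ} {x y : ℤ} :
    (x, y) ∈ reps c d n ↔ (x % c = 1 ∧ y % c = 1) ∧ x ^ 2 + d * y ^ 2 = n := Iff.rfl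

/-- `±x`, the sign being that of `ε`. -/
def signed (ε : Prop) [Decidable ε] (x : ℤ) : ℤ := if ε then x else -x

theorem emod_six_sign {x : ℤ} (h2 : x % 2 = 1) (h3 : x % 3 ≠ 0) : x % 6 = 1 ∨ (-x) % 6 = 1 := by
  have : x % 6 = 0 ∨ x % 6 = 1 ∨ x % 6 = 2 ∨ x % 6 = 3 ∨ x % 6 = 4 ∨ x % 6 = 5 := by omega
  rcases this with h | h | h | h | h | h <;> omega

theorem sq_emod_three (x : ℤ) : x % 3 = 0 ∧ x ^ 2 % 3 = 0 ∨ x % 3 ≠ 0 ∧ x ^ 2 % 3 = 1 := by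
  have : x % 3 = 0 ∨ x % 3 = 1 ∨ x % 3 = 2 := by omega
  rcases this with h | h | h <;> simp [h, sq, Int.mul_emod]

/-- If w ≡ -v modulo 3, then a v² + b w² ≡ (a + b) w² ≡ 0. It serves to show that the numbers
produced by the involutions below are prime to 3, so that one choice of sign makes them 1 modulo 6.
-/
theorem not_three_dvd_add {v w : ℤ} {m : ℤ} (hm : m % 3 ≠ 0)
    (h : ∃ a b : ℤ, a * v ^ 2 + b * w ^ 2 = m ∧ (a + b) % 3 = 0) : (v + w) % 3 ≠ 0 := by
  obtain ⟨a, b, h, hab⟩ := h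
  intro h0
  apply hm
  obtain ⟨k, hk⟩ := Int.dvd_of_emod_eq_zero h0
  obtain ⟨l, hl⟩ := Int.dvd_of_emod_eq_zero hab
  have : m = 3 * (a * k * (v - w) + l * w ^ 2) := by
    have e1 : v = 3 * k - w := by omega
    have e2 : a = 3 * l - b := by omega
    rw [← h, e2, e1]; ring
  omega

/-- An odd number which is a square is the square of an integer `≡ 1 (mod 6)` up to sign. -/
theorem exists_odd_sq_iff {m : ℕ} (h3 : (m : ℤ) % 3 ≠ 0) :
    (∃ u : ℕ, m = (2 * u + 1) ^ 2) ↔ ∃ x : ℤ, x % 6 = 1 ∧ x ^ 2 = m := by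
  constructor
  · rintro ⟨u, rfl⟩
    have : (2 * (u : ℤ) + 1) % 3 ≠ 0 := by
      intro h
      apply h3
      push_cast
      rw [sq, Int.mul_emod, h]
      rfl
    rcases emod_six_sign (x := 2 * u + 1) (by omega) this with h | h
    · exact ⟨_, h, by push_cast; ring⟩
    · exact ⟨_, h, by push_cast; ring⟩
  · rintro ⟨x, hx, h⟩
    refine ⟨x.natAbs / 2, ?_⟩
    rw [show 2 * (x.natAbs / 2) + 1 = x.natAbs by omega]
    zify
    rw [sq_abs, h]

theorem eq_of_sq_eq {x y c : ℤ} (hc : 2 < c) (hx : x % c = 1) (hy : y % c = 1)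
    (h : x ^ 2 = y ^ 2) : x = y := by
  rcases sq_eq_sq_iff_eq_or_eq_neg.1 h with h | h
  · exact h
  · exfalso
    subst h
    have h1 := Int.emod_add_mul_ediv (-y) c
    have h2 := Int.emod_add_mul_ediv y c
    rw [hx] at h1
    rw [hy] at h2
    have h3 : c * ((-y) / c + y / c) = -2 := by linarith
    have h4 : c ∣ 2 := ⟨-((-y) / c + y / c), by linarith⟩
    have := Int.le_of_dvd (by norm_num) h4
    omega

theorem odd_sq_mul_nine {m : ℕ} :
    (∃ u : ℕ, 9 * m = (2 * u + 1) ^ 2) ↔ ∃ u : ℕ, m = (2 * u + 1) ^ 2 := by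
  constructor
  · rintro ⟨u, h⟩
    have h3 : 3 ∣ 2 * u + 1 := Nat.prime_three.dvd_of_dvd_pow (n := 2) (by omega)
    obtain ⟨v, hv⟩ := h3
    refine ⟨v / 2, ?_⟩
    rw [show 2 * (v / 2) + 1 = v by omega]
    rw [hv] at h
    nlinarith
  · rintro ⟨u, rfl⟩
    exact ⟨3 * u + 1, by ring⟩

theorem not_odd_sq_three_mul {m : ℕ} (h3 : (m : ℤ) % 3 ≠ 0) :
    ¬ ∃ u : ℕ, 3 * m = (2 * u + 1) ^ 2 := by
  rintro ⟨u, h⟩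
  obtain ⟨v, hv⟩ : 3 ∣ 2 * u + 1 := Nat.prime_three.dvd_of_dvd_pow (n := 2) (by omega)
  rw [hv] at h
  have : m = 3 * v ^ 2 := by nlinarith
  omega

/-! ### The form `x² + 2y²` -/

/-- The involution sends x + y√-2 to ± its conjugate times (-1 + 2√-2)/3, an element of norm 1, the
sign being fixed by the congruence modulo 6. A fixed point for the sign + has x = y, hence x² = m;
the sign - would give x = -2y, against parity. -/
theorem card_reps_two_of_not_dvd (m : ℕ) (hm : (m : ℤ) % 3 ≠ 0)
    [Decidable (∃ u : ℕ, m = (2 * u + 1) ^ 2)] :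
    ((reps 6 2 (3 * m)).ncard : ZMod 2) = if ∃ u : ℕ, m = (2 * u + 1) ^ 2 then 1 else 0 := by
  have key : ∀ x y : ℤ, (x, y) ∈ reps 6 2 (3 * m) → ∃ z, x = y + 6 * z ∧
      ((y + 4 * z) % 6 = 1 ∨ (-(y + 4 * z)) % 6 = 1) := by
    intro x y h
    obtain ⟨⟨hx, hy⟩, h⟩ := mem_reps.1 h
    obtain ⟨z, hz⟩ : ∃ z, x = y + 6 * z := ⟨(x - y) / 6, by omega⟩
    subst hz
    push_cast at h
    have := not_three_dvd_add (v := y + 2 * z) (w := 2 * z) hm ⟨1, 2, by nlinarith, rfl⟩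
    exact ⟨z, rfl, emod_six_sign (by omega) (by omega)⟩
  rw [ncard_eq_ncard_fixed (finite_reps _ _ _ two_ne_zero) (fun p =>
    (signed (((2 * p.1 + p.2) / 3) % 6 = 1) ((4 * p.2 - p.1) / 3),
      signed (((2 * p.1 + p.2) / 3) % 6 = 1) ((2 * p.1 + p.2) / 3)))]
  · apply ncard_eq_ite_of_subsingleton
    · rintro ⟨x, y⟩ ⟨hp, h1⟩ ⟨x', y'⟩ ⟨hp', h1'⟩
      obtain ⟨⟨hx, hy⟩, h⟩ := mem_reps.1 hp
      obtain ⟨⟨hx', hy'⟩, h'⟩ := mem_reps.1 hp'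
      simp only [signed, Prod.mk.injEq] at h1 h1'
      have e1 : x = y := by split_ifs at h1 <;> omega
      have e2 : x' = y' := by split_ifs at h1' <;> omega
      subst e1 e2
      have : x = x' := eq_of_sq_eq (by norm_num) hx hx' (by push_cast at h h'; linarith)
      rw [this]
    · rw [exists_odd_sq_iff hm]
      constructor
      · rintro ⟨⟨x, y⟩, hp, h1⟩
        obtain ⟨⟨hx, hy⟩, h⟩ := mem_reps.1 hp
        simp only [signed, Prod.mk.injEq] at h1
        have e1 : x = y := by split_ifs at h1 <;> omega
        subst e1
        exact ⟨x, hx, by push_cast at h; linarith⟩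
      · rintro ⟨x, hx, h⟩
        refine ⟨(x, x), mem_reps.2 ⟨⟨hx, hx⟩, by push_cast; linarith⟩, ?_⟩
        simp only [signed, Prod.mk.injEq]
        rw [if_pos, if_pos] <;> omega
  · rintro ⟨x, y⟩ hp
    obtain ⟨z, rfl, hs⟩ := key _ _ hp
    obtain ⟨⟨hx, hy⟩, h⟩ := mem_reps.1 hp
    rw [mem_reps]
    simp only [signed]
    rw [show (2 * (y + 6 * z) + y) / 3 = y + 4 * z by omega,
      show (4 * y - (y + 6 * z)) / 3 = y - 2 * z by omega]
    push_cast at h ⊢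
    split_ifs with h1
    · exact ⟨by omega, by linear_combination h⟩
    · exact ⟨by omega, by linear_combination h⟩
  · rintro ⟨x, y⟩ hp
    obtain ⟨z, rfl, hs⟩ := key _ _ hp
    obtain ⟨⟨hx, hy⟩, h⟩ := mem_reps.1 hp
    simp only [signed, Prod.mk.injEq]
    rw [show (2 * (y + 6 * z) + y) / 3 = y + 4 * z by omega,
      show (4 * y - (y + 6 * z)) / 3 = y - 2 * z by omega]
    split_ifs <;> omega

theorem exists_eq_of_reps_two {m : ℕ} {x y : ℤ} (h : (x, y) ∈ reps 6 2 (9 * m)) :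
    ∃ z, x = 4 * y + 9 * z ∧ z % 2 = 1 ∧ 2 * (y + 2 * z) ^ 2 + z ^ 2 = m := by
  obtain ⟨⟨hx, hy⟩, h⟩ := mem_reps.1 h
  obtain ⟨t, ht⟩ : ∃ t, x = y + 6 * t := ⟨(x - y) / 6, by omega⟩
  subst ht
  push_cast at h
  obtain ⟨k, hk⟩ : ∃ k, y = 3 * k + 1 := ⟨y / 3, by omega⟩
  have h9 : y + t = 3 * (m - 3 * t ^ 2 - (y + t) * (k + t)) := by
    have e : 3 * (y + t) = 3 * (3 * (m - 3 * t ^ 2 - (y + t) * (k + t))) := by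
      linear_combination h - 3 * (y + t) * hk
    linarith
  obtain ⟨z, hz⟩ : ∃ z, y + 6 * t = 4 * y + 9 * z := ⟨(2 * t - y) / 3, by omega⟩
  refine ⟨z, hz, by omega, ?_⟩
  rw [hz] at h
  have e : 9 * (2 * (y + 2 * z) ^ 2 + z ^ 2) = 9 * (m : ℤ) := by linear_combination h
  linarith

/-- Here the involution is ± the conjugate times (7 + 4√-2)/9. A fixed point would force z = 0 or y
= -2z, while y and z are odd. -/
theorem card_reps_two_of_dvd (m : ℕ) (hm : (m : ℤ) % 3 ≠ 0) :
    ((reps 6 2 (9 * m)).ncard : ZMod 2) = 0 := by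
  have key : ∀ x y : ℤ, (x, y) ∈ reps 6 2 (9 * m) → ∃ z, x = 4 * y + 9 * z ∧ z % 2 = 1 ∧
      ((y + 4 * z) % 6 = 1 ∨ (-(y + 4 * z)) % 6 = 1) := by
    intro x y h
    obtain ⟨z, hz, hz2, h3⟩ := exists_eq_of_reps_two h
    obtain ⟨⟨hx, hy⟩, -⟩ := mem_reps.1 h
    have := not_three_dvd_add (v := -(y + 2 * z)) (w := z) hm ⟨2, 1, by linear_combination h3, rfl⟩
    have := not_three_dvd_add (v := y + 2 * z) (w := z) hm ⟨2, 1, by linear_combination h3, rfl⟩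
    exact ⟨z, hz, hz2, emod_six_sign (by omega) (by omega)⟩
  rw [ncard_eq_ncard_fixed (finite_reps _ _ _ two_ne_zero) (fun p =>
    (signed ((p.2 + 4 * ((p.1 - 4 * p.2) / 9)) % 6 = 1) (4 * p.2 + 7 * ((p.1 - 4 * p.2) / 9)),
      signed ((p.2 + 4 * ((p.1 - 4 * p.2) / 9)) % 6 = 1) (p.2 + 4 * ((p.1 - 4 * p.2) / 9))))]
  · convert Nat.cast_zero
    rw [Set.ncard_eq_zero ((finite_reps _ _ _ two_ne_zero).subset (Set.sep_subset _ _))]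
    ext ⟨x, y⟩
    simp only [Set.mem_ofPred_eq, Set.mem_empty_iff_false, iff_false, not_and]
    intro hp
    obtain ⟨z, rfl, hz, hs⟩ := key _ _ hp
    obtain ⟨⟨hx, hy⟩, -⟩ := mem_reps.1 hp
    rw [show (4 * y + 9 * z - 4 * y) / 9 = z by omega]
    simp only [signed, Prod.mk.injEq]
    split_ifs <;> omega
  · rintro ⟨x, y⟩ hp
    obtain ⟨z, rfl, hz, hs⟩ := key _ _ hp
    obtain ⟨⟨hx, hy⟩, h⟩ := mem_reps.1 hp
    rw [mem_reps]
    simp only [signed]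
    rw [show (4 * y + 9 * z - 4 * y) / 9 = z by omega]
    push_cast at h ⊢
    split_ifs with h1
    · exact ⟨by omega, by linear_combination h⟩
    · exact ⟨by omega, by linear_combination h⟩
  · rintro ⟨x, y⟩ hp
    obtain ⟨z, rfl, hz, hs⟩ := key _ _ hp
    obtain ⟨⟨hx, hy⟩, h⟩ := mem_reps.1 hp
    simp only [signed, Prod.mk.injEq]
    rw [show (4 * y + 9 * z - 4 * y) / 9 = z by omega]
    split_ifs <;> omega

/-- Multiplication by -1 + 2√-2, of norm 9, preserves the congruences modulo 6. It is onto because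
the representations of 27m turn out to be divisible by this element. -/
theorem card_reps_two_nine_mul (m : ℕ) :
    (reps 6 2 (9 * (3 * m))).ncard = (reps 6 2 (3 * m)).ncard := by
  symm
  refine Set.ncard_congr (fun p _ => (-p.1 - 4 * p.2, 2 * p.1 - p.2)) ?_ ?_ ?_
  · rintro ⟨x, y⟩ hp
    obtain ⟨⟨hx, hy⟩, h⟩ := mem_reps.1 hp
    rw [mem_reps]
    refine ⟨by omega, ?_⟩
    push_cast at h ⊢
    linear_combination 9 * h
  · rintro ⟨x, y⟩ ⟨x', y'⟩ _ _ h
    simp only [Prod.mk.injEq] at h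
    ext <;> simp only <;> omega
  · rintro ⟨x, y⟩ hp
    obtain ⟨z, rfl, hz, h⟩ := exists_eq_of_reps_two hp
    obtain ⟨⟨hx, hy⟩, -⟩ := mem_reps.1 hp
    have h3 : (y + 3 * z) * (y + z) = 3 * ((y + 2 * z) ^ 2 - m) := by
      push_cast at h
      linear_combination -h
    obtain ⟨k, hk⟩ : ∃ k, y = 3 * k + 1 := ⟨y / 3, by omega⟩
    have h4 : y + z = 3 * ((y + 2 * z) ^ 2 - m - (k + z) * (y + z)) := by
      linear_combination h3 - (y + z) * hk
    refine ⟨(-z, -(y + 2 * z)), mem_reps.2 ⟨by omega, ?_⟩, ?_⟩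
    · push_cast at h ⊢
      linear_combination h
    · simp only [Prod.mk.injEq]
      omega

-- Descent on the power of 3 dividing m, two factors at a time: neither the parity nor the condition
-- of being an odd square changes under m ↦ 9m.
open Classical in
theorem card_reps_two (m : ℕ) :
    ((reps 6 2 (3 * m)).ncard : ZMod 2) = if ∃ u : ℕ, m = (2 * u + 1) ^ 2 then 1 else 0 := by
  induction m using Nat.strong_induction_on with
  | _ m ih =>
    by_cases h1 : (m : ℤ) % 3 ≠ 0
    · exact card_reps_two_of_not_dvd m h1
    obtain ⟨k, rfl⟩ : ∃ k, m = 3 * k := ⟨m / 3, by omega⟩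
    by_cases h2 : (k : ℤ) % 3 ≠ 0
    · rw [if_neg (not_odd_sq_three_mul h2), ← mul_assoc]
      exact card_reps_two_of_dvd k h2
    obtain ⟨l, rfl⟩ : ∃ l, k = 3 * l := ⟨k / 3, by omega⟩
    rcases Nat.eq_zero_or_pos l with rfl | hl
    · have h0 : reps 6 2 (3 * (3 * (3 * 0))) = ∅ := by
        ext ⟨x, y⟩
        rw [mem_reps]
        simp only [Set.mem_empty_iff_false, iff_false, not_and]
        rintro ⟨hx, hy⟩ h
        push_cast at h
        have : x = 0 := by nlinarith [sq_nonneg x, sq_nonneg y]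
        omega
      have h5 : ¬ ∃ u : ℕ, 3 * (3 * 0) = (2 * u + 1) ^ 2 := by
        rintro ⟨u, hu⟩
        have : 0 < (2 * u + 1) ^ 2 := by positivity
        omega
      rw [h0, if_neg h5]
      simp
    · have h3 : (∃ u : ℕ, 3 * (3 * l) = (2 * u + 1) ^ 2) ↔ ∃ u : ℕ, l = (2 * u + 1) ^ 2 := by
        rw [show 3 * (3 * l) = 9 * l by ring, odd_sq_mul_nine]
      rw [show 3 * (3 * (3 * l)) = 9 * (3 * l) by ring, card_reps_two_nine_mul,
        ih l (by omega)]
      simp only [h3]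

/-! ### The form `x² + 5y²` -/

theorem reps_five_eq {x y : ℤ} {m : ℕ} (h : (x, y) ∈ reps 6 5 (6 * m)) :
    ∃ z, x = y + 6 * z ∧ (y + z) ^ 2 + 5 * z ^ 2 = m := by
  obtain ⟨⟨hx, hy⟩, h⟩ := mem_reps.1 h
  obtain ⟨z, hz⟩ : ∃ z, x = y + 6 * z := ⟨(x - y) / 6, by omega⟩
  subst hz
  push_cast at h
  refine ⟨z, rfl, ?_⟩
  have e : 6 * ((y + z) ^ 2 + 5 * z ^ 2) = 6 * (m : ℤ) := by linear_combination h
  linarith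

/-- The involution is ± the conjugate times (-2 + √-5)/3. Its fixed points are of two kinds: x = y,
with x² = m, and x = -5y, with 5y² = m. They exclude each other modulo 3. -/
theorem card_reps_five_of_not_dvd (m : ℕ) (h2 : (m : ℤ) % 2 = 1) (hm : (m : ℤ) % 3 ≠ 0)
    [Decidable ((∃ u : ℕ, m = (2 * u + 1) ^ 2) ∨ ∃ u : ℕ, m = 5 * (2 * u + 1) ^ 2)] :
    ((reps 6 5 (6 * m)).ncard : ZMod 2) =
      if (∃ u : ℕ, m = (2 * u + 1) ^ 2) ∨ ∃ u : ℕ, m = 5 * (2 * u + 1) ^ 2 then 1 else 0 := by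
  have key : ∀ x y : ℤ, (x, y) ∈ reps 6 5 (6 * m) → ∃ z, x = y + 6 * z ∧
      ((y + 2 * z) % 6 = 1 ∨ (-(y + 2 * z)) % 6 = 1) := by
    intro x y hp
    obtain ⟨z, hz, h⟩ := reps_five_eq hp
    obtain ⟨⟨hx, hy⟩, -⟩ := mem_reps.1 hp
    have := not_three_dvd_add (v := y + z) (w := z) hm ⟨1, 5, by linear_combination h, rfl⟩
    exact ⟨z, hz, emod_six_sign (by omega) (by omega)⟩
  have fixed : ∀ x y : ℤ, (x, y) ∈ reps 6 5 (6 * m) →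
      (signed (((x + 2 * y) / 3) % 6 = 1) ((5 * y - 2 * x) / 3) = x ∧
        signed (((x + 2 * y) / 3) % 6 = 1) ((x + 2 * y) / 3) = y ↔
      x = y ∧ x ^ 2 = m ∨ x = -5 * y ∧ 5 * y ^ 2 = m) := by
    intro x y hp
    obtain ⟨⟨hx, hy⟩, h⟩ := mem_reps.1 hp
    push_cast at h
    simp only [signed]
    constructor
    · intro h1
      have : x = y ∨ x = -5 * y := by split_ifs at h1 <;> omega
      rcases this with e | e
      · exact Or.inl ⟨e, by subst e; linarith⟩
      · exact Or.inr ⟨e, by subst e; linarith⟩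
    · rintro (⟨e, -⟩ | ⟨e, -⟩)
      · rw [if_pos (by omega), if_pos (by omega)]
        omega
      · rw [if_neg (by omega), if_neg (by omega)]
        omega
  rw [ncard_eq_ncard_fixed (finite_reps _ _ _ (by norm_num)) (fun p =>
    (signed (((p.1 + 2 * p.2) / 3) % 6 = 1) ((5 * p.2 - 2 * p.1) / 3),
      signed (((p.1 + 2 * p.2) / 3) % 6 = 1) ((p.1 + 2 * p.2) / 3)))]
  · apply ncard_eq_ite_of_subsingleton
    · rintro ⟨x, y⟩ ⟨hp, h1⟩ ⟨x', y'⟩ ⟨hp', h1'⟩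
      obtain ⟨⟨hx, hy⟩, h⟩ := mem_reps.1 hp
      obtain ⟨⟨hx', hy'⟩, h'⟩ := mem_reps.1 hp'
      simp only [Prod.mk.injEq] at h1 h1'
      rw [fixed _ _ hp] at h1
      rw [fixed _ _ hp'] at h1'
      have a1 := sq_emod_three x
      have a2 := sq_emod_three y
      have a3 := sq_emod_three x'
      have a4 := sq_emod_three y'
      have : y = y' := by
        rcases h1 with ⟨e1, e2⟩ | ⟨e1, e2⟩ <;> rcases h1' with ⟨e3, e4⟩ | ⟨e3, e4⟩
        · exact eq_of_sq_eq (by norm_num) hy hy' (by rw [← e1, ← e3, e2, e4])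
        · omega
        · omega
        · exact eq_of_sq_eq (by norm_num) hy hy' (by linarith)
      subst this
      have : x = x' := by
        rcases h1 with ⟨e1, e2⟩ | ⟨e1, e2⟩ <;> rcases h1' with ⟨e3, e4⟩ | ⟨e3, e4⟩ <;> omega
      rw [this]
    · constructor
      · rintro ⟨⟨x, y⟩, hp, h1⟩
        obtain ⟨⟨hx, hy⟩, h⟩ := mem_reps.1 hp
        simp only [Prod.mk.injEq] at h1
        rw [fixed _ _ hp] at h1
        rcases h1 with ⟨e1, e2⟩ | ⟨e1, e2⟩
        · exact Or.inl ((exists_odd_sq_iff hm).2 ⟨x, hx, e2⟩)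
        · right
          refine ⟨y.natAbs / 2, ?_⟩
          rw [show 2 * (y.natAbs / 2) + 1 = y.natAbs by omega]
          zify
          rw [sq_abs, e2]
      · rintro (h | ⟨u, hu⟩)
        · obtain ⟨x, hx, h⟩ := (exists_odd_sq_iff hm).1 h
          have hp : (x, x) ∈ reps 6 5 (6 * m) := mem_reps.2 ⟨⟨hx, hx⟩, by push_cast; linarith⟩
          refine ⟨(x, x), hp, ?_⟩
          simp only [Prod.mk.injEq]
          rw [fixed _ _ hp]
          exact Or.inl ⟨rfl, h⟩
        · obtain ⟨y, hy, h⟩ := (exists_odd_sq_iff (m := (2 * u + 1) ^ 2)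
            (by intro h0; apply hm; rw [hu]; push_cast at h0 ⊢; omega)).1 ⟨u, rfl⟩
          have h5 : 5 * y ^ 2 = (m : ℤ) := by rw [h, hu]; push_cast; ring
          have hp : (-5 * y, y) ∈ reps 6 5 (6 * m) :=
            mem_reps.2 ⟨⟨by omega, hy⟩, by push_cast; linarith⟩
          refine ⟨(-5 * y, y), hp, ?_⟩
          simp only [Prod.mk.injEq]
          rw [fixed _ _ hp]
          exact Or.inr ⟨rfl, h5⟩
  · rintro ⟨x, y⟩ hp
    obtain ⟨z, rfl, hs⟩ := key _ _ hp
    obtain ⟨⟨hx, hy⟩, h⟩ := mem_reps.1 hp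
    rw [mem_reps]
    simp only [signed]
    rw [show (y + 6 * z + 2 * y) / 3 = y + 2 * z by omega,
      show (5 * y - 2 * (y + 6 * z)) / 3 = y - 4 * z by omega]
    push_cast at h ⊢
    split_ifs with h1
    · exact ⟨by omega, by linear_combination h⟩
    · exact ⟨by omega, by linear_combination h⟩
  · rintro ⟨x, y⟩ hp
    obtain ⟨z, rfl, hs⟩ := key _ _ hp
    obtain ⟨⟨hx, hy⟩, h⟩ := mem_reps.1 hp
    simp only [signed, Prod.mk.injEq]
    rw [show (y + 6 * z + 2 * y) / 3 = y + 2 * z by omega,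
      show (5 * y - 2 * (y + 6 * z)) / 3 = y - 4 * z by omega]
    split_ifs <;> omega

theorem exists_eq_of_reps_five {m : ℕ} {x y : ℤ} (h : (x, y) ∈ reps 6 5 (18 * m)) :
    ∃ z, x = -2 * y + 9 * z ∧ z % 2 = 1 ∧ (y - 2 * z) ^ 2 + 5 * z ^ 2 = 2 * m := by
  obtain ⟨⟨hx, hy⟩, h⟩ := mem_reps.1 h
  obtain ⟨t, ht⟩ : ∃ t, x = y + 6 * t := ⟨(x - y) / 6, by omega⟩
  subst ht
  push_cast at h
  obtain ⟨k, hk⟩ : ∃ k, y = 3 * k + 1 := ⟨y / 3, by omega⟩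
  have h9 : y + 2 * t = 3 * (m - 2 * t ^ 2 - k * (y + 2 * t)) := by
    have e : 6 * (y + 2 * t) = 6 * (3 * (m - 2 * t ^ 2 - k * (y + 2 * t))) := by
      linear_combination h - 6 * (y + 2 * t) * hk
    linarith
  obtain ⟨z, hz⟩ : ∃ z, y + 6 * t = -2 * y + 9 * z := ⟨(y + 2 * t) / 3, by omega⟩
  refine ⟨z, hz, by omega, ?_⟩
  rw [hz] at h
  have e : 9 * ((y - 2 * z) ^ 2 + 5 * z ^ 2) = 9 * (2 * (m : ℤ)) := by linear_combination h
  linarith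

/-- The conjugate is multiplied by ±(1 + 4√-5)/9. A fixed point would force z = 0 or y = 2z, while y
and z are odd. -/
theorem card_reps_five_of_dvd (m : ℕ) (hm : (m : ℤ) % 3 ≠ 0) :
    ((reps 6 5 (18 * m)).ncard : ZMod 2) = 0 := by
  have key : ∀ x y : ℤ, (x, y) ∈ reps 6 5 (18 * m) → ∃ z, x = -2 * y + 9 * z ∧ z % 2 = 1 ∧
      ((y - 4 * z) % 6 = 1 ∨ (-(y - 4 * z)) % 6 = 1) := by
    intro x y h
    obtain ⟨z, hz, hz2, h3⟩ := exists_eq_of_reps_five h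
    obtain ⟨⟨hx, hy⟩, -⟩ := mem_reps.1 h
    have hm' : (2 * m : ℤ) % 3 ≠ 0 := by omega
    have := not_three_dvd_add (v := -(y - 2 * z)) (w := z) hm' ⟨1, 5, by linear_combination h3, rfl⟩
    have := not_three_dvd_add (v := y - 2 * z) (w := z) hm' ⟨1, 5, by linear_combination h3, rfl⟩
    exact ⟨z, hz, hz2, emod_six_sign (by omega) (by omega)⟩
  rw [ncard_eq_ncard_fixed (finite_reps _ _ _ (by norm_num)) (fun p =>
    (signed ((p.2 - 4 * ((p.1 + 2 * p.2) / 9)) % 6 = 1) (-2 * p.2 - ((p.1 + 2 * p.2) / 9)),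
      signed ((p.2 - 4 * ((p.1 + 2 * p.2) / 9)) % 6 = 1) (p.2 - 4 * ((p.1 + 2 * p.2) / 9))))]
  · convert Nat.cast_zero
    rw [Set.ncard_eq_zero ((finite_reps _ _ _ (by norm_num)).subset (Set.sep_subset _ _))]
    ext ⟨x, y⟩
    simp only [Set.mem_ofPred_eq, Set.mem_empty_iff_false, iff_false, not_and]
    intro hp
    obtain ⟨z, rfl, hz, hs⟩ := key _ _ hp
    obtain ⟨⟨hx, hy⟩, -⟩ := mem_reps.1 hp
    rw [show (-2 * y + 9 * z + 2 * y) / 9 = z by omega]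
    simp only [signed, Prod.mk.injEq]
    split_ifs <;> omega
  · rintro ⟨x, y⟩ hp
    obtain ⟨z, rfl, hz, hs⟩ := key _ _ hp
    obtain ⟨⟨hx, hy⟩, h⟩ := mem_reps.1 hp
    rw [mem_reps]
    simp only [signed]
    rw [show (-2 * y + 9 * z + 2 * y) / 9 = z by omega]
    push_cast at h ⊢
    split_ifs with h1
    · exact ⟨by omega, by linear_combination h⟩
    · exact ⟨by omega, by linear_combination h⟩
  · rintro ⟨x, y⟩ hp
    obtain ⟨z, rfl, hz, hs⟩ := key _ _ hp
    obtain ⟨⟨hx, hy⟩, h⟩ := mem_reps.1 hp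
    simp only [signed, Prod.mk.injEq]
    rw [show (-2 * y + 9 * z + 2 * y) / 9 = z by omega]
    split_ifs <;> omega

/-- The bijection is multiplication by 2 - √-5, of norm 9. -/
theorem card_reps_five_nine_mul (m : ℕ) :
    (reps 6 5 (18 * (3 * m))).ncard = (reps 6 5 (6 * m)).ncard := by
  symm
  refine Set.ncard_congr (fun p _ => (2 * p.1 + 5 * p.2, 2 * p.2 - p.1)) ?_ ?_ ?_
  · rintro ⟨x, y⟩ hp
    obtain ⟨⟨hx, hy⟩, h⟩ := mem_reps.1 hp
    rw [mem_reps]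
    refine ⟨by omega, ?_⟩
    push_cast at h ⊢
    linear_combination 9 * h
  · rintro ⟨x, y⟩ ⟨x', y'⟩ _ _ h
    simp only [Prod.mk.injEq] at h
    ext <;> simp only <;> omega
  · rintro ⟨x, y⟩ hp
    obtain ⟨z, rfl, hz, h⟩ := exists_eq_of_reps_five hp
    obtain ⟨⟨hx, hy⟩, -⟩ := mem_reps.1 hp
    have h3 : (y - 3 * z) * (y - z) = 3 * (2 * m - 2 * z ^ 2) := by
      push_cast at h
      linear_combination h
    obtain ⟨k, hk⟩ : ∃ k, y = 3 * k + 1 := ⟨y / 3, by omega⟩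
    have h4 : y - z = 3 * (2 * m - 2 * z ^ 2 - (k - z) * (y - z)) := by
      linear_combination h3 - (y - z) * hk
    refine ⟨(2 * z - y, z), mem_reps.2 ⟨by omega, ?_⟩, ?_⟩
    · push_cast at h ⊢
      linear_combination h
    · simp only [Prod.mk.injEq]
      omega

open Classical in
theorem card_reps_five (m : ℕ) (hodd : m % 2 = 1) :
    ((reps 6 5 (6 * m)).ncard : ZMod 2) =
      if (∃ u : ℕ, m = (2 * u + 1) ^ 2) ∨ ∃ u : ℕ, m = 5 * (2 * u + 1) ^ 2 then 1 else 0 := by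
  induction m using Nat.strong_induction_on with
  | _ m ih =>
    by_cases h1 : (m : ℤ) % 3 ≠ 0
    · exact card_reps_five_of_not_dvd m (by omega) h1
    obtain ⟨k, rfl⟩ : ∃ k, m = 3 * k := ⟨m / 3, by omega⟩
    have hsq5 : ∀ l : ℕ, (∃ u : ℕ, 9 * l = 5 * (2 * u + 1) ^ 2) ↔
        ∃ u : ℕ, l = 5 * (2 * u + 1) ^ 2 := by
      intro l
      constructor
      · rintro ⟨u, hu⟩
        obtain ⟨j, rfl⟩ : 5 ∣ l := by omega
        obtain ⟨v, rfl⟩ := odd_sq_mul_nine.1 ⟨u, (by omega : 9 * j = (2 * u + 1) ^ 2)⟩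
        exact ⟨v, rfl⟩
      · rintro ⟨u, rfl⟩
        obtain ⟨v, hv⟩ := odd_sq_mul_nine.2 ⟨u, rfl⟩
        exact ⟨v, by omega⟩
    by_cases h2 : (k : ℤ) % 3 ≠ 0
    · rw [if_neg, show 6 * (3 * k) = 18 * k by ring]
      · exact card_reps_five_of_dvd k h2
      · rintro (h | ⟨u, hu⟩)
        · exact not_odd_sq_three_mul h2 h
        · obtain ⟨j, rfl⟩ : 5 ∣ k := by omega
          exact not_odd_sq_three_mul (m := j) (by push_cast at h2; omega) ⟨u, by omega⟩
    obtain ⟨l, rfl⟩ : ∃ l, k = 3 * l := ⟨k / 3, by omega⟩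
    rw [show 6 * (3 * (3 * l)) = 18 * (3 * l) by ring, card_reps_five_nine_mul,
      ih l (by omega) (by omega)]
    simp only [show 3 * (3 * l) = 9 * l by ring, odd_sq_mul_nine, hsq5]

/-! ### The form `x² + 3y²` -/

-- The involution is ± the conjugate times the sixth root of unity (1 - √-3)/2. Its fixed points are
-- x = y and x = -3y, giving n = 4y² and n = 12y².
open Classical in
theorem card_reps_three (n : ℕ) :
    ((reps 4 3 n).ncard : ZMod 2) =
      if (∃ u : ℕ, n = 4 * (2 * u + 1) ^ 2) ∨ ∃ u : ℕ, n = 12 * (2 * u + 1) ^ 2 then 1 else 0 := by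
  have fixed : ∀ x y : ℤ, (x, y) ∈ reps 4 3 n →
      (signed ((-((x + y) / 2)) % 4 = 1) ((x - 3 * y) / 2) = x ∧
        signed ((-((x + y) / 2)) % 4 = 1) (-((x + y) / 2)) = y ↔
      x = y ∧ 4 * y ^ 2 = n ∨ x = -3 * y ∧ 12 * y ^ 2 = n) := by
    intro x y hp
    obtain ⟨⟨hx, hy⟩, h⟩ := mem_reps.1 hp
    push_cast at h
    simp only [signed]
    constructor
    · intro h1
      have : x = y ∨ x = -3 * y := by split_ifs at h1 <;> omega
      rcases this with e | e
      · exact Or.inl ⟨e, by subst e; linarith⟩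
      · exact Or.inr ⟨e, by subst e; linarith⟩
    · rintro (⟨e, -⟩ | ⟨e, -⟩)
      · rw [if_neg (by omega), if_neg (by omega)]
        omega
      · rw [if_pos (by omega), if_pos (by omega)]
        omega
  have ex : ∀ c : ℤ, (∃ u : ℕ, (n : ℤ) = c * (2 * u + 1) ^ 2) ↔
      ∃ y : ℤ, y % 4 = 1 ∧ c * y ^ 2 = n := by
    intro c
    constructor
    · rintro ⟨u, hu⟩
      rcases emod_four_sign (x := 2 * u + 1) (by omega) with h | h
      · exact ⟨_, h, by rw [hu]⟩
      · exact ⟨_, h, by rw [hu]; ring⟩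
    · rintro ⟨x, hx, h⟩
      refine ⟨x.natAbs / 2, ?_⟩
      rw [show 2 * ((x.natAbs / 2 : ℕ) : ℤ) + 1 = x.natAbs by omega, Int.natCast_natAbs, sq_abs, h]
  rw [ncard_eq_ncard_fixed (finite_reps _ _ _ (by norm_num)) (fun p =>
    (signed ((-((p.1 + p.2) / 2)) % 4 = 1) ((p.1 - 3 * p.2) / 2),
      signed ((-((p.1 + p.2) / 2)) % 4 = 1) (-((p.1 + p.2) / 2))))]
  · apply ncard_eq_ite_of_subsingleton
    · rintro ⟨x, y⟩ ⟨hp, h1⟩ ⟨x', y'⟩ ⟨hp', h1'⟩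
      obtain ⟨⟨hx, hy⟩, h⟩ := mem_reps.1 hp
      obtain ⟨⟨hx', hy'⟩, h'⟩ := mem_reps.1 hp'
      simp only [Prod.mk.injEq] at h1 h1'
      rw [fixed _ _ hp] at h1
      rw [fixed _ _ hp'] at h1'
      have odd : ∀ z : ℤ, z % 4 = 1 → z ^ 2 % 8 = 1 := by
        intro z hz
        obtain ⟨k, rfl⟩ : ∃ k, z = 4 * k + 1 := ⟨z / 4, by omega⟩
        have : (4 * k + 1) ^ 2 = 8 * (2 * k ^ 2 + k) + 1 := by ring
        omega
      have a2 := odd y hy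
      have a4 := odd y' hy'
      have : y = y' := by
        rcases h1 with ⟨e1, e2⟩ | ⟨e1, e2⟩ <;> rcases h1' with ⟨e3, e4⟩ | ⟨e3, e4⟩
        · exact eq_of_sq_eq (by norm_num) hy hy' (by linarith)
        · omega
        · omega
        · exact eq_of_sq_eq (by norm_num) hy hy' (by linarith)
      subst this
      have : x = x' := by
        rcases h1 with ⟨e1, e2⟩ | ⟨e1, e2⟩ <;> rcases h1' with ⟨e3, e4⟩ | ⟨e3, e4⟩ <;> omega
      rw [this]
    · have ex4 := ex 4
      have ex12 := ex 12
      norm_cast at ex4 ex12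
      rw [ex4, ex12]
      constructor
      · rintro ⟨⟨x, y⟩, hp, h1⟩
        obtain ⟨⟨hx, hy⟩, h⟩ := mem_reps.1 hp
        simp only [Prod.mk.injEq] at h1
        rw [fixed _ _ hp] at h1
        exact h1.imp (fun e => ⟨y, hy, e.2⟩) (fun e => ⟨y, hy, e.2⟩)
      · rintro (⟨y, hy, h⟩ | ⟨y, hy, h⟩)
        · have hp : (y, y) ∈ reps 4 3 n := mem_reps.2 ⟨⟨hy, hy⟩, by push_cast; linarith⟩
          refine ⟨(y, y), hp, ?_⟩
          simp only [Prod.mk.injEq]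
          rw [fixed _ _ hp]
          exact Or.inl ⟨rfl, h⟩
        · have hp : (-3 * y, y) ∈ reps 4 3 n :=
            mem_reps.2 ⟨⟨by omega, hy⟩, by push_cast; linarith⟩
          refine ⟨(-3 * y, y), hp, ?_⟩
          simp only [Prod.mk.injEq]
          rw [fixed _ _ hp]
          exact Or.inr ⟨rfl, h⟩
  · rintro ⟨x, y⟩ hp
    obtain ⟨⟨hx, hy⟩, h⟩ := mem_reps.1 hp
    obtain ⟨z, rfl⟩ : ∃ z, x = y + 4 * z := ⟨(x - y) / 4, by omega⟩
    rw [mem_reps]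
    simp only [signed]
    rw [show (y + 4 * z + y) / 2 = y + 2 * z by omega,
      show (y + 4 * z - 3 * y) / 2 = 2 * z - y by omega]
    push_cast at h ⊢
    split_ifs with h1
    · exact ⟨by omega, by linear_combination h⟩
    · exact ⟨by omega, by linear_combination h⟩
  · rintro ⟨x, y⟩ hp
    obtain ⟨⟨hx, hy⟩, h⟩ := mem_reps.1 hp
    obtain ⟨z, rfl⟩ : ∃ z, x = y + 4 * z := ⟨(x - y) / 4, by omega⟩
    simp only [signed, Prod.mk.injEq]
    rw [show (y + 4 * z + y) / 2 = y + 2 * z by omega,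
      show (y + 4 * z - 3 * y) / 2 = 2 * z - y by omega]
    split_ifs <;> omega

/-! ### The modular equations of levels 3 and 5 -/

instance : CharP (ZMod 2)⟦X⟧ 2 :=
  charP_of_injective_algebraMap (FaithfulSMul.algebraMap_injective (ZMod 2) (ZMod 2)⟦X⟧) 2

/-- In characteristic 2 the left side is Δ(q^4) + Δ(q^12), and the right side counts representations
by x² + 3y² with x and y both 1 modulo 4. -/
theorem modular_equation_three :
    (Delta + PowerSeries.expand 3 three_ne_zero Delta) ^ 4 =
      Delta * PowerSeries.expand 3 three_ne_zero Delta := by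
  classical
  have e : ∀ f : (ZMod 2)⟦X⟧, f ^ 4 = PowerSeries.expand 4 four_ne_zero f := by
    intro f
    rw [PowerSeries.expand_mul 2 two_ne_zero 2 two_ne_zero, expand_two, expand_two]
    ring
  rw [e, map_add, ← PowerSeries.expand_mul]
  ext n
  conv_rhs => rw [Delta_eq_sqSeries, coeff_sqSeries_mul_expand, card_reps_three]
  rw [map_add, coeff_expand_Delta, coeff_expand_Delta]
  by_cases h1 : ∃ u : ℕ, n = 4 * (2 * u + 1) ^ 2
  · have h2 : ¬ ∃ u : ℕ, n = 4 * 3 * (2 * u + 1) ^ 2 := by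
      rintro ⟨v, hv⟩
      obtain ⟨u, hu⟩ := h1
      have a1 : (2 * u + 1) ^ 2 = 4 * (u ^ 2 + u) + 1 := by ring
      have a2 : (2 * v + 1) ^ 2 = 4 * (v ^ 2 + v) + 1 := by ring
      omega
    rw [if_pos h1, if_neg h2, if_pos (Or.inl h1), add_zero]
  · simp only [h1, if_false, false_or, zero_add]

/-- By Euler's pentagonal number theorem `sqSeries 6` is η(24τ) modulo 2, and this is Jacobi's
formula for its cube. Writing f³ = f(q) f(q²) reduces it to x² + 2y². -/
theorem sqSeries_six_cube : sqSeries 6 ^ 3 = PowerSeries.expand 3 three_ne_zero Delta := by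
  classical
  rw [pow_succ', ← expand_two]
  ext n
  rw [coeff_sqSeries_mul_expand, coeff_expand_Delta]
  by_cases h : 3 ∣ n
  · obtain ⟨m, rfl⟩ := h
    rw [card_reps_two]
    simp only [mul_right_inj' three_ne_zero]
  · rw [if_neg (by rintro ⟨m, rfl⟩; exact h (Dvd.intro _ rfl))]
    convert Nat.cast_zero
    rw [Set.ncard_eq_zero (finite_reps _ _ _ two_ne_zero)]
    ext ⟨x, y⟩
    simp only [Set.mem_empty_iff_false, iff_false]
    rintro ⟨⟨hx, hy⟩, hn⟩
    have a1 := sq_emod_three x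
    have a2 := sq_emod_three y
    simp only at hx hy hn
    omega

theorem sqSeries_six_mul_expand_five :
    sqSeries 6 * PowerSeries.expand 5 (by norm_num) (sqSeries 6) =
      PowerSeries.expand 6 (by norm_num) Delta + PowerSeries.expand 30 (by norm_num) Delta := by
  classical
  ext n
  rw [coeff_sqSeries_mul_expand, map_add, coeff_expand_Delta, coeff_expand_Delta]
  have odd : ∀ u : ℕ, (2 * u + 1) ^ 2 % 4 = 1 := by
    intro u
    have a1 : (2 * u + 1) ^ 2 = 4 * (u ^ 2 + u) + 1 := by ring
    omega
  by_cases h : ∃ m, n = 6 * m ∧ m % 2 = 1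
  · obtain ⟨m, rfl, hm⟩ := h
    rw [card_reps_five m hm]
    have e1 : (∃ u : ℕ, 6 * m = 30 * (2 * u + 1) ^ 2) ↔ ∃ u : ℕ, m = 5 * (2 * u + 1) ^ 2 :=
      exists_congr fun u => by omega
    have e2 : (∃ u : ℕ, 6 * m = 6 * (2 * u + 1) ^ 2) ↔ ∃ u : ℕ, m = (2 * u + 1) ^ 2 :=
      exists_congr fun u => by omega
    simp only [e1, e2]
    by_cases h1 : ∃ u : ℕ, m = (2 * u + 1) ^ 2
    -- A number that is both a square and five times a square would have a 5-adic valuation both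
    -- even and odd.
    · have h2 : ¬ ∃ u : ℕ, m = 5 * (2 * u + 1) ^ 2 := by
        rintro ⟨v, hv⟩
        obtain ⟨u, hu⟩ := h1
        have h5 : 5 ∣ 2 * u + 1 := Nat.prime_five.dvd_of_dvd_pow (n := 2) (by omega)
        obtain ⟨w, hw⟩ := h5
        rw [hv, hw] at hu
        have hu' : (2 * v + 1) ^ 2 = 5 * w ^ 2 := by nlinarith
        have h5 := congrArg (fun t => padicValNat 5 t) hu'
        have hw0 : w ≠ 0 := by omega
        have : Fact (Nat.Prime 5) := ⟨Nat.prime_five⟩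
        rw [padicValNat.mul (by norm_num) (by positivity), padicValNat.pow, padicValNat.pow,
          padicValNat_self] at h5
        omega
      rw [if_pos h1, if_neg h2, if_pos (Or.inl h1), add_zero]
    · simp only [h1, if_false, false_or, zero_add]
  · rw [if_neg, if_neg]
    · rw [add_zero]
      convert Nat.cast_zero
      rw [Set.ncard_eq_zero (finite_reps _ _ _ (by norm_num))]
      ext ⟨x, y⟩
      simp only [Set.mem_empty_iff_false, iff_false]
      rintro ⟨⟨hx, hy⟩, hn⟩
      simp only at hx hy hn
      obtain ⟨a, rfl⟩ : ∃ a, x = 6 * a + 1 := ⟨x / 6, by omega⟩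
      obtain ⟨b, rfl⟩ : ∃ b, y = 6 * b + 1 := ⟨y / 6, by omega⟩
      have e1 : a * (3 * a + 1) % 2 = 0 := by
        rcases Int.emod_two_eq_zero_or_one a with h | h <;> simp [Int.mul_emod, Int.add_emod, h]
      have e2 : b * (3 * b + 1) % 2 = 0 := by
        rcases Int.emod_two_eq_zero_or_one b with h | h <;> simp [Int.mul_emod, Int.add_emod, h]
      -- Since a(3a + 1) and b(3b + 1) are even, n ≡ 6 modulo 24, so n is 6 times an odd number.
      have e3 : (n : ℤ) = 12 * (a * (3 * a + 1)) + 60 * (b * (3 * b + 1)) + 6 := by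
        rw [← hn]; push_cast; ring
      exact h ⟨n / 6, by omega, by omega⟩
    · rintro ⟨u, hu⟩
      have := odd u
      exact h ⟨n / 6, by omega, by omega⟩
    · rintro ⟨u, hu⟩
      have := odd u
      exact h ⟨n / 6, by omega, by omega⟩

/-- With f = `sqSeries 6`, cubing f(q) f(q^5) = Δ(q^6) + Δ(q^30) and using f³ = Δ(q^3) gives the
equation with q replaced by q^3. That substitution is injective. -/
theorem modular_equation_five :
    (Delta + PowerSeries.expand 5 (by norm_num) Delta) ^ 6 =
      Delta * PowerSeries.expand 5 (by norm_num) Delta := by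
  apply expand_injective 3 three_ne_zero
  have h := congrArg (fun f => f ^ 3) sqSeries_six_mul_expand_five
  simp only [mul_pow] at h
  rw [← map_pow, sqSeries_six_cube, ← PowerSeries.expand_mul] at h
  rw [map_mul, map_pow, map_add, ← PowerSeries.expand_mul, show (6 : ℕ) = 2 * 3 from rfl, pow_mul,
    ← expand_two, map_add, ← PowerSeries.expand_mul, ← PowerSeries.expand_mul]
  exact h.symm

/-! ### Recurrences for the Hecke operators -/

/-- The operator `∑ a_m q^m ↦ ∑ a_{pm} q^m`. -/
noncomputable def opU (p : ℕ) : (ZMod 2)⟦X⟧ →ₗ[ZMod 2] (ZMod 2)⟦X⟧ where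
  toFun f := PowerSeries.mk fun m => PowerSeries.coeff (p * m) f
  map_add' f g := by ext; simp
  map_smul' c f := by ext; simp

theorem heckeT_eq (p : ℕ) (hp : p ≠ 0) (f : (ZMod 2)⟦X⟧) :
    heckeT p f = opU p f + PowerSeries.expand p hp f := by
  ext m
  rw [coeff_heckeT, map_add, PowerSeries.coeff_expand]
  simp [opU]

/-- Only exponents divisible by p in f can meet those of g(q^p) in an exponent divisible by p. This
linearity over series in q^p turns an algebraic relation into a recurrence. -/
theorem opU_mul_expand (p : ℕ) (hp : p ≠ 0) (f g : (ZMod 2)⟦X⟧) :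
    opU p (f * PowerSeries.expand p hp g) = opU p f * g := by
  classical
  ext m
  simp only [opU, LinearMap.coe_mk, AddHom.coe_mk, PowerSeries.coeff_mk, PowerSeries.coeff_mul]
  symm
  apply Finset.sum_of_injOn (fun a : ℕ × ℕ => (p * a.1, p * a.2))
  · rintro ⟨a, b⟩ _ ⟨c, d⟩ _ h
    simpa [hp] using h
  · rintro ⟨a, b⟩ h
    simp only [Finset.mem_coe, Finset.HasAntidiagonal.mem_antidiagonal] at h ⊢
    rw [← h, mul_add]
  · rintro ⟨i, j⟩ h h'
    simp only [Finset.HasAntidiagonal.mem_antidiagonal] at h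
    rw [PowerSeries.coeff_expand_of_not_dvd, mul_zero]
    rintro ⟨b, rfl⟩
    apply h'
    have hi : p ∣ i := (Nat.dvd_add_left ⟨b, rfl⟩).1 (h ▸ ⟨m, rfl⟩)
    obtain ⟨a, rfl⟩ := hi
    refine ⟨(a, b), ?_, rfl⟩
    simp only [Finset.mem_coe, Finset.HasAntidiagonal.mem_antidiagonal]
    rw [← mul_add] at h
    exact Nat.eq_of_mul_eq_mul_left (Nat.pos_of_ne_zero hp) h
  · rintro ⟨a, b⟩ _
    simp only
    rw [PowerSeries.coeff_expand_mul]

theorem relation_three {t y : (ZMod 2)⟦X⟧} (h : (t + y) ^ 4 = t * y) :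
    y ^ 4 = t ^ 4 + t * y := by
  have h2 : (2 : (ZMod 2)⟦X⟧) = 0 := CharTwo.two_eq_zero
  linear_combination h - (t ^ 4 + 2 * t ^ 3 * y + 3 * t ^ 2 * y ^ 2 + 2 * t * y ^ 3) * h2

/-- A multiple of (t + y)^6 - t y modulo 2. Its main terms t^16 + t^4 y^4 = (t^4 + t y)^4 are those
of the level 3 relation, so that up to the lighter terms t^8 and t^3 y the operators T_3 and T_5
obey recurrences of the same shape. -/
theorem relation_five {t y : (ZMod 2)⟦X⟧} (h : (t + y) ^ 6 = t * y) :
    y ^ 16 = t ^ 16 + t ^ 8 + t ^ 4 * y ^ 4 + t ^ 3 * y := by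
  have h2 : (2 : (ZMod 2)⟦X⟧) = 0 := CharTwo.two_eq_zero
  linear_combination
    (y ^ 10 + t * y ^ 5 + t ^ 2 + t ^ 2 * y ^ 8 + t ^ 5 * y + t ^ 8 * y ^ 2 + t ^ 10) * h -
      (3 * t * y ^ 15 + 3 * t ^ 2 * y ^ 10 + 8 * t ^ 2 * y ^ 14 + 3 * t ^ 3 * y ^ 5 +
        7 * t ^ 3 * y ^ 9 + 13 * t ^ 3 * y ^ 13 + 8 * t ^ 4 * y ^ 4 + 10 * t ^ 4 * y ^ 8 +
        15 * t ^ 4 * y ^ 12 + 10 * t ^ 5 * y ^ 3 + 8 * t ^ 5 * y ^ 7 + 13 * t ^ 5 * y ^ 11 +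
        7 * t ^ 6 * y ^ 2 + 6 * t ^ 6 * y ^ 6 + 8 * t ^ 6 * y ^ 10 + 3 * t ^ 7 * y +
        8 * t ^ 7 * y ^ 5 + 3 * t ^ 7 * y ^ 9 + 1 * t ^ 8 + 10 * t ^ 8 * y ^ 4 +
        1 * t ^ 8 * y ^ 8 + 7 * t ^ 9 * y ^ 3 + 3 * t ^ 9 * y ^ 7 + 3 * t ^ 10 * y ^ 2 +
        8 * t ^ 10 * y ^ 6 + 13 * t ^ 11 * y ^ 5 + 15 * t ^ 12 * y ^ 4 + 13 * t ^ 13 * y ^ 3 +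
        8 * t ^ 14 * y ^ 2 + 3 * t ^ 15 * y + 1 * t ^ 16) * h2

/-- The linear recurrence for `k ↦ T_3(Δ^k)` given by the symmetric relation between `Δ` and
`Δ(q^3)`. -/
theorem heckeT_three_recurrence (r k : ℕ) :
    heckeT 3 (Delta ^ (k + 4 * 2 ^ r)) = Delta ^ (4 * 2 ^ r) * heckeT 3 (Delta ^ k) +
      Delta ^ 2 ^ r * heckeT 3 (Delta ^ (k + 2 ^ r)) := by
  set y := PowerSeries.expand 3 three_ne_zero Delta with hy
  have h1 := relation_three modular_equation_three
  -- By symmetry the relation also holds with Δ and Δ(q^3) exchanged: it writes Δ^4 through powers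
  -- of Δ(q^3), which pass through `opU`. The relation `h1` serves the other half of T_3.
  have h2 := relation_three (t := y) (y := Delta) (by rw [add_comm, modular_equation_three, mul_comm])
  rw [← hy] at h1
  replace h1 := congrArg (fun f => f ^ 2 ^ r) h1
  replace h2 := congrArg (fun f => f ^ 2 ^ r) h2
  simp only [add_pow_char_pow, mul_pow, ← pow_mul] at h1 h2
  have hU : ∀ (f : (ZMod 2)⟦X⟧) (j : ℕ), opU 3 (f * y ^ j) = opU 3 f * Delta ^ j := by
    intro f j
    rw [hy, ← map_pow, opU_mul_expand]
  simp only [heckeT_eq 3 three_ne_zero, map_pow, ← hy]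
  have e : opU 3 (Delta ^ (k + 4 * 2 ^ r)) = Delta ^ (4 * 2 ^ r) * opU 3 (Delta ^ k) +
      Delta ^ 2 ^ r * opU 3 (Delta ^ (k + 2 ^ r)) := by
    conv_lhs => rw [pow_add, h2]
    rw [mul_add, mul_comm (y ^ 2 ^ r), ← mul_assoc, map_add, hU, hU, ← pow_add]
    ring
  rw [e, pow_add y, h1]
  ring

theorem heckeT_five_recurrence (r k : ℕ) :
    heckeT 5 (Delta ^ (k + 16 * 2 ^ r)) =
      (Delta ^ (16 * 2 ^ r) + Delta ^ (8 * 2 ^ r)) * heckeT 5 (Delta ^ k) +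
      Delta ^ (4 * 2 ^ r) * heckeT 5 (Delta ^ (k + 4 * 2 ^ r)) +
      Delta ^ (3 * 2 ^ r) * heckeT 5 (Delta ^ (k + 2 ^ r)) := by
  set y := PowerSeries.expand 5 (by norm_num) Delta with hy
  have h1 := relation_five modular_equation_five
  have h2 := relation_five (t := y) (y := Delta) (by rw [add_comm, modular_equation_five, mul_comm])
  rw [← hy] at h1
  replace h1 := congrArg (fun f => f ^ 2 ^ r) h1
  replace h2 := congrArg (fun f => f ^ 2 ^ r) h2
  simp only [add_pow_char_pow, mul_pow, ← pow_mul] at h1 h2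
  have hU : ∀ (f : (ZMod 2)⟦X⟧) (j : ℕ), opU 5 (f * y ^ j) = opU 5 f * Delta ^ j := by
    intro f j
    rw [hy, ← map_pow, opU_mul_expand]
  simp only [heckeT_eq 5 (by norm_num), map_pow, ← hy]
  have e : opU 5 (Delta ^ (k + 16 * 2 ^ r)) =
      (Delta ^ (16 * 2 ^ r) + Delta ^ (8 * 2 ^ r)) * opU 5 (Delta ^ k) +
      Delta ^ (4 * 2 ^ r) * opU 5 (Delta ^ (k + 4 * 2 ^ r)) +
      Delta ^ (3 * 2 ^ r) * opU 5 (Delta ^ (k + 2 ^ r)) := by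
    conv_lhs => rw [pow_add, h2]
    rw [mul_add, mul_add, mul_add, mul_comm (y ^ (4 * 2 ^ r)),
      mul_comm (y ^ (3 * 2 ^ r)), ← mul_assoc, ← mul_assoc, map_add, map_add, map_add, hU, hU, hU,
      hU, ← pow_add, ← pow_add]
    ring
  rw [e, pow_add y, h1]
  ring

theorem heckeT_sq (p : ℕ) (hp : p ≠ 0) (f : (ZMod 2)⟦X⟧) (hpp : Nat.Coprime p 2) :
    heckeT p (f ^ 2) = heckeT p f ^ 2 := by
  rw [← expand_two, ← expand_two]
  ext m
  simp only [coeff_heckeT, PowerSeries.coeff_expand]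
  have e1 : 2 ∣ p * m ↔ 2 ∣ m := hpp.symm.dvd_mul_left
  by_cases h : 2 ∣ m
  · obtain ⟨k, rfl⟩ := h
    have e2 : p ∣ 2 * k ↔ p ∣ k := hpp.dvd_mul_left
    rw [if_pos (e1.2 ⟨k, rfl⟩), if_pos (Dvd.intro k rfl), Nat.mul_div_cancel_left _ two_pos,
      mul_left_comm,
      Nat.mul_div_cancel_left _ two_pos]
    simp only [e2]
    by_cases h' : p ∣ k
    · obtain ⟨l, rfl⟩ := h'
      rw [mul_left_comm 2 p l, Nat.mul_div_cancel_left _ (Nat.pos_of_ne_zero hp),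
        Nat.mul_div_cancel_left _ (Nat.pos_of_ne_zero hp), if_pos (Dvd.intro l rfl),
        Nat.mul_div_cancel_left _ two_pos, if_pos (Dvd.intro l rfl)]
      simp
    · simp [h']
  · rw [if_neg (e1.not.2 h), if_neg h, zero_add]
    split_ifs with h1 h2
    · exact absurd (h2.trans (Nat.div_dvd_of_dvd h1)) h
    · rfl
    · rfl

/-! Initial values -/

theorem coeff_Delta_zero : PowerSeries.coeff 0 Delta = 0 := by
  classical
  simp only [Delta, PowerSeries.coeff_mk]
  rw [if_neg]
  rintro ⟨m, hm⟩
  have : 0 < (2 * m + 1) ^ 2 := by positivity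
  omega

theorem coeff_Delta_one : PowerSeries.coeff 1 Delta = 1 := by
  classical
  simp only [Delta, PowerSeries.coeff_mk]
  rw [if_pos ⟨0, rfl⟩]

theorem heckeT_one (p : ℕ) (hp : p ≠ 0) : heckeT p 1 = 0 := by
  have : opU p 1 = 1 := by
    ext m
    simp [opU, PowerSeries.coeff_one, hp]
  rw [heckeT_eq p hp, this, map_one, CharTwo.add_self_eq_zero]

/-! ### Integral modular forms of level 1 and their reduction modulo 2 -/

section Integrality

open UpperHalfPlane ModularForm ModularFormClass MatrixGroups EisensteinSeries

/-- The reduction modulo 2 of an integral power series. -/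
noncomputable abbrev redTwo : ℤ⟦X⟧ →+* (ZMod 2)⟦X⟧ := PowerSeries.map (Int.castRingHom (ZMod 2))

/-- The series `∑_{n ≥ 1} σ_k(n) q^n`. -/
noncomputable def sigmaSeries (k : ℕ) : ℤ⟦X⟧ :=
  PowerSeries.mk fun n => (ArithmeticFunction.sigma k n : ℤ)

theorem qExpansion_E₄ :
    qExpansion 1 E₄ = PowerSeries.map (Int.castRingHom ℂ) (1 + 240 * sigmaSeries 3) := by
  have h240 : (240 : ℤ⟦X⟧) = PowerSeries.C 240 := by simp
  ext n
  rw [E_qExpansion_coeff _ ⟨2, rfl⟩, h240]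
  simp only [PowerSeries.coeff_map, map_add, PowerSeries.coeff_one, PowerSeries.coeff_C_mul,
    sigmaSeries, PowerSeries.coeff_mk]
  rcases eq_or_ne n 0 with rfl | hn
  · simp
  · simp only [hn, if_false]
    norm_num [show bernoulli 4 = -1 / 30 by decide +kernel]

theorem qExpansion_E₆ :
    qExpansion 1 E₆ = PowerSeries.map (Int.castRingHom ℂ) (1 - 504 * sigmaSeries 5) := by
  have h504 : (504 : ℤ⟦X⟧) = PowerSeries.C 504 := by simp
  ext n
  rw [E_qExpansion_coeff _ ⟨3, rfl⟩, h504]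
  simp only [PowerSeries.coeff_map, map_sub, PowerSeries.coeff_one, PowerSeries.coeff_C_mul,
    sigmaSeries, PowerSeries.coeff_mk]
  rcases eq_or_ne n 0 with rfl | hn
  · simp
  · simp only [hn, if_false]
    norm_num [show bernoulli 6 = 1 / 42 by decide +kernel]

/-- The combination `(5 σ₃(n) + 7 σ₅(n)) / 12` of divisor sums. -/
noncomputable def mixedSigma : ℤ⟦X⟧ :=
  PowerSeries.mk fun n => ∑ d ∈ n.divisors, ((5 * d ^ 3 + 7 * d ^ 5) / 12 : ℤ)

/-- Expanding E₄³ - E₆² and dividing by 1728 leaves the linear terms 5/12 σ₃ + 7/12 σ₅. The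
congruence 5d³ + 7d⁵ ≡ 12d modulo 24 makes them integral and gives their parity at the same time. -/
theorem exists_mixedTerm (d : ℤ) : ∃ c, 5 * d ^ 3 + 7 * d ^ 5 = 12 * (d + 2 * c) := by
  have h : ∀ x : ZMod 24, 5 * x ^ 3 + 7 * x ^ 5 - 12 * x = 0 := by decide
  have h1 := h (d : ZMod 24)
  norm_cast at h1
  rw [ZMod.intCast_zmod_eq_zero_iff_dvd] at h1
  obtain ⟨c, hc⟩ := h1
  exact ⟨c, by push_cast at hc; linarith⟩

theorem twelve_mul_mixedSigma : 12 * mixedSigma = 5 * sigmaSeries 3 + 7 * sigmaSeries 5 := by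
  have h5 : (5 : ℤ⟦X⟧) = PowerSeries.C 5 := by simp
  have h7 : (7 : ℤ⟦X⟧) = PowerSeries.C 7 := by simp
  have h12 : (12 : ℤ⟦X⟧) = PowerSeries.C 12 := by simp
  ext n
  rw [h5, h7, h12]
  simp only [mixedSigma, map_add, PowerSeries.coeff_C_mul, sigmaSeries, PowerSeries.coeff_mk,
    ArithmeticFunction.sigma_apply, Finset.mul_sum, Nat.cast_sum, Nat.cast_pow,
    ← Finset.sum_add_distrib]
  exact Finset.sum_congr rfl fun d _ => Int.mul_ediv_cancel' ((exists_mixedTerm d).elim fun c hc => ⟨_, hc⟩)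

/-- The `q`-expansion of the discriminant, with integral coefficients. -/
noncomputable def tauSeries : ℤ⟦X⟧ :=
  mixedSigma + 100 * sigmaSeries 3 ^ 2 + 8000 * sigmaSeries 3 ^ 3 - 147 * sigmaSeries 5 ^ 2

theorem qExpansion_discriminant :
    qExpansion 1 discriminant = PowerSeries.map (Int.castRingHom ℂ) tauSeries := by
  have h1 : 1728 * qExpansion 1 discriminant = qExpansion 1 E₄ ^ 3 - qExpansion 1 E₆ ^ 2 := by
    have e1 := ModularForm.qExpansion_sub one_pos one_mem_strictPeriods_SL
      (ModularForm.mcast (by decide) (E₄.pow 3) : ModularForm 𝒮ℒ 12)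
      (ModularForm.mcast (by decide) (E₆.pow 2) : ModularForm 𝒮ℒ 12)
    simp only [ModularForm.qExpansion_mcast,
      ModularForm.qExpansion_pow one_pos one_mem_strictPeriods_SL] at e1
    rw [← e1]
    have e2 := ModularForm.qExpansion_smul one_pos one_mem_strictPeriods_SL (1728 : ℂ)
      CuspForm.discriminant
    have e3 : (1728 : ℂ⟦X⟧) * qExpansion 1 discriminant =
        (1728 : ℂ) • qExpansion 1 CuspForm.discriminant := by
      rw [PowerSeries.smul_eq_C_mul, map_ofNat]
      rfl
    rw [e3, ← e2]
    congr 1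
    ext z
    have := discriminant_eq_E₄_cube_sub_E₆_sq z
    change (1728 : ℂ) * discriminant z = E₄ z ^ 3 - E₆ z ^ 2
    rw [this]
    ring
  have h2 : (1728 : ℤ⟦X⟧) * tauSeries =
      (1 + 240 * sigmaSeries 3) ^ 3 - (1 - 504 * sigmaSeries 5) ^ 2 := by
    rw [tauSeries]
    linear_combination 144 * twelve_mul_mixedSigma
  have h3 := congrArg (PowerSeries.map (Int.castRingHom ℂ)) h2
  rw [map_mul, map_sub, map_pow, map_pow, ← qExpansion_E₄, ← qExpansion_E₆, ← h1] at h3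
  have h4 : (1728 : ℂ⟦X⟧) ≠ 0 := by
    rw [← map_ofNat PowerSeries.C 1728]
    simp
  simp only [map_ofNat] at h3
  exact (mul_left_cancel₀ h4 h3).symm

theorem card_divisors_cast (n : ℕ) (hn : n ≠ 0) [Decidable (∃ m, n = m ^ 2)] :
    (n.divisors.card : ZMod 2) = if ∃ m, n = m ^ 2 then 1 else 0 := by
  rw [← Set.ncard_coe_finset, ncard_eq_ncard_fixed (Finset.finite_toSet _) (fun d => n / d)]
  · apply ncard_eq_ite_of_subsingleton
    · rintro a ⟨ha, h1⟩ b ⟨hb, h2⟩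
      simp only [Finset.mem_coe, Nat.mem_divisors] at ha hb
      have e1 := Nat.mul_div_cancel' ha.1
      have e2 := Nat.mul_div_cancel' hb.1
      rw [h1] at e1
      rw [h2] at e2
      exact Nat.mul_self_inj.1 (e1.trans e2.symm)
    · constructor
      · rintro ⟨a, ha, h1⟩
        simp only [Finset.mem_coe, Nat.mem_divisors] at ha
        have e1 := Nat.mul_div_cancel' ha.1
        rw [h1] at e1
        exact ⟨a, by rw [sq, e1]⟩
      · rintro ⟨m, rfl⟩
        refine ⟨m, ?_, ?_⟩
        · simp only [Finset.mem_coe, Nat.mem_divisors]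
          exact ⟨dvd_pow_self m two_ne_zero, hn⟩
        · rw [sq, Nat.mul_div_cancel _ (Nat.pos_of_ne_zero (by rintro rfl; simp at hn))]
  · intro d hd
    simp only [Finset.mem_coe, Nat.mem_divisors] at hd ⊢
    exact ⟨Nat.div_dvd_of_dvd hd.1, hn⟩
  · intro d hd
    simp only [Finset.mem_coe, Nat.mem_divisors] at hd
    exact Nat.div_div_self hd.1 hn

theorem coeff_redTwo_mixedSigma (n : ℕ) :
    PowerSeries.coeff n (redTwo mixedSigma) = ∑ d ∈ n.divisors, (d : ZMod 2) := by
  simp only [redTwo, PowerSeries.coeff_map, mixedSigma, PowerSeries.coeff_mk, map_sum]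
  refine Finset.sum_congr rfl fun d _ => ?_
  obtain ⟨c, hc⟩ := exists_mixedTerm d
  rw [hc, Int.mul_ediv_cancel_left _ (by norm_num)]
  have h2 : (2 : ZMod 2) = 0 := rfl
  simp [h2]

theorem coeff_redTwo_sigmaSeries_five (n : ℕ) :
    PowerSeries.coeff n (redTwo (sigmaSeries 5)) = ∑ d ∈ n.divisors, (d : ZMod 2) := by
  simp only [redTwo, PowerSeries.coeff_map, sigmaSeries, PowerSeries.coeff_mk,
    ArithmeticFunction.sigma_apply, eq_intCast, Int.cast_natCast]
  rw [Nat.cast_sum]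
  refine Finset.sum_congr rfl fun d _ => ?_
  have h : ∀ x : ZMod 2, x ^ 5 = x := by decide
  rw [Nat.cast_pow, h]

theorem sum_divisors_eq_card (n : ℕ) :
    ∑ d ∈ n.divisors, (d : ZMod 2) = ((n.divisors.filter Odd).card : ZMod 2) := by
  rw [Finset.card_filter, Nat.cast_sum]
  refine Finset.sum_congr rfl fun d _ => ?_
  split_ifs with h
  · rw [ZMod.natCast_eq_one_iff_odd.2 h, Nat.cast_one]
  · rw [ZMod.natCast_eq_zero_iff_even.2 (Nat.not_odd_iff_even.1 h), Nat.cast_zero]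

/-- Modulo 2 the coefficient of q^n is o(n) + o(n/2), with o the number of odd divisors and the
second term present only for n even. For n even the two terms cancel; for n odd, o(n) is the number
of divisors, which is odd exactly when n is a square. -/
theorem redTwo_tauSeries : redTwo tauSeries = Delta := by
  classical
  have h2 : (2 : (ZMod 2)⟦X⟧) = 0 := CharTwo.two_eq_zero
  have h : redTwo tauSeries = redTwo mixedSigma + redTwo (sigmaSeries 5) ^ 2 := by
    simp only [tauSeries, map_add, map_sub, map_mul, map_pow, map_ofNat]
    linear_combination (50 * redTwo (sigmaSeries 3) ^ 2 + 4000 * redTwo (sigmaSeries 3) ^ 3 -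
      74 * redTwo (sigmaSeries 5) ^ 2) * h2
  rw [h, ← expand_two]
  ext n
  rw [map_add, PowerSeries.coeff_expand, coeff_redTwo_mixedSigma, coeff_redTwo_sigmaSeries_five]
  simp only [Delta, PowerSeries.coeff_mk]
  rcases Nat.even_or_odd' n with ⟨k, rfl | rfl⟩
  · rw [if_pos (Dvd.intro k rfl), Nat.mul_div_cancel_left _ two_pos, if_neg]
    · rw [sum_divisors_eq_card, sum_divisors_eq_card]
      have : (2 * k).divisors.filter Odd = k.divisors.filter Odd := by
        ext d
        simp only [Finset.mem_filter, Nat.mem_divisors]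
        constructor
        · rintro ⟨⟨h1, h2⟩, h3⟩
          exact ⟨⟨(Nat.Coprime.dvd_mul_left (Nat.coprime_two_right.2 h3)).1 h1, by omega⟩, h3⟩
        · rintro ⟨⟨h1, h2⟩, h3⟩
          exact ⟨⟨h1.mul_left 2, by omega⟩, h3⟩
      rw [this, CharTwo.add_self_eq_zero]
    · rintro ⟨m, hm⟩
      have a1 : (2 * m + 1) ^ 2 = 2 * (2 * m ^ 2 + 2 * m) + 1 := by ring
      omega
  · rw [if_neg (by omega), add_zero, sum_divisors_eq_card, Finset.filter_true_of_mem,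
      card_divisors_cast _ (by omega)]
    · congr 1
      apply propext
      constructor
      · rintro ⟨m, hm⟩
        have : Odd (m ^ 2) := hm ▸ odd_two_mul_add_one k
        obtain ⟨l, rfl⟩ := (Nat.odd_pow_iff two_ne_zero).1 this
        exact ⟨l, hm⟩
      · rintro ⟨m, hm⟩
        exact ⟨_, hm⟩
    · intro d hd
      exact (odd_two_mul_add_one k).of_dvd_nat (Nat.dvd_of_mem_divisors hd)

/-- The reduction modulo 2 of an integral form of level 1 and weight `12 k` is a polynomial of
degree at most `k` in `Δ`. -/
theorem redTwo_mem_span (k : ℕ) : ∀ (w : ℤ), w = 12 * k → ∀ (f : ModularForm 𝒮ℒ w) (G : ℤ⟦X⟧),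
    qExpansion 1 f = PowerSeries.map (Int.castRingHom ℂ) G →
    redTwo G ∈ Submodule.span (ZMod 2) {h | ∃ i ≤ k, h = Delta ^ i} := by
  have hinj : Function.Injective (PowerSeries.map (Int.castRingHom ℂ)) := by
    intro a b h
    ext n
    have := congrArg (PowerSeries.coeff n) h
    simpa using this
  induction k with
  | zero =>
    intro w hw f G hG
    obtain rfl : w = 0 := by simpa using hw
    obtain ⟨c, hc⟩ := levelOne_weight_zero_const f
    have h1 : qExpansion 1 f = PowerSeries.C c := by
      have e1 := ModularForm.qExpansion_smul one_pos one_mem_strictPeriods_SL c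
        (1 : ModularForm 𝒮ℒ 0)
      have e2 : (f : ℍ → ℂ) = c • ⇑(1 : ModularForm 𝒮ℒ 0) := by
        rw [hc]
        ext z
        simp
      rw [e2, e1, ModularForm.qExpansion_one, PowerSeries.smul_eq_C_mul, mul_one]
    have h2 : G = PowerSeries.C (PowerSeries.coeff 0 G) := by
      apply hinj
      rw [PowerSeries.map_C, ← hG, h1]
      congr 1
      have := congrArg (PowerSeries.coeff 0) (h1.symm.trans hG)
      simpa using this
    rw [h2, PowerSeries.map_C]
    have : PowerSeries.C ((Int.castRingHom (ZMod 2)) (PowerSeries.coeff 0 G)) =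
        ((Int.castRingHom (ZMod 2)) (PowerSeries.coeff 0 G)) • Delta ^ 0 := by
      rw [PowerSeries.smul_eq_C_mul, pow_zero, mul_one]
    rw [this]
    exact Submodule.smul_mem _ _ (Submodule.subset_span ⟨0, le_rfl, rfl⟩)
  | succ k ih =>
    intro w hw f G hG
    set a : ℤ := PowerSeries.coeff 0 G with ha
    have hw' : (((3 * (k + 1) : ℕ) : ℤ) * 4) = w := by rw [hw]; push_cast; ring
    -- The multiple a E₄^(3(k+1)) has the constant term of f and reduces to the constant a. The
    -- difference is a cusp form, hence the discriminant times a form of weight 12k.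
    set e : ModularForm 𝒮ℒ w := ModularForm.mcast (by exact_mod_cast hw') (E₄.pow (3 * (k + 1))) with he
    have hqe : qExpansion 1 e =
        PowerSeries.map (Int.castRingHom ℂ) ((1 + 240 * sigmaSeries 3) ^ (3 * (k + 1))) := by
      rw [he, ModularForm.qExpansion_mcast,
        ModularForm.qExpansion_pow one_pos one_mem_strictPeriods_SL, qExpansion_E₄, map_pow]
    set G' : ℤ⟦X⟧ := G - PowerSeries.C a * (1 + 240 * sigmaSeries 3) ^ (3 * (k + 1)) with hG'
    have hq : qExpansion 1 (f - (a : ℂ) • e : ModularForm 𝒮ℒ w) =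
        PowerSeries.map (Int.castRingHom ℂ) G' := by
      have e1 := ModularForm.qExpansion_sub one_pos one_mem_strictPeriods_SL f ((a : ℂ) • e)
      have e2 := ModularForm.qExpansion_smul one_pos one_mem_strictPeriods_SL (a : ℂ) e
      rw [FunLike.coe_sub, e1, FunLike.coe_smul, e2, hqe, hG, hG', map_sub, map_mul,
        PowerSeries.map_C, PowerSeries.smul_eq_C_mul]
      rfl
    have hs0 : PowerSeries.constantCoeff (sigmaSeries 3) = 0 := by
      rw [← PowerSeries.coeff_zero_eq_constantCoeff_apply]
      simp [sigmaSeries]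
    have hG0 : PowerSeries.constantCoeff G' = 0 := by
      rw [hG', map_sub, map_mul, map_pow, map_add, map_mul, hs0, ha]
      simp
    have hD := qExpansion_discriminant
    have hτ0 : PowerSeries.constantCoeff tauSeries = 0 := by
      have := congrArg (PowerSeries.coeff 0) hD
      rw [← CuspForm.coe_discriminant, CuspFormClass.qExpansion_coeff_zero CuspForm.discriminant
        one_pos one_mem_strictPeriods_SL] at this
      simpa using this.symm
    have hτ1 : PowerSeries.coeff 1 tauSeries = 1 := by
      have := congrArg (PowerSeries.coeff 1) hD
      rw [discriminant_qExpansion_coeff_one] at this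
      simp only [PowerSeries.coeff_map, eq_intCast] at this
      exact_mod_cast this.symm
    obtain ⟨u, hu⟩ := PowerSeries.X_dvd_iff.2 hτ0
    obtain ⟨H, hH⟩ := PowerSeries.X_dvd_iff.2 hG0
    -- The discriminant series is q times a unit of ℤ[[q]], so the quotient keeps integral
    -- coefficients.
    have hu1 : IsUnit u := by
      rw [PowerSeries.isUnit_iff_constantCoeff]
      have : PowerSeries.coeff 1 tauSeries = PowerSeries.constantCoeff u := by
        rw [hu]
        simp
      rw [← this, hτ1]
      exact isUnit_one
    obtain ⟨v, hv⟩ := hu1.exists_right_inv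
    have hG'τ : G' = tauSeries * (H * v) := by
      rw [hu, hH]
      linear_combination -(PowerSeries.X * H) * hv
    have hcusp : (qExpansion 1 (f - (a : ℂ) • e : ModularForm 𝒮ℒ w)).coeff 0 = 0 := by
      rw [hq]
      simp [hG0]
    have hmul := qExpansion_eq_qExpansion_discriminant_mul _ hcusp
    rw [hq, hG'τ, map_mul, ← hD] at hmul
    have hDne : qExpansion 1 discriminant ≠ 0 := by
      intro h0
      have := discriminant_qExpansion_coeff_one
      rw [h0] at this
      simp at this
    have hspan := ih (w - 12) (by rw [hw]; push_cast; ring) _ _ (mul_left_cancel₀ hDne hmul).symm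
    have hGeq : redTwo G = Delta * redTwo (H * v) +
        ((a : ℤ) : ZMod 2) • Delta ^ 0 := by
      have e1 : G = tauSeries * (H * v) + PowerSeries.C a * (1 + 240 * sigmaSeries 3) ^ (3 * (k + 1)) := by
        rw [← hG'τ, hG']
        ring
      have e2 : (240 : (ZMod 2)⟦X⟧) = 0 := by
        have h2 : (2 : (ZMod 2)⟦X⟧) = 0 := CharTwo.two_eq_zero
        linear_combination 120 * h2
      have e3 : redTwo (PowerSeries.C a * (1 + 240 * sigmaSeries 3) ^ (3 * (k + 1))) =
          ((a : ℤ) : ZMod 2) • Delta ^ 0 := by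
        rw [map_mul, map_pow, map_add, map_mul, map_one, map_ofNat, e2, zero_mul, add_zero,
          one_pow, pow_zero, PowerSeries.smul_eq_C_mul, PowerSeries.map_C]
        rfl
      rw [e1, map_add, map_mul redTwo tauSeries, redTwo_tauSeries, e3]
    rw [hGeq]
    refine Submodule.add_mem _ ?_ (Submodule.smul_mem _ _ (Submodule.subset_span ⟨0, by omega, rfl⟩))
    have hle : Submodule.span (ZMod 2) {h | ∃ i ≤ k, h = Delta ^ i} ≤
        (Submodule.span (ZMod 2) {h | ∃ i ≤ k + 1, h = Delta ^ i}).comap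
          (LinearMap.mulLeft (ZMod 2) Delta) := by
      rw [Submodule.span_le]
      rintro _ ⟨i, hi, rfl⟩
      exact Submodule.subset_span ⟨i + 1, by omega, by
        rw [LinearMap.mulLeft_apply, pow_succ']⟩
    exact hle hspan

end Integrality

/-! ### Hecke operators on modular forms of level 1 -/

section HeckeForm

open UpperHalfPlane ModularForm ModularFormClass MatrixGroups Matrix.SpecialLinearGroup Manifold

variable {p : ℕ} [hp : Fact p.Prime] {k : ℤ}

/-- The matrix `[1, j; 0, p]`. -/
noncomputable def heckeMatrix (p : ℕ) [hp : Fact p.Prime] (j : ℤ) : GL (Fin 2) ℝ :=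
  Matrix.GeneralLinearGroup.mkOfDetNeZero !![1, (j : ℝ); 0, p] (by
    simp [Matrix.det_fin_two, hp.out.ne_zero])

/-- The matrix `[p, 0; 0, 1]`. -/
noncomputable def heckeMatrixInfty (p : ℕ) [hp : Fact p.Prime] : GL (Fin 2) ℝ :=
  Matrix.GeneralLinearGroup.mkOfDetNeZero !![(p : ℝ), 0; 0, 1] (by
    simp [Matrix.det_fin_two, hp.out.ne_zero])

theorem heckeMatrix_smul (j : ℤ) (τ : ℍ) : ((heckeMatrix p j • τ : ℍ) : ℂ) = (τ + j) / p := by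
  rw [UpperHalfPlane.coe_smul_of_det_pos]
  · simp [num, denom, heckeMatrix, Matrix.GeneralLinearGroup.mkOfDetNeZero]
  · simp [heckeMatrix, Matrix.GeneralLinearGroup.mkOfDetNeZero, Matrix.det_fin_two, hp.out.pos]

theorem heckeMatrixInfty_smul (τ : ℍ) : ((heckeMatrixInfty p • τ : ℍ) : ℂ) = p * τ := by
  rw [UpperHalfPlane.coe_smul_of_det_pos]
  · simp [num, denom, heckeMatrixInfty, Matrix.GeneralLinearGroup.mkOfDetNeZero]
  · simp [heckeMatrixInfty, Matrix.GeneralLinearGroup.mkOfDetNeZero, Matrix.det_fin_two, hp.out.pos]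

theorem slash_heckeMatrix (f : ℍ → ℂ) (j : ℤ) (τ : ℍ) :
    (f ∣[k] heckeMatrix p j) τ = f (heckeMatrix p j • τ) * (p : ℂ)⁻¹ := by
  have hp0 : (p : ℂ) ≠ 0 := by exact_mod_cast hp.out.ne_zero
  have hd : (heckeMatrix p j).det.val = p := by
    simp [heckeMatrix, Matrix.GeneralLinearGroup.mkOfDetNeZero, Matrix.det_fin_two]
  have hden : denom (heckeMatrix p j) τ = p := by
    simp [denom, heckeMatrix, Matrix.GeneralLinearGroup.mkOfDetNeZero]
  have hσ : ∀ z, σ (heckeMatrix p j) z = z := by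
    intro z
    rw [σ, if_pos (by rw [hd]; exact_mod_cast hp.out.pos)]
    rfl
  rw [ModularForm.slash_apply, hσ, hd, hden, mul_assoc]
  congr 1
  rw [Nat.abs_cast, Complex.ofReal_natCast, zpow_sub₀ hp0, zpow_neg, zpow_one]
  field_simp

theorem slash_heckeMatrixInfty (f : ℍ → ℂ) (τ : ℍ) :
    (f ∣[k] heckeMatrixInfty p) τ = f (heckeMatrixInfty p • τ) * (p : ℂ) ^ (k - 1) := by
  have hd : (heckeMatrixInfty p).det.val = p := by
    simp [heckeMatrixInfty, Matrix.GeneralLinearGroup.mkOfDetNeZero, Matrix.det_fin_two]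
  have hden : denom (heckeMatrixInfty p) τ = 1 := by
    simp [denom, heckeMatrixInfty, Matrix.GeneralLinearGroup.mkOfDetNeZero]
  have hσ : ∀ z, σ (heckeMatrixInfty p) z = z := by
    intro z
    rw [σ, if_pos (by rw [hd]; exact_mod_cast hp.out.pos)]
    rfl
  rw [ModularForm.slash_apply, hσ, hd, hden, one_zpow, mul_one, Nat.abs_cast,
    Complex.ofReal_natCast]

/-- The Hecke operator `T_p` on functions on the upper half plane. -/
noncomputable def heckeFun (p : ℕ) [hp : Fact p.Prime] (k : ℤ) (f : ℍ → ℂ) : ℍ → ℂ :=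
  f ∣[k] heckeMatrixInfty p + ∑ j : ZMod p, f ∣[k] heckeMatrix p j.val

theorem val_heckeMatrix (j : ℤ) : (heckeMatrix p j).val = !![1, (j : ℝ); 0, p] := rfl

theorem val_heckeMatrixInfty : (heckeMatrixInfty p).val = !![(p : ℝ), 0; 0, 1] := rfl

theorem val_coe_SL (γ : SL(2, ℤ)) :
    (γ : GL (Fin 2) ℝ).val = (γ : Matrix (Fin 2) (Fin 2) ℤ).map (Int.cast : ℤ → ℝ) := rfl

theorem slash_eq_slash_of_mul {f : ℍ → ℂ} (hf : ∀ γ : SL(2, ℤ), f ∣[k] γ = f)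
    {A B : GL (Fin 2) ℝ} (γ : SL(2, ℤ))
    (h : A.val = (γ : Matrix (Fin 2) (Fin 2) ℤ).map (Int.cast : ℤ → ℝ) * B.val) :
    f ∣[k] A = f ∣[k] B := by
  have h' : A = (γ : GL (Fin 2) ℝ) * B := Units.ext h
  rw [h', SlashAction.slash_mul]
  congr 1
  exact hf γ

theorem slash_heckeMatrix_val {f : ℍ → ℂ} (hf : ∀ γ : SL(2, ℤ), f ∣[k] γ = f) (j : ℤ) :
    f ∣[k] heckeMatrix p ((j : ZMod p).val) = f ∣[k] heckeMatrix p j := by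
  set i : ℤ := ((j : ZMod p).val : ℤ) with hi
  obtain ⟨m, hm⟩ : (p : ℤ) ∣ i - j := by
    rw [← ZMod.intCast_zmod_eq_zero_iff_dvd, hi]
    simp
  have hm' : (i : ℝ) = j + p * m := by
    have : i = j + p * m := by linarith
    exact_mod_cast this
  refine slash_eq_slash_of_mul hf ⟨!![1, m; 0, 1], by simp [Matrix.det_fin_two]⟩ ?_
  rw [val_heckeMatrix, val_heckeMatrix, hm']
  ext a b
  fin_cases a <;> fin_cases b <;> simp [Matrix.mul_apply]
  ring

/-- Right multiplication by T shifts j to j + 1 modulo p and fixes the remaining coset. -/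
theorem heckeFun_slash_T {f : ℍ → ℂ} (hf : ∀ γ : SL(2, ℤ), f ∣[k] γ = f) :
    heckeFun p k f ∣[k] ModularGroup.T = heckeFun p k f := by
  rw [heckeFun, SlashAction.add_slash, ModularForm.SL_slash, ← SlashAction.slash_mul,
    ModularForm.SL_slash, SlashAction.sum_slash]
  congr 1
  · refine slash_eq_slash_of_mul hf ⟨!![1, p; 0, 1], by simp [Matrix.det_fin_two]⟩ ?_
    rw [Units.val_mul, val_heckeMatrixInfty, val_coe_SL, ModularGroup.coe_T]
    ext a b
    fin_cases a <;> fin_cases b <;> simp [Matrix.mul_apply]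
  · refine Fintype.sum_equiv (Equiv.addRight 1) _ _ fun j => ?_
    have e : Equiv.addRight 1 j = (((j.val : ℤ) + 1 : ℤ) : ZMod p) := by simp
    rw [← SlashAction.slash_mul, e, slash_heckeMatrix_val hf]
    congr 1
    apply Units.ext
    rw [Units.val_mul, val_heckeMatrix, val_heckeMatrix, val_coe_SL, ModularGroup.coe_T]
    ext a b
    fin_cases a <;> fin_cases b <;> simp [Matrix.mul_apply]
    ring

/-- Right multiplication by S exchanges the cosets of [p, 0; 0, 1] and [1, 0; 0, p], and sends j ≠ 0
to i = -1/j. For the latter, writing 1 + j i = p m, the matrix [j, -m; p, -i] in SL(2, ℤ) provides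
the equivalence. -/
theorem heckeFun_slash_S {f : ℍ → ℂ} (hf : ∀ γ : SL(2, ℤ), f ∣[k] γ = f) :
    heckeFun p k f ∣[k] ModularGroup.S = heckeFun p k f := by
  have h0 : (f ∣[k] heckeMatrixInfty p) ∣[k] ModularGroup.S =
      f ∣[k] heckeMatrix p (((0 : ZMod p).val : ℕ) : ℤ) := by
    rw [ModularForm.SL_slash, ← SlashAction.slash_mul]
    refine slash_eq_slash_of_mul hf ModularGroup.S ?_
    rw [Units.val_mul, val_heckeMatrix, val_heckeMatrixInfty, val_coe_SL, ModularGroup.coe_S]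
    ext a b
    fin_cases a <;> fin_cases b <;> simp [Matrix.mul_apply]
  have h1 : (f ∣[k] heckeMatrix p (((0 : ZMod p).val : ℕ) : ℤ)) ∣[k] ModularGroup.S =
      f ∣[k] heckeMatrixInfty p := by
    rw [ModularForm.SL_slash, ← SlashAction.slash_mul]
    refine slash_eq_slash_of_mul hf ModularGroup.S ?_
    rw [Units.val_mul, val_heckeMatrix, val_heckeMatrixInfty, val_coe_SL, ModularGroup.coe_S]
    ext a b
    fin_cases a <;> fin_cases b <;> simp [Matrix.mul_apply]
  have h2 : ∀ j : ZMod p, j ≠ 0 → (f ∣[k] heckeMatrix p j.val) ∣[k] ModularGroup.S =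
      f ∣[k] heckeMatrix p (-j⁻¹ : ZMod p).val := by
    intro j hj
    set i : ZMod p := -j⁻¹ with hi
    obtain ⟨m, hm⟩ : (p : ℤ) ∣ 1 + (j.val : ℤ) * i.val := by
      rw [← ZMod.intCast_zmod_eq_zero_iff_dvd]
      simp [hi, hj]
    rw [ModularForm.SL_slash, ← SlashAction.slash_mul]
    refine slash_eq_slash_of_mul hf ⟨!![(j.val : ℤ), -m; p, -(i.val : ℤ)], by
      rw [Matrix.det_fin_two_of]; linarith⟩ ?_
    have hm' : 1 + ((j.val : ℤ) : ℝ) * ((i.val : ℤ) : ℝ) = p * m := by exact_mod_cast hm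
    rw [Units.val_mul, val_heckeMatrix, val_heckeMatrix, val_coe_SL, ModularGroup.coe_S]
    clear_value i
    generalize (j.val : ℤ) = j' at *
    generalize (i.val : ℤ) = i' at *
    ext a b
    fin_cases a <;> fin_cases b <;> simp [Matrix.mul_apply]
    · linarith
    · ring
  have hsum : ∀ g : ZMod p → ℍ → ℂ, ∑ j, g j = g 0 + ∑ j ∈ Finset.univ.erase 0, g j := fun g =>
    (Finset.add_sum_erase _ _ (Finset.mem_univ 0)).symm
  rw [heckeFun, SlashAction.add_slash, h0, hsum, SlashAction.add_slash, h1, ModularForm.SL_slash,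
    SlashAction.sum_slash]
  have h3 : ∑ j ∈ Finset.univ.erase (0 : ZMod p),
      (f ∣[k] heckeMatrix p j.val) ∣[k] (ModularGroup.S : GL (Fin 2) ℝ) =
      ∑ j ∈ Finset.univ.erase (0 : ZMod p), f ∣[k] heckeMatrix p j.val := by
    refine Finset.sum_nbij' (fun j => -j⁻¹) (fun j => -j⁻¹) ?_ ?_ ?_ ?_ ?_
    · simp
    · simp
    · intro j _
      simp [inv_neg]
    · intro j _
      simp [inv_neg]
    · intro j hj
      exact h2 j (Finset.ne_of_mem_erase hj)
  rw [h3]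
  abel

theorem sum_pow_val_mul {ζ : ℂ} (hζ : IsPrimitiveRoot ζ p) (m : ℕ) :
    ∑ j : ZMod p, ζ ^ (j.val * m) = if p ∣ m then (p : ℂ) else 0 := by
  have e : ∑ j : ZMod p, ζ ^ (j.val * m) = ∑ j ∈ Finset.range p, (ζ ^ m) ^ j := by
    refine Finset.sum_nbij' (fun j => j.val) (fun j => (j : ZMod p)) ?_ ?_ ?_ ?_ ?_
    · intro j _
      simpa using ZMod.val_lt j
    · simp
    · intro j _
      simp
    · intro j hj
      exact ZMod.val_cast_of_lt (Finset.mem_range.1 hj)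
    · intro j _
      rw [← pow_mul, mul_comm]
  rw [e]
  split_ifs with h
  · rw [(hζ.pow_eq_one_iff_dvd m).2 h]
    simp
  · have h1 : ζ ^ m ≠ 1 := fun h1 => h ((hζ.pow_eq_one_iff_dvd m).1 h1)
    have h2 := mul_geom_sum (ζ ^ m) p
    rw [← pow_mul, mul_comm m p, pow_mul, hζ.pow_eq_one, one_pow, sub_self] at h2
    exact (mul_eq_zero.1 h2).resolve_left (sub_ne_zero.2 h1)

open Function.Periodic in
theorem hasSum_heckeFun {f : ℍ → ℂ} {a : ℕ → ℂ}
    (hf : ∀ τ : ℍ, HasSum (fun m => a m * qParam 1 τ ^ m) (f τ)) (τ : ℍ) :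
    HasSum (fun m => (a (p * m) + if p ∣ m then (p : ℂ) ^ (k - 1) * a (m / p) else 0) *
      qParam 1 τ ^ m) (heckeFun p k f τ) := by
  have hp0 : (p : ℂ) ≠ 0 := by exact_mod_cast hp.out.ne_zero
  have hinj : Function.Injective (fun m : ℕ => p * m) := mul_right_injective₀ hp.out.ne_zero
  have hV : HasSum (fun m => (if p ∣ m then (p : ℂ) ^ (k - 1) * a (m / p) else 0) *
      qParam 1 τ ^ m) ((f ∣[k] heckeMatrixInfty p) τ) := by
    rw [slash_heckeMatrixInfty, ← hinj.hasSum_iff]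
    · have h1 := (hf (heckeMatrixInfty p • τ)).mul_right ((p : ℂ) ^ (k - 1))
      refine h1.congr_fun ?_
      intro m
      have hq : qParam 1 (heckeMatrixInfty p • τ : ℍ) = qParam 1 τ ^ p := by
        rw [heckeMatrixInfty_smul, qParam, qParam, ← Complex.exp_nat_mul]
        congr 1
        ring
      simp only [Function.comp_apply, dvd_mul_right, if_true, hq,
        Nat.mul_div_cancel_left _ hp.out.pos]
      rw [← pow_mul]
      ring
    · intro m hm
      have : ¬ p ∣ m := fun ⟨c, hc⟩ => hm ⟨c, hc.symm⟩
      simp [this]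
  set ζ : ℂ := Complex.exp (2 * Real.pi * Complex.I / p) with hζ
  have hprim : IsPrimitiveRoot ζ p := Complex.isPrimitiveRoot_exp p hp.out.ne_zero
  set w : ℂ := Complex.exp (2 * Real.pi * Complex.I * τ / p) with hw
  have hwp : w ^ p = qParam 1 τ := by
    rw [hw, ← Complex.exp_nat_mul, qParam]
    congr 1
    push_cast
    field_simp
  have hU : HasSum (fun m => a (p * m) * qParam 1 τ ^ m)
      ((∑ j : ZMod p, f ∣[k] heckeMatrix p j.val) τ) := by
    have h1 : HasSum (fun m => ∑ j : ZMod p, a m * qParam 1 (heckeMatrix p j.val • τ : ℍ) ^ m *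
        (p : ℂ)⁻¹) ((∑ j : ZMod p, f ∣[k] heckeMatrix p j.val) τ) := by
      rw [Finset.sum_apply]
      refine hasSum_sum fun j _ => ?_
      rw [slash_heckeMatrix]
      exact (hf _).mul_right _
    -- Averaging over the p-th roots of unity keeps exactly the exponents divisible by p.
    have h2 : ∀ m, ∑ j : ZMod p, a m * qParam 1 (heckeMatrix p j.val • τ : ℍ) ^ m * (p : ℂ)⁻¹ =
        if p ∣ m then a m * w ^ m else 0 := by
      intro m
      have h3 : ∀ j : ZMod p, a m * qParam 1 (heckeMatrix p j.val • τ : ℍ) ^ m * (p : ℂ)⁻¹ =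
          (a m * w ^ m * (p : ℂ)⁻¹) * ζ ^ (j.val * m) := by
        intro j
        have hq : qParam 1 (heckeMatrix p j.val • τ : ℍ) = w * ζ ^ j.val := by
          rw [heckeMatrix_smul, qParam, hw, hζ, ← Complex.exp_nat_mul, ← Complex.exp_add]
          congr 1
          push_cast
          field_simp
        rw [hq, mul_pow, ← pow_mul]
        ring
      simp_rw [h3]
      rw [← Finset.mul_sum, sum_pow_val_mul hprim]
      split_ifs
      · field_simp
      · simp
    simp_rw [h2] at h1
    rw [← hinj.hasSum_iff] at h1
    · refine h1.congr_fun ?_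
      intro m
      simp only [Function.comp_apply, dvd_mul_right, if_true]
      rw [pow_mul, hwp]
    · intro m hm
      have : ¬ p ∣ m := fun ⟨c, hc⟩ => hm ⟨c, hc.symm⟩
      simp [this]
  have := hU.add hV
  rw [heckeFun, Pi.add_apply, add_comm]
  refine this.congr_fun ?_
  intro m
  ring

/-- The Hecke operator `T_p` on modular forms of level 1. -/
noncomputable def heckeForm (p : ℕ) [hp : Fact p.Prime] (f : ModularForm 𝒮ℒ k) :
    ModularForm 𝒮ℒ k :=
  have hf : ∀ γ : SL(2, ℤ), (f : ℍ → ℂ) ∣[k] γ = f := fun γ =>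
    SlashInvariantForm.slash_action_eqn f _ (MonoidHom.mem_range.mpr ⟨γ, rfl⟩)
  have hinv := SlashInvariantForm.slash_action_generators_SL2Z
    (heckeFun_slash_S (p := p) hf) (heckeFun_slash_T (p := p) hf)
  { toFun := heckeFun p k f
    slash_action_eq' := by
      rintro _ ⟨γ, rfl⟩
      exact hinv γ
    holo' := by
      have hf' := ModularFormClass.holo f
      have : ∀ s : Finset (ZMod p), MDiff (∑ j ∈ s, (f : ℍ → ℂ) ∣[k] heckeMatrix p j.val) := by
        intro s
        induction s using Finset.induction_on with
        | empty => exact mdifferentiable_const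
        | insert a s ha ih =>
          rw [Finset.sum_insert ha]
          exact (hf'.slash _ _).add ih
      exact (hf'.slash _ _).add (this Finset.univ)
    bdd_at_cusps' := by
      intro c hc
      rw [Subgroup.IsArithmetic.isCusp_iff_isCusp_SL2Z] at hc
      rw [OnePoint.isBoundedAt_iff_forall_SL2Z hc]
      intro γ _
      rw [hinv γ]
      exact isBoundedAtImInfty_of_hasSum_qExpansion one_pos
        (hasSum_heckeFun (ModularForm.hasSum_qExpansion f one_pos one_mem_strictPeriods_SL)) }

theorem qExpansion_heckeForm (f : ModularForm 𝒮ℒ k) (m : ℕ) :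
    PowerSeries.coeff m (qExpansion 1 (heckeForm p f)) =
      PowerSeries.coeff (p * m) (qExpansion 1 f) +
        if p ∣ m then (p : ℂ) ^ (k - 1) * PowerSeries.coeff (m / p) (qExpansion 1 f) else 0 :=
  (UpperHalfPlane.qExpansion_coeff_unique (h := 1) (f := heckeForm p f) one_pos
    (ModularFormClass.analyticAt_cuspFunction_zero (heckeForm p f) one_pos one_mem_strictPeriods_SL)
    (hasSum_heckeFun (ModularForm.hasSum_qExpansion f one_pos one_mem_strictPeriods_SL)) m).symm

end HeckeForm

/-! ### Stability of F(n) under the Hecke operators -/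

section Stability

open UpperHalfPlane ModularForm ModularFormClass MatrixGroups

/-- The n-th power of the discriminant is a form of weight 12n, and so is its image under the
complex Hecke operator. Its integral expansion reduces to T_p Δ^n because p^(12n-1) is odd. -/
theorem heckeT_pow_mem_span {p : ℕ} (hp : p.Prime) (hp2 : p ≠ 2) (n : ℕ) :
    heckeT p (Delta ^ n) ∈ Submodule.span (ZMod 2) {h | ∃ i ≤ n, h = Delta ^ i} := by
  rcases n.eq_zero_or_pos with rfl | hn
  · rw [pow_zero, heckeT_one p hp.ne_zero]
    exact Submodule.zero_mem _
  have : Fact p.Prime := ⟨hp⟩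
  set f : ModularForm 𝒮ℒ ((n : ℤ) * 12) :=
    ModularForm.pow (CuspForm.toModularFormₗ CuspForm.discriminant) n with hf
  have hqf : qExpansion 1 f = PowerSeries.map (Int.castRingHom ℂ) (tauSeries ^ n) := by
    rw [hf, ModularForm.qExpansion_pow one_pos one_mem_strictPeriods_SL, map_pow,
      ← qExpansion_discriminant]
    rfl
  set G : ℤ⟦X⟧ := PowerSeries.mk fun m => PowerSeries.coeff (p * m) (tauSeries ^ n) +
    if p ∣ m then (p : ℤ) ^ (12 * n - 1) * PowerSeries.coeff (m / p) (tauSeries ^ n) else 0 with hG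
  have hw : ((n : ℤ) * 12 - 1) = ((12 * n - 1 : ℕ) : ℤ) := by omega
  have hq : qExpansion 1 (heckeForm p f) = PowerSeries.map (Int.castRingHom ℂ) G := by
    ext m
    rw [qExpansion_heckeForm, hqf, hw]
    simp only [hG, PowerSeries.coeff_map, PowerSeries.coeff_mk, zpow_natCast]
    split_ifs <;> simp
  have key := redTwo_mem_span n _ (mul_comm _ _) (heckeForm p f) G hq
  have : redTwo G = heckeT p (Delta ^ n) := by
    have hp1 : ((p : ℤ) : ZMod 2) = 1 := by
      have : Odd p := hp.odd_of_ne_two hp2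
      simpa using (ZMod.natCast_eq_one_iff_odd).2 this
    rw [← redTwo_tauSeries, ← map_pow]
    ext m
    simp only [coeff_heckeT, hG, PowerSeries.coeff_map, PowerSeries.coeff_mk, map_add]
    split_ifs
    · simp only [map_mul, map_pow, eq_intCast, hp1, one_pow, one_mul]
    · simp
  rwa [this] at key

/-- The part of a power series with exponents in a residue class modulo 8. -/
noncomputable def projEight (r : ZMod 8) : (ZMod 2)⟦X⟧ →ₗ[ZMod 2] (ZMod 2)⟦X⟧ where
  toFun f := PowerSeries.mk fun n => if (n : ZMod 8) = r then PowerSeries.coeff n f else 0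
  map_add' f g := by
    ext n
    simp only [PowerSeries.coeff_mk, map_add]
    split_ifs <;> simp
  map_smul' c f := by
    ext n
    simp only [PowerSeries.coeff_mk, PowerSeries.coeff_smul, RingHom.id_apply, smul_eq_mul]
    split_ifs <;> simp

/-- Odd squares are 1 modulo 8. -/
theorem coeff_Delta_pow_eq_zero (k n : ℕ) (h : (n : ZMod 8) ≠ k) :
    PowerSeries.coeff n (Delta ^ k) = 0 := by
  induction k generalizing n with
  | zero =>
    rw [pow_zero, PowerSeries.coeff_one, if_neg]
    rintro rfl
    exact h rfl
  | succ k ih =>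
    rw [pow_succ, PowerSeries.coeff_mul]
    refine Finset.sum_eq_zero fun x hx => ?_
    rw [Finset.HasAntidiagonal.mem_antidiagonal] at hx
    by_cases h1 : (x.1 : ZMod 8) = k
    · have h2 : PowerSeries.coeff x.2 Delta = 0 := by
        classical
        simp only [Delta, PowerSeries.coeff_mk]
        rw [if_neg]
        rintro ⟨m, hm⟩
        apply h
        rw [← hx, hm]
        have : ∀ a : ZMod 8, (2 * a + 1) ^ 2 = 1 := by decide
        push_cast
        rw [h1, this]
      rw [h2, mul_zero]
    · rw [ih _ h1, zero_mul]

theorem projEight_Delta_pow (r : ZMod 8) (k : ℕ) :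
    projEight r (Delta ^ k) = if (k : ZMod 8) = r then Delta ^ k else 0 := by
  ext n
  simp only [projEight, LinearMap.coe_mk, AddHom.coe_mk, PowerSeries.coeff_mk]
  by_cases h : (n : ZMod 8) = k
  · rw [h]
    split_ifs <;> simp
  · rw [coeff_Delta_pow_eq_zero k n h]
    split_ifs <;> simp [coeff_Delta_pow_eq_zero k n h]

/-- As p² ≡ 1 modulo 8, dividing an exponent by p and multiplying it by p have the same effect
modulo 8. So all exponents of q in T_p Δ^k are p k modulo 8, and projecting to that class discards
the other powers of Δ. -/
theorem heckeT_pow_mem_span_mod_eight {p : ℕ} (hp : p.Prime) (hp2 : p ≠ 2) (k : ℕ) :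
    heckeT p (Delta ^ k) ∈
      Submodule.span (ZMod 2) {h | ∃ i ≤ k, (i : ZMod 8) = p * k ∧ h = Delta ^ i} := by
  have hodd : (p : ZMod 8) * p = 1 := by
    obtain ⟨m, rfl⟩ := hp.odd_of_ne_two hp2
    have : ∀ a : ZMod 8, (2 * a + 1) * (2 * a + 1) = 1 := by decide
    push_cast
    exact this m
  have h1 : projEight (p * k) (heckeT p (Delta ^ k)) = heckeT p (Delta ^ k) := by
    ext n
    simp only [projEight, LinearMap.coe_mk, AddHom.coe_mk, PowerSeries.coeff_mk]
    split_ifs with h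
    · rfl
    · rw [coeff_heckeT, coeff_Delta_pow_eq_zero, zero_add]
      · split_ifs with hd
        · obtain ⟨m, rfl⟩ := hd
          rw [Nat.mul_div_cancel_left _ hp.pos, coeff_Delta_pow_eq_zero]
          intro h'
          apply h
          push_cast
          rw [h']
        · rfl
      · intro h'
        apply h
        rw [← h']
        push_cast
        rw [← mul_assoc, hodd, one_mul]
  have h2 : ∀ f ∈ Submodule.span (ZMod 2) {h | ∃ i ≤ k, h = Delta ^ i}, projEight (p * k) f ∈
      Submodule.span (ZMod 2) {h | ∃ i ≤ k, (i : ZMod 8) = p * k ∧ h = Delta ^ i} := by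
    intro f hf
    rw [← Submodule.mem_comap]
    revert f
    change Submodule.span _ _ ≤ _
    rw [Submodule.span_le]
    rintro _ ⟨i, hi, rfl⟩
    rw [SetLike.mem_coe, Submodule.mem_comap, projEight_Delta_pow]
    split_ifs with h
    · exact Submodule.subset_span ⟨i, hi, h, rfl⟩
    · exact Submodule.zero_mem _
  rw [← h1]
  exact h2 _ (heckeT_pow_mem_span hp hp2 k)

theorem heckeT_mem_F {p : ℕ} (hp : p.Prime) (hp2 : p ≠ 2) (n : ℕ) :
    ∀ f ∈ F n, heckeT p f ∈ F n := by
  intro f hf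
  rw [← Submodule.mem_comap]
  revert f
  change F n ≤ _
  conv_lhs => rw [F]
  rw [Submodule.span_le]
  rintro _ ⟨i, hi, rfl⟩
  refine Submodule.span_mono ?_ (heckeT_pow_mem_span_mod_eight hp hp2 (2 * i + 1))
  rintro _ ⟨j, hj, hj8, rfl⟩
  have h2 : ((j : ℕ) : ZMod 2) = ((p * (2 * i + 1) : ℕ) : ZMod 2) := by
    have := congrArg (ZMod.castHom (show 2 ∣ 8 by norm_num) (ZMod 2)) hj8
    simp only [map_mul, map_natCast] at this
    simpa using this
  have hodd : Odd j := by
    rw [← ZMod.natCast_eq_one_iff_odd, h2, ZMod.natCast_eq_one_iff_odd]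
    exact (hp.odd_of_ne_two hp2).mul (odd_two_mul_add_one i)
  obtain ⟨l, rfl⟩ := hodd
  exact ⟨l, by omega, rfl⟩

end Stability

/-! Initial values -/

/-- This is the degree 6 modular equation used directly. It serves only for the initial values
needed by the degree 16 recurrence. -/
theorem heckeT_five_recurrence_six (k : ℕ) :
    heckeT 5 (Delta ^ (k + 6)) = Delta ^ 6 * heckeT 5 (Delta ^ k) +
      Delta * heckeT 5 (Delta ^ (k + 1)) + Delta ^ 4 * heckeT 5 (Delta ^ (k + 2)) +
      Delta ^ 2 * heckeT 5 (Delta ^ (k + 4)) := by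
  set y := PowerSeries.expand 5 (by norm_num) Delta with hy
  have hyt := modular_equation_five
  rw [← hy] at hyt
  have h2 : (2 : (ZMod 2)⟦X⟧) = 0 := CharTwo.two_eq_zero
  have key : ∀ t y : (ZMod 2)⟦X⟧, (t + y) ^ 6 = t * y →
      t ^ 6 = y ^ 6 + t * y + t ^ 2 * y ^ 4 + t ^ 4 * y ^ 2 := by
    intro t y h
    linear_combination h - (3 * t ^ 5 * y + 8 * t ^ 4 * y ^ 2 + 10 * t ^ 3 * y ^ 3 +
      8 * t ^ 2 * y ^ 4 + 3 * t * y ^ 5 + y ^ 6) * h2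
  have h1 := key y Delta (by rw [add_comm, hyt, mul_comm])
  have h3 := key Delta y hyt
  have hU : ∀ (f : (ZMod 2)⟦X⟧) (j : ℕ), opU 5 (f * y ^ j) = opU 5 f * Delta ^ j := by
    intro f j
    rw [hy, ← map_pow, opU_mul_expand]
  simp only [heckeT_eq 5 (by norm_num), map_pow, ← hy]
  have e : opU 5 (Delta ^ (k + 6)) = Delta ^ 6 * opU 5 (Delta ^ k) +
      Delta * opU 5 (Delta ^ (k + 1)) + Delta ^ 4 * opU 5 (Delta ^ (k + 2)) +
      Delta ^ 2 * opU 5 (Delta ^ (k + 4)) := by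
    have e' : Delta ^ (k + 6) = Delta ^ k * y ^ 6 + Delta ^ (k + 1) * y ^ 1 +
        Delta ^ (k + 2) * y ^ 4 + Delta ^ (k + 4) * y ^ 2 := by
      rw [pow_add, h3]
      ring
    rw [e', map_add, map_add, map_add, hU, hU, hU, hU]
    ring
  rw [e, pow_add y k 6, h1]
  ring

theorem heckeT_eq_zero_of_mod_eight {p : ℕ} (hp : p.Prime) (hp2 : p ≠ 2) (k : ℕ)
    (h : ∀ i ≤ k, (i : ZMod 8) ≠ p * k) : heckeT p (Delta ^ k) = 0 := by
  have h1 := heckeT_pow_mem_span_mod_eight hp hp2 k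
  have : {h : (ZMod 2)⟦X⟧ | ∃ i ≤ k, (i : ZMod 8) = p * k ∧ h = Delta ^ i} = ∅ := by
    ext f
    simp only [Set.mem_empty_iff_false, iff_false]
    rintro ⟨i, hi, hi8, -⟩
    exact h i hi hi8
  rw [this, Submodule.span_empty] at h1
  exact (Submodule.mem_bot _).1 h1

theorem coeff_Delta_pow_self (k : ℕ) : PowerSeries.coeff k (Delta ^ k) = 1 := by
  obtain ⟨u, hu⟩ := PowerSeries.X_dvd_iff.2
    (show PowerSeries.constantCoeff Delta = 0 by
      simpa using coeff_Delta_zero)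
  have h1 : PowerSeries.constantCoeff u = 1 := by
    have := coeff_Delta_one
    rw [hu, ← zero_add 1, PowerSeries.coeff_succ_X_mul] at this
    simpa using this
  rw [hu, mul_pow, PowerSeries.coeff_X_pow_mul', if_pos le_rfl, Nat.sub_self]
  simp [h1]

/-- The residue class modulo 8 leaves only multiples of Δ, and the coefficient of q in T_p Δ^p is
that of q^p in Δ^p, which is 1. -/
theorem heckeT_prime_self {p : ℕ} (hp : p.Prime) (hp2 : p ≠ 2)
    (h : ∀ i ≤ p, (i : ZMod 8) = p * p → i = 1) : heckeT p (Delta ^ p) = Delta := by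
  have h1 := heckeT_pow_mem_span_mod_eight hp hp2 p
  have hle : {h : (ZMod 2)⟦X⟧ | ∃ i ≤ p, (i : ZMod 8) = p * p ∧ h = Delta ^ i} ⊆ {Delta} := by
    rintro _ ⟨i, hi, hi8, rfl⟩
    rw [h i hi hi8, pow_one]
    rfl
  obtain ⟨c, hc⟩ := Submodule.mem_span_singleton.1 (Submodule.span_mono hle h1)
  have h2 := congrArg (PowerSeries.coeff 1) hc
  rw [PowerSeries.coeff_smul, coeff_Delta_one, coeff_heckeT, mul_one, coeff_Delta_pow_self,
    if_neg (by simpa using hp.one_lt.ne'), add_zero, smul_eq_mul, mul_one] at h2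
  rw [← hc, h2, one_smul]

theorem heckeT_three_one : heckeT 3 (Delta ^ 1) = 0 :=
  heckeT_eq_zero_of_mod_eight Nat.prime_three (by norm_num) 1 (by decide)

theorem heckeT_three_two : heckeT 3 (Delta ^ 2) = 0 :=
  heckeT_eq_zero_of_mod_eight Nat.prime_three (by norm_num) 2 (by decide)

theorem heckeT_three_three : heckeT 3 (Delta ^ 3) = Delta :=
  heckeT_prime_self Nat.prime_three (by norm_num) (by decide)

theorem heckeT_five_double {k : ℕ} : heckeT 5 (Delta ^ (2 * k)) = heckeT 5 (Delta ^ k) ^ 2 := by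
  rw [mul_comm, pow_mul, heckeT_sq 5 (by norm_num) _ (by norm_num)]

theorem heckeT_five_one : heckeT 5 (Delta ^ 1) = 0 :=
  heckeT_eq_zero_of_mod_eight Nat.prime_five (by norm_num) 1 (by decide)

theorem heckeT_five_two : heckeT 5 (Delta ^ 2) = 0 := by
  rw [show Delta ^ 2 = Delta ^ (2 * 1) from rfl, heckeT_five_double, heckeT_five_one, zero_pow two_ne_zero]

theorem heckeT_five_three : heckeT 5 (Delta ^ 3) = 0 :=
  heckeT_eq_zero_of_mod_eight Nat.prime_five (by norm_num) 3 (by decide)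

theorem heckeT_five_four : heckeT 5 (Delta ^ 4) = 0 := by
  rw [show Delta ^ 4 = Delta ^ (2 * 2) from rfl, heckeT_five_double, heckeT_five_two, zero_pow two_ne_zero]

theorem heckeT_five_five : heckeT 5 (Delta ^ 5) = Delta :=
  heckeT_prime_self Nat.prime_five (by norm_num) (by decide)

theorem heckeT_five_six : heckeT 5 (Delta ^ 6) = 0 := by
  rw [show Delta ^ 6 = Delta ^ (2 * 3) from rfl, heckeT_five_double, heckeT_five_three, zero_pow two_ne_zero]

theorem heckeT_five_seven : heckeT 5 (Delta ^ 7) = Delta ^ 3 := by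
  have := heckeT_five_recurrence_six 1
  norm_num [heckeT_five_two, heckeT_five_three, heckeT_five_five] at this
  rw [this, show heckeT 5 Delta = 0 by simpa using heckeT_five_one]
  ring

theorem heckeT_five_eight : heckeT 5 (Delta ^ 8) = 0 := by
  rw [show Delta ^ 8 = Delta ^ (2 * 4) from rfl, heckeT_five_double, heckeT_five_four, zero_pow two_ne_zero]

theorem heckeT_five_nine : heckeT 5 (Delta ^ 9) = 0 := by
  have := heckeT_five_recurrence_six 3
  norm_num [heckeT_five_three, heckeT_five_four, heckeT_five_five, heckeT_five_seven] at this
  rw [this, ← pow_succ, ← pow_add]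
  exact CharTwo.add_self_eq_zero _

theorem heckeT_five_ten : heckeT 5 (Delta ^ 10) = Delta ^ 2 := by
  rw [show Delta ^ 10 = Delta ^ (2 * 5) from rfl, heckeT_five_double, heckeT_five_five]

theorem heckeT_five_eleven : heckeT 5 (Delta ^ 11) = 0 := by
  have := heckeT_five_recurrence_six 5
  norm_num [heckeT_five_six, heckeT_five_nine, heckeT_five_five, heckeT_five_seven] at this
  rw [this, ← pow_succ, ← pow_add]
  exact CharTwo.add_self_eq_zero _

theorem heckeT_five_twelve : heckeT 5 (Delta ^ 12) = 0 := by
  rw [show Delta ^ 12 = Delta ^ (2 * 6) from rfl, heckeT_five_double, heckeT_five_six, zero_pow two_ne_zero]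

theorem heckeT_five_thirteen : heckeT 5 (Delta ^ 13) = Delta ^ 9 := by
  have := heckeT_five_recurrence_six 7
  norm_num [heckeT_five_eight, heckeT_five_nine, heckeT_five_eleven, heckeT_five_seven] at this
  rw [this, ← pow_add]

theorem heckeT_five_fourteen : heckeT 5 (Delta ^ 14) = Delta ^ 6 := by
  rw [show Delta ^ 14 = Delta ^ (2 * 7) from rfl, heckeT_five_double, heckeT_five_seven, ← pow_mul]

theorem heckeT_five_fifteen : heckeT 5 (Delta ^ 15) = Delta ^ 11 + Delta ^ 3 := by
  have := heckeT_five_recurrence_six 9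
  norm_num [heckeT_five_nine, heckeT_five_ten, heckeT_five_eleven, heckeT_five_thirteen] at this
  rw [this, ← pow_add]
  ring

/-! ### Weights of exponents -/

/-- The weight of an exponent: the binary digits at the places `2 i` and `2 i + 1` contribute
`2 * 2 ^ i` and `3 * 2 ^ i`. -/
def wt (n : ℕ) : ℕ :=
  if n = 0 then 0 else 2 * wt (n / 4) + (2 * (n % 2) + 3 * (n / 2 % 2))
termination_by n
decreasing_by omega

theorem wt_zero : wt 0 = 0 := by rw [wt, if_pos rfl]

theorem wt_eq (n : ℕ) : wt n = 2 * wt (n / 4) + (2 * (n % 2) + 3 * (n / 2 % 2)) := by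
  rcases Nat.eq_zero_or_pos n with rfl | h
  · simp [wt_zero]
  · conv_lhs => rw [wt, if_neg h.ne']

theorem wt_four_mul_add (n r t : ℕ) (hr : r < 2) (ht : t < 2) :
    wt (4 * n + (r + 2 * t)) = 2 * wt n + (2 * r + 3 * t) := by
  rw [wt_eq]
  have h1 : (4 * n + (r + 2 * t)) / 4 = n := by omega
  have h2 : (4 * n + (r + 2 * t)) % 2 = r := by omega
  have h3 : (4 * n + (r + 2 * t)) / 2 % 2 = t := by omega
  rw [h1, h2, h3]

theorem wt_four_mul (n : ℕ) : wt (4 * n) = 2 * wt n := by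
  simpa using wt_four_mul_add n 0 0 (by norm_num) (by norm_num)

theorem wt_one : wt 1 = 2 := by
  simpa [wt_zero] using wt_four_mul_add 0 1 0 (by norm_num) (by norm_num)

theorem wt_two : wt 2 = 3 := by
  simpa [wt_zero] using wt_four_mul_add 0 0 1 (by norm_num) (by norm_num)

theorem exists_base_four (n : ℕ) : ∃ m r t, r < 2 ∧ t < 2 ∧ n = 4 * m + (r + 2 * t) :=
  ⟨n / 4, n % 2, n / 2 % 2, by omega, by omega, by omega⟩

theorem two_le_wt {n : ℕ} (h : n ≠ 0) : 2 ≤ wt n := by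
  induction n using Nat.strong_induction_on with
  | _ n ih =>
    obtain ⟨m, r, t, hr, ht, rfl⟩ := exists_base_four n
    rw [wt_four_mul_add _ _ _ hr ht]
    rcases eq_or_ne m 0 with rfl | hm
    · omega
    · have := ih m (by omega) hm
      omega

/-- In base 4 a carry adds at most 2 wt(1) = 4 to the weight, and the digits that cause it lose at
least as much. -/
theorem wt_add_le (m n : ℕ) : wt (m + n) ≤ wt m + wt n := by
  induction hN : m + n using Nat.strong_induction_on generalizing m n with
  | _ N ih =>
    subst hN
    rcases Nat.eq_zero_or_pos m with rfl | hm
    · simp [wt_zero]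
    rcases Nat.eq_zero_or_pos n with rfl | hn
    · simp [wt_zero]
    obtain ⟨m, r, t, hr, ht, rfl⟩ := exists_base_four m
    obtain ⟨n, r', t', hr', ht', rfl⟩ := exists_base_four n
    rw [wt_four_mul_add _ _ _ hr ht, wt_four_mul_add _ _ _ hr' ht']
    have h0 := ih (m + n) (by omega) m n rfl
    by_cases hc : r + 2 * t + (r' + 2 * t') < 4
    · obtain ⟨u, v, hu, hv, huv⟩ : ∃ u v, u < 2 ∧ v < 2 ∧
          r + 2 * t + (r' + 2 * t') = u + 2 * v :=
        ⟨(r + 2 * t + (r' + 2 * t')) % 2, (r + 2 * t + (r' + 2 * t')) / 2, by omega, by omega,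
          by omega⟩
      rw [show 4 * m + (r + 2 * t) + (4 * n + (r' + 2 * t')) = 4 * (m + n) + (u + 2 * v) by omega,
        wt_four_mul_add _ _ _ hu hv]
      omega
    · obtain ⟨u, v, hu, hv, huv⟩ : ∃ u v, u < 2 ∧ v < 2 ∧
          r + 2 * t + (r' + 2 * t') = 4 + (u + 2 * v) :=
        ⟨(r + 2 * t + (r' + 2 * t')) % 2, (r + 2 * t + (r' + 2 * t') - 4) / 2, by omega, by omega,
          by omega⟩
      rw [show 4 * m + (r + 2 * t) + (4 * n + (r' + 2 * t')) = 4 * (m + n + 1) + (u + 2 * v) by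
        omega, wt_four_mul_add _ _ _ hu hv]
      have h1 := ih (m + n + 1) (by omega) (m + n) 1 rfl
      rw [wt_one] at h1
      omega

theorem testBit_four_mul_add (n r t i : ℕ) (hr : r < 2) (ht : t < 2) :
    (4 * n + (r + 2 * t)).testBit (i + 2) = n.testBit i := by
  rw [Nat.testBit_add]
  congr 1
  omega

theorem wt_two_pow_succ_succ (i : ℕ) : wt (2 ^ (i + 2)) = 2 * wt (2 ^ i) := by
  rw [← wt_four_mul, pow_add, mul_comm]
  norm_num

theorem wt_add_two_pow {m i : ℕ} (h : m.testBit i = false) :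
    wt (m + 2 ^ i) = wt m + wt (2 ^ i) := by
  induction i using Nat.twoStepInduction generalizing m with
  | zero =>
    obtain ⟨m, r, t, hr, ht, rfl⟩ := exists_base_four m
    have : r = 0 := by
      have : (4 * m + (r + 2 * t)) % 2 = 0 := by simpa [Nat.testBit_zero] using h
      omega
    subst this
    rw [show 4 * m + (0 + 2 * t) + 2 ^ 0 = 4 * m + (1 + 2 * t) by omega,
      wt_four_mul_add _ _ _ (by norm_num) ht, wt_four_mul_add _ _ _ (by norm_num) ht, pow_zero,
      wt_one]
    omega
  | one =>
    obtain ⟨m, r, t, hr, ht, rfl⟩ := exists_base_four m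
    have : t = 0 := by
      have : (4 * m + (r + 2 * t)) / 2 % 2 = 0 := by
        simpa [Nat.testBit_eq_decide_div_mod_eq] using h
      omega
    subst this
    rw [show 4 * m + (r + 2 * 0) + 2 ^ 1 = 4 * m + (r + 2 * 1) by omega,
      wt_four_mul_add _ _ _ hr (by norm_num), wt_four_mul_add _ _ _ hr (by norm_num), pow_one,
      wt_two]
    omega
  | more i ih _ =>
    obtain ⟨m, r, t, hr, ht, rfl⟩ := exists_base_four m
    rw [testBit_four_mul_add _ _ _ _ hr ht] at h
    rw [show 4 * m + (r + 2 * t) + 2 ^ (i + 2) = 4 * (m + 2 ^ i) + (r + 2 * t) by ring,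
      wt_four_mul_add _ _ _ hr ht, wt_four_mul_add _ _ _ hr ht, ih h, wt_two_pow_succ_succ]
    omega

/-- Successive place values have ratio 3/2 or 4/3. Being below 2, the ratio makes binary carries
lose weight. -/
theorem two_mul_wt_two_pow_succ_le (i : ℕ) : 2 * wt (2 ^ (i + 1)) ≤ 3 * wt (2 ^ i) := by
  induction i using Nat.twoStepInduction with
  | zero => simp [wt_one, wt_two]
  | one =>
    have := wt_two_pow_succ_succ 0
    simp only [pow_zero, wt_one, zero_add] at this
    norm_num at this
    norm_num [wt_two, this]
  | more i ih _ =>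
    rw [wt_two_pow_succ_succ, wt_two_pow_succ_succ]
    omega

theorem wt_two_pow_pos (i : ℕ) : 2 ≤ wt (2 ^ i) := two_le_wt (by positivity)

theorem wt_add_two_pow_lt {m i : ℕ} (h : m.testBit i = true) :
    wt (m + 2 ^ i) < wt m + wt (2 ^ i) := by
  have hle : 2 ^ i ≤ m := Nat.ge_two_pow_of_testBit h
  obtain ⟨n, rfl⟩ := Nat.exists_eq_add_of_le' hle
  have hn : n.testBit i = false := by
    rw [add_comm, Nat.testBit_two_pow_add_eq] at h
    simpa using h
  rw [wt_add_two_pow hn, show n + 2 ^ i + 2 ^ i = n + 2 ^ (i + 1) by ring]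
  have h1 := wt_add_le n (2 ^ (i + 1))
  have h2 := two_mul_wt_two_pow_succ_le i
  have h3 := wt_two_pow_pos i
  omega

/-! The exponents `1 + 2 * I(a, b)`, where `I` interleaves binary digits -/

/-- The number whose binary digits at even places are those of `a`, and at odd places those
of `b`. -/
def interleave (a b : ℕ) : ℕ :=
  if a = 0 ∧ b = 0 then 0 else 4 * interleave (a / 2) (b / 2) + (a % 2 + 2 * (b % 2))
termination_by a + b
decreasing_by omega

theorem interleave_zero : interleave 0 0 = 0 := by rw [interleave, if_pos ⟨rfl, rfl⟩]

theorem interleave_eq (a b : ℕ) :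
    interleave a b = 4 * interleave (a / 2) (b / 2) + (a % 2 + 2 * (b % 2)) := by
  by_cases h : a = 0 ∧ b = 0
  · obtain ⟨rfl, rfl⟩ := h
    simp [interleave_zero]
  · conv_lhs => rw [interleave, if_neg h]

theorem interleave_two_mul_add (a b r t : ℕ) (hr : r < 2) (ht : t < 2) :
    interleave (2 * a + r) (2 * b + t) = 4 * interleave a b + (r + 2 * t) := by
  rw [interleave_eq]
  have h1 : (2 * a + r) / 2 = a := by omega
  have h2 : (2 * b + t) / 2 = b := by omega
  have h3 : (2 * a + r) % 2 = r := by omega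
  have h4 : (2 * b + t) % 2 = t := by omega
  rw [h1, h2, h3, h4]

theorem exists_two_mul_add (n : ℕ) : ∃ m r, r < 2 ∧ n = 2 * m + r := ⟨n / 2, n % 2, by omega, by omega⟩

theorem exists_interleave (n : ℕ) : ∃ a b, interleave a b = n := by
  induction n using Nat.strong_induction_on with
  | _ n ih =>
    rcases Nat.eq_zero_or_pos n with rfl | hn
    · exact ⟨0, 0, interleave_zero⟩
    obtain ⟨m, r, t, hr, ht, rfl⟩ := exists_base_four n
    obtain ⟨a, b, rfl⟩ := ih m (by omega)
    exact ⟨2 * a + r, 2 * b + t, interleave_two_mul_add _ _ _ _ hr ht⟩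

theorem testBit_two_mul_add (n r i : ℕ) (hr : r < 2) :
    (2 * n + r).testBit (i + 1) = n.testBit i := by
  rw [Nat.testBit_succ]
  congr 1
  omega

theorem testBit_interleave_left (a b s : ℕ) :
    (interleave a b).testBit (2 * s) = a.testBit s := by
  induction s generalizing a b with
  | zero =>
    obtain ⟨a, r, hr, rfl⟩ := exists_two_mul_add a
    obtain ⟨b, t, ht, rfl⟩ := exists_two_mul_add b
    rw [interleave_two_mul_add _ _ _ _ hr ht]
    simp only [mul_zero, Nat.testBit_zero]
    congr 2
    omega
  | succ s ih =>
    obtain ⟨a, r, hr, rfl⟩ := exists_two_mul_add a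
    obtain ⟨b, t, ht, rfl⟩ := exists_two_mul_add b
    rw [interleave_two_mul_add _ _ _ _ hr ht, testBit_two_mul_add _ _ _ hr,
      show 2 * (s + 1) = 2 * s + 2 by ring, testBit_four_mul_add _ _ _ _ hr ht, ih]

theorem testBit_interleave_right (a b s : ℕ) :
    (interleave a b).testBit (2 * s + 1) = b.testBit s := by
  induction s generalizing a b with
  | zero =>
    obtain ⟨a, r, hr, rfl⟩ := exists_two_mul_add a
    obtain ⟨b, t, ht, rfl⟩ := exists_two_mul_add b
    rw [interleave_two_mul_add _ _ _ _ hr ht]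
    simp only [Nat.testBit_eq_decide_div_mod_eq]
    congr 2
    omega
  | succ s ih =>
    obtain ⟨a, r, hr, rfl⟩ := exists_two_mul_add a
    obtain ⟨b, t, ht, rfl⟩ := exists_two_mul_add b
    rw [interleave_two_mul_add _ _ _ _ hr ht, testBit_two_mul_add _ _ _ ht,
      show 2 * (s + 1) + 1 = 2 * s + 1 + 2 by ring, testBit_four_mul_add _ _ _ _ hr ht, ih]

theorem interleave_add_left {a s : ℕ} (b : ℕ) (h : a.testBit s = false) :
    interleave (a + 2 ^ s) b = interleave a b + 2 ^ (2 * s) := by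
  induction s generalizing a b with
  | zero =>
    obtain ⟨a, r, hr, rfl⟩ := exists_two_mul_add a
    obtain ⟨b, t, ht, rfl⟩ := exists_two_mul_add b
    have : r = 0 := by
      have : (2 * a + r) % 2 = 0 := by simpa [Nat.testBit_zero] using h
      omega
    subst this
    rw [show 2 * a + 0 + 2 ^ 0 = 2 * a + 1 by ring, interleave_two_mul_add _ _ _ _ (by omega) ht,
      interleave_two_mul_add _ _ _ _ hr ht]
    ring
  | succ s ih =>
    obtain ⟨a, r, hr, rfl⟩ := exists_two_mul_add a
    obtain ⟨b, t, ht, rfl⟩ := exists_two_mul_add b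
    rw [testBit_two_mul_add _ _ _ hr] at h
    rw [show 2 * a + r + 2 ^ (s + 1) = 2 * (a + 2 ^ s) + r by ring,
      interleave_two_mul_add _ _ _ _ hr ht, interleave_two_mul_add _ _ _ _ hr ht, ih b h]
    ring

theorem interleave_add_right (a : ℕ) {b s : ℕ} (h : b.testBit s = false) :
    interleave a (b + 2 ^ s) = interleave a b + 2 ^ (2 * s + 1) := by
  induction s generalizing a b with
  | zero =>
    obtain ⟨a, r, hr, rfl⟩ := exists_two_mul_add a
    obtain ⟨b, t, ht, rfl⟩ := exists_two_mul_add b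
    have : t = 0 := by
      have : (2 * b + t) % 2 = 0 := by simpa [Nat.testBit_zero] using h
      omega
    subst this
    rw [show 2 * b + 0 + 2 ^ 0 = 2 * b + 1 by ring, interleave_two_mul_add _ _ _ _ hr (by omega),
      interleave_two_mul_add _ _ _ _ hr ht]
    ring
  | succ s ih =>
    obtain ⟨a, r, hr, rfl⟩ := exists_two_mul_add a
    obtain ⟨b, t, ht, rfl⟩ := exists_two_mul_add b
    rw [testBit_two_mul_add _ _ _ ht] at h
    rw [show 2 * b + t + 2 ^ (s + 1) = 2 * (b + 2 ^ s) + t by ring,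
      interleave_two_mul_add _ _ _ _ hr ht, interleave_two_mul_add _ _ _ _ hr ht, ih a h]
    ring

/-- The odd number `1 + 2 * I(a, b)`. -/
def expo (a b : ℕ) : ℕ := 1 + 2 * interleave a b

theorem wt_two_mul_interleave (a b : ℕ) : wt (2 * interleave a b) = 3 * a + 4 * b := by
  induction hN : a + b using Nat.strong_induction_on generalizing a b with
  | _ N ih =>
    subst hN
    by_cases h : a = 0 ∧ b = 0
    · obtain ⟨rfl, rfl⟩ := h
      simp [interleave_zero, wt_zero]
    obtain ⟨a, r, hr, rfl⟩ := exists_two_mul_add a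
    obtain ⟨b, t, ht, rfl⟩ := exists_two_mul_add b
    have h1 : wt (2 * interleave a b + t) = 3 * a + 4 * b + 2 * t := by
      rw [← ih (a + b) (by omega) a b rfl]
      interval_cases t
      · rfl
      · have : (2 * interleave a b).testBit 0 = false := by simp
        simpa [wt_one] using wt_add_two_pow this
    rw [interleave_two_mul_add _ _ _ _ hr ht,
      show 2 * (4 * interleave a b + (r + 2 * t)) =
        4 * (2 * interleave a b + t) + (0 + 2 * r) by ring,
      wt_four_mul_add _ _ _ (by norm_num) hr, h1]
    ring

/-- The digit s of a sits at place 2s + 1, of value 3·2^s, and the digit s of b at place 2s + 2, of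
value 4·2^s. The final 1 has weight 2. -/
theorem wt_expo (a b : ℕ) : wt (expo a b) = 2 + 3 * a + 4 * b := by
  have : (2 * interleave a b).testBit 0 = false := by simp
  have := wt_add_two_pow this
  rw [pow_zero, wt_one, wt_two_mul_interleave] at this
  rw [expo, add_comm, this]
  ring

theorem testBit_expo_succ (a b i : ℕ) : (expo a b).testBit (i + 1) = (interleave a b).testBit i := by
  rw [expo, add_comm, testBit_two_mul_add _ _ _ (by norm_num)]

theorem testBit_expo_left (a b s : ℕ) : (expo a b).testBit (2 * s + 1) = a.testBit s := by
  rw [testBit_expo_succ, testBit_interleave_left]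

theorem testBit_expo_right (a b s : ℕ) : (expo a b).testBit (2 * s + 2) = b.testBit s := by
  rw [testBit_expo_succ, testBit_interleave_right]

theorem expo_add_left {a s : ℕ} (b : ℕ) (h : a.testBit s = false) :
    expo (a + 2 ^ s) b = expo a b + 2 ^ (2 * s + 1) := by
  rw [expo, expo, interleave_add_left b h]
  ring

theorem expo_add_right (a : ℕ) {b s : ℕ} (h : b.testBit s = false) :
    expo a (b + 2 ^ s) = expo a b + 2 ^ (2 * s + 2) := by
  rw [expo, expo, interleave_add_right a h]
  ring

theorem exists_expo (i : ℕ) : ∃ a b, expo a b = 2 * i + 1 := by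
  obtain ⟨a, b, h⟩ := exists_interleave i
  exact ⟨a, b, by rw [expo, h, add_comm]⟩

theorem expo_zero_zero : expo 0 0 = 1 := by rw [expo, interleave_zero]

/-! ### The weight filtration -/

/-- The span of the powers `Δ^l` with `wt l + d ≤ w`. -/
noncomputable def fil (d w : ℕ) : Submodule (ZMod 2) (ZMod 2)⟦X⟧ :=
  Submodule.span (ZMod 2) {f | ∃ l, wt l + d ≤ w ∧ f = Delta ^ l}

theorem pow_mem_fil {d w l : ℕ} (h : wt l + d ≤ w) : Delta ^ l ∈ fil d w :=
  Submodule.subset_span ⟨l, h, rfl⟩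

theorem fil_mono {d w d' w' : ℕ} (h : w + d' ≤ w' + d) : fil d w ≤ fil d' w' := by
  refine Submodule.span_mono ?_
  rintro _ ⟨l, hl, rfl⟩
  exact ⟨l, by omega, rfl⟩

theorem pow_mul_mem_fil {d w : ℕ} (j : ℕ) {f : (ZMod 2)⟦X⟧} (hf : f ∈ fil d w) :
    Delta ^ j * f ∈ fil d (wt j + w) := by
  have : fil d w ≤ (fil d (wt j + w)).comap (LinearMap.mulLeft (ZMod 2) (Delta ^ j)) := by
    conv_lhs => rw [fil]
    rw [Submodule.span_le]
    rintro _ ⟨l, hl, rfl⟩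
    rw [SetLike.mem_coe, Submodule.mem_comap, LinearMap.mulLeft_apply, ← pow_add]
    have := wt_add_le j l
    exact pow_mem_fil (by omega)
  exact this hf

theorem map_mem_fil {T : (ZMod 2)⟦X⟧ →ₗ[ZMod 2] (ZMod 2)⟦X⟧} {e : ℕ}
    (hT : ∀ k, T (Delta ^ k) ∈ fil e (wt k)) {d w : ℕ} {f : (ZMod 2)⟦X⟧} (hf : f ∈ fil d w) :
    T f ∈ fil (d + e) w := by
  have : fil d w ≤ (fil (d + e) w).comap T := by
    conv_lhs => rw [fil]
    rw [Submodule.span_le]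
    rintro _ ⟨l, hl, rfl⟩
    exact fil_mono (by omega) (hT l)
  exact this hf

theorem exists_two_pow_add {n j : ℕ} (h : 2 ^ j ≤ n) : ∃ i m, j ≤ i ∧ m < 2 ^ i ∧ n = m + 2 ^ i := by
  have hn : n ≠ 0 := by
    have : 0 < 2 ^ j := by positivity
    omega
  refine ⟨n.log2, n - 2 ^ n.log2, (Nat.le_log2 hn).2 h, ?_, ?_⟩
  · have := Nat.lt_log2_self (n := n)
    rw [pow_succ] at this
    omega
  · have := Nat.log2_self_le hn
    omega

theorem testBit_eq_false_of_lt {m i : ℕ} (h : m < 2 ^ i) : m.testBit i = false :=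
  Nat.testBit_lt_two_pow h

theorem wt_of_lt_sixteen {n : ℕ} (h : n < 16) :
    wt n = 2 * (2 * (n / 4 % 2) + 3 * (n / 8)) + (2 * (n % 2) + 3 * (n / 2 % 2)) := by
  rw [wt_eq, wt_eq (n / 4), show n / 4 / 4 = 0 by omega, wt_zero,
    show n / 4 / 2 % 2 = n / 8 by omega]
  omega

/-- Induction by removing the top bit 4·2^r. The identity wt(4·2^r) = 2 wt(2^r) balances the second
term of the recurrence, where 2^r appears twice. -/
theorem heckeT_three_mem_fil (k : ℕ) : heckeT 3 (Delta ^ k) ∈ fil 3 (wt k) := by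
  induction k using Nat.strong_induction_on with
  | _ k ih =>
    by_cases hk : k < 2 ^ 2
    · norm_num at hk
      interval_cases k
      · rw [pow_zero, heckeT_one 3 (by norm_num)]
        exact Submodule.zero_mem _
      · rw [heckeT_three_one]
        exact Submodule.zero_mem _
      · rw [heckeT_three_two]
        exact Submodule.zero_mem _
      · rw [heckeT_three_three, ← pow_one Delta]
        exact pow_mem_fil (by norm_num [wt_of_lt_sixteen])
    · obtain ⟨i, m, hi, hm, rfl⟩ := exists_two_pow_add (not_lt.1 hk)
      obtain ⟨r, rfl⟩ := Nat.exists_eq_add_of_le' hi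
      have hw := wt_add_two_pow (testBit_eq_false_of_lt hm)
      have hr := wt_two_pow_succ_succ r
      have hpos : 0 < 2 ^ r := by positivity
      have e : 2 ^ (r + 2) = 4 * 2 ^ r := by ring
      rw [e] at hw hr hm ⊢
      rw [heckeT_three_recurrence]
      have h1 := wt_add_le m (2 ^ r)
      refine Submodule.add_mem _ ?_ ?_
      · exact fil_mono (by omega) (pow_mul_mem_fil (4 * 2 ^ r) (ih m (by omega)))
      · exact fil_mono (by omega) (pow_mul_mem_fil (2 ^ r) (ih (m + 2 ^ r) (by omega)))

theorem wt_eight_mul_lt (r : ℕ) : wt (8 * 2 ^ r) < wt (16 * 2 ^ r) := by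
  have h1 := wt_two_pow_succ_succ (r + 1)
  have h2 := wt_two_pow_succ_succ (r + 2)
  have h3 := wt_two_pow_succ_succ r
  have h4 := two_mul_wt_two_pow_succ_le r
  have h5 := wt_two_pow_pos r
  rw [show 8 * 2 ^ r = 2 ^ (r + 1 + 2) by ring, show 16 * 2 ^ r = 2 ^ (r + 2 + 2) by ring]
  omega

theorem wt_three_mul_lt (r : ℕ) : wt (3 * 2 ^ r) + wt (2 ^ r) < wt (16 * 2 ^ r) := by
  have h1 := wt_add_le (2 ^ (r + 1)) (2 ^ r)
  have h2 := wt_two_pow_succ_succ (r + 2)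
  have h3 := wt_two_pow_succ_succ r
  have h4 := two_mul_wt_two_pow_succ_le r
  have h5 := wt_two_pow_pos r
  rw [show 3 * 2 ^ r = 2 ^ (r + 1) + 2 ^ r by ring, show 16 * 2 ^ r = 2 ^ (r + 2 + 2) by ring]
  omega

/-- As for T_3, now with top bit 16·2^r. The two additional terms of the recurrence have strictly
smaller weight, and the exponents below 16 are checked one by one. -/
theorem heckeT_five_mem_fil (k : ℕ) : heckeT 5 (Delta ^ k) ∈ fil 4 (wt k) := by
  induction k using Nat.strong_induction_on with
  | _ k ih =>
    by_cases hk : k < 2 ^ 4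
    · norm_num at hk
      interval_cases k
      · rw [pow_zero, heckeT_one 5 (by norm_num)]
        exact Submodule.zero_mem _
      · rw [heckeT_five_one]; exact Submodule.zero_mem _
      · rw [heckeT_five_two]; exact Submodule.zero_mem _
      · rw [heckeT_five_three]; exact Submodule.zero_mem _
      · rw [heckeT_five_four]; exact Submodule.zero_mem _
      · rw [heckeT_five_five, ← pow_one Delta]
        exact pow_mem_fil (by norm_num [wt_of_lt_sixteen])
      · rw [heckeT_five_six]; exact Submodule.zero_mem _
      · rw [heckeT_five_seven]
        exact pow_mem_fil (by norm_num [wt_of_lt_sixteen])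
      · rw [heckeT_five_eight]; exact Submodule.zero_mem _
      · rw [heckeT_five_nine]; exact Submodule.zero_mem _
      · rw [heckeT_five_ten]
        exact pow_mem_fil (by norm_num [wt_of_lt_sixteen])
      · rw [heckeT_five_eleven]; exact Submodule.zero_mem _
      · rw [heckeT_five_twelve]; exact Submodule.zero_mem _
      · rw [heckeT_five_thirteen]
        exact pow_mem_fil (by norm_num [wt_of_lt_sixteen])
      · rw [heckeT_five_fourteen]
        exact pow_mem_fil (by norm_num [wt_of_lt_sixteen])
      · rw [heckeT_five_fifteen]
        exact Submodule.add_mem _ (pow_mem_fil (by norm_num [wt_of_lt_sixteen])) (pow_mem_fil (by norm_num [wt_of_lt_sixteen]))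
    · obtain ⟨i, m, hi, hm, rfl⟩ := exists_two_pow_add (not_lt.1 hk)
      obtain ⟨r, rfl⟩ := Nat.exists_eq_add_of_le' hi
      have hw := wt_add_two_pow (testBit_eq_false_of_lt hm)
      have hr := wt_two_pow_succ_succ (r + 2)
      have hpos : 0 < 2 ^ r := by positivity
      have e : 2 ^ (r + 4) = 16 * 2 ^ r := by ring
      have e' : 2 ^ (r + 2 + 2) = 16 * 2 ^ r := by ring
      have e'' : 2 ^ (r + 2) = 4 * 2 ^ r := by ring
      rw [e'] at hr
      rw [e] at hw hm ⊢
      rw [e''] at hr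
      rw [heckeT_five_recurrence, add_mul]
      have h1 := wt_add_le m (4 * 2 ^ r)
      have h2 := wt_add_le m (2 ^ r)
      have h3 := wt_eight_mul_lt r
      have h4 := wt_three_mul_lt r
      refine Submodule.add_mem _ (Submodule.add_mem _ (Submodule.add_mem _ ?_ ?_) ?_) ?_
      · exact fil_mono (by omega) (pow_mul_mem_fil (16 * 2 ^ r) (ih m (by omega)))
      · exact fil_mono (by omega) (pow_mul_mem_fil (8 * 2 ^ r) (ih m (by omega)))
      · exact fil_mono (by omega) (pow_mul_mem_fil (4 * 2 ^ r) (ih (m + 4 * 2 ^ r) (by omega)))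
      · exact fil_mono (by omega) (pow_mul_mem_fil (3 * 2 ^ r) (ih (m + 2 ^ r) (by omega)))

/-- The recurrence of `T_3`, modulo terms of lower weight. -/
theorem heckeT_three_add_mem_fil (i m : ℕ) :
    heckeT 3 (Delta ^ (m + 2 ^ (i + 2))) + (Delta ^ 2 ^ (i + 2) * heckeT 3 (Delta ^ m) +
      Delta ^ 2 ^ i * heckeT 3 (Delta ^ (m + 2 ^ i))) ∈ fil 4 (wt m + wt (2 ^ (i + 2))) := by
  rw [show 2 ^ (i + 2) = 4 * 2 ^ i by ring, heckeT_three_recurrence, CharTwo.add_self_eq_zero]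
  exact Submodule.zero_mem _

/-- The recurrence of `T_5`, modulo terms of lower weight. -/
theorem heckeT_five_add_mem_fil {i : ℕ} (hi : 2 ≤ i) (m : ℕ) :
    heckeT 5 (Delta ^ (m + 2 ^ (i + 2))) + (Delta ^ 2 ^ (i + 2) * heckeT 5 (Delta ^ m) +
      Delta ^ 2 ^ i * heckeT 5 (Delta ^ (m + 2 ^ i))) ∈ fil 5 (wt m + wt (2 ^ (i + 2))) := by
  obtain ⟨r, rfl⟩ := Nat.exists_eq_add_of_le' hi
  rw [show 2 ^ (r + 2 + 2) = 16 * 2 ^ r by ring, show 2 ^ (r + 2) = 4 * 2 ^ r by ring,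
    heckeT_five_recurrence]
  have h2 : (2 : (ZMod 2)⟦X⟧) = 0 := CharTwo.two_eq_zero
  have e : (Delta ^ (16 * 2 ^ r) + Delta ^ (8 * 2 ^ r)) * heckeT 5 (Delta ^ m) +
      Delta ^ (4 * 2 ^ r) * heckeT 5 (Delta ^ (m + 4 * 2 ^ r)) +
      Delta ^ (3 * 2 ^ r) * heckeT 5 (Delta ^ (m + 2 ^ r)) +
      (Delta ^ (16 * 2 ^ r) * heckeT 5 (Delta ^ m) +
        Delta ^ (4 * 2 ^ r) * heckeT 5 (Delta ^ (m + 4 * 2 ^ r))) =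
      Delta ^ (8 * 2 ^ r) * heckeT 5 (Delta ^ m) +
      Delta ^ (3 * 2 ^ r) * heckeT 5 (Delta ^ (m + 2 ^ r)) := by
    linear_combination (Delta ^ (16 * 2 ^ r) * heckeT 5 (Delta ^ m) +
        Delta ^ (4 * 2 ^ r) * heckeT 5 (Delta ^ (m + 4 * 2 ^ r))) * h2
  rw [e]
  have h1 := wt_add_le m (2 ^ r)
  have h3 := wt_eight_mul_lt r
  have h4 := wt_three_mul_lt r
  refine Submodule.add_mem _ ?_ ?_
  · exact fil_mono (by omega) (pow_mul_mem_fil (8 * 2 ^ r) (heckeT_five_mem_fil m))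
  · exact fil_mono (by omega) (pow_mul_mem_fil (3 * 2 ^ r) (heckeT_five_mem_fil (m + 2 ^ r)))

/-! ### Leading terms -/

/-- The expected leading term of `T Δ^(E x y)`, where `T` lowers the coordinate `x` by one. -/
noncomputable def lead (E : ℕ → ℕ → ℕ) (x y : ℕ) : (ZMod 2)⟦X⟧ :=
  if x = 0 then 0 else Delta ^ E (x - 1) y

theorem lead_zero (E : ℕ → ℕ → ℕ) (y : ℕ) : lead E 0 y = 0 := if_pos rfl

theorem lead_succ (E : ℕ → ℕ → ℕ) (x y : ℕ) : lead E (x + 1) y = Delta ^ E x y := rfl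

theorem pow_two_pow_mul_pow_mem_fil {n i d W : ℕ} (hn : n.testBit i = true) (h : wt n + d ≤ W) :
    Delta ^ 2 ^ i * Delta ^ n ∈ fil (d + 1) (wt (2 ^ i) + W) := by
  rw [← pow_add]
  have := wt_add_two_pow_lt hn
  rw [add_comm (2 ^ i) n]
  exact pow_mem_fil (by omega)

section LeadingTerm

variable {T : (ZMod 2)⟦X⟧ →ₗ[ZMod 2] (ZMod 2)⟦X⟧} {d i₀ c c' s₀ : ℕ} {E : ℕ → ℕ → ℕ}

/-- With the bit i of m set, forming m + 2^i already carries and loses weight. -/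
theorem second_term_mem_fil (hU : ∀ k, T (Delta ^ k) ∈ fil d (wt k)) {m i : ℕ}
    (hm : m.testBit i = true) :
    Delta ^ 2 ^ i * T (Delta ^ (m + 2 ^ i)) ∈ fil (d + 1) (wt m + wt (2 ^ (i + 2))) := by
  have h1 := wt_add_two_pow_lt hm
  have h2 := wt_two_pow_succ_succ i
  exact fil_mono (by omega) (pow_mul_mem_fil (2 ^ i) (hU (m + 2 ^ i)))

/-- This handles a clear bit i of m: the leading term L of T(Δ^(m + 2^i)) then still contains the
bit i, and multiplying by Δ^(2^i) carries there. -/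
theorem second_term_mem_fil' {m i : ℕ} {L : (ZMod 2)⟦X⟧}
    (h : T (Delta ^ (m + 2 ^ i)) + L ∈ fil (d + 1) (wt (m + 2 ^ i)))
    (hL : L = 0 ∨ ∃ n, L = Delta ^ n ∧ n.testBit i = true ∧ wt n + d ≤ wt (m + 2 ^ i)) :
    Delta ^ 2 ^ i * T (Delta ^ (m + 2 ^ i)) ∈ fil (d + 1) (wt m + wt (2 ^ (i + 2))) := by
  have h1 := wt_add_le m (2 ^ i)
  have h2 := wt_two_pow_succ_succ i
  have h3 : Delta ^ 2 ^ i * L ∈ fil (d + 1) (wt (2 ^ i) + wt (m + 2 ^ i)) := by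
    rcases hL with rfl | ⟨n, rfl, hn, hw⟩
    · rw [mul_zero]
      exact Submodule.zero_mem _
    · exact pow_two_pow_mul_pow_mem_fil hn hw
  have h4 := Submodule.sub_mem _ (pow_mul_mem_fil (2 ^ i) h) h3
  rw [mul_add, add_sub_cancel_right] at h4
  exact fil_mono (by omega) h4

theorem add_lead_mem_fil (hR : ∀ i, i₀ ≤ i → ∀ m, T (Delta ^ (m + 2 ^ (i + 2))) +
      (Delta ^ 2 ^ (i + 2) * T (Delta ^ m) + Delta ^ 2 ^ i * T (Delta ^ (m + 2 ^ i))) ∈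
        fil (d + 1) (wt m + wt (2 ^ (i + 2))))
    {i m : ℕ} (hi : i₀ ≤ i) (hm : m.testBit (i + 2) = false) {L : (ZMod 2)⟦X⟧}
    (h : Delta ^ 2 ^ (i + 2) * T (Delta ^ m) + Delta ^ 2 ^ i * T (Delta ^ (m + 2 ^ i)) + L ∈
      fil (d + 1) (wt m + wt (2 ^ (i + 2)))) :
    T (Delta ^ (m + 2 ^ (i + 2))) + L ∈ fil (d + 1) (wt (m + 2 ^ (i + 2))) := by
  rw [wt_add_two_pow hm]
  have h1 := Submodule.add_mem _ (hR i hi m) h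
  have h2 : (2 : (ZMod 2)⟦X⟧) = 0 := CharTwo.two_eq_zero
  convert h1 using 1
  linear_combination -(Delta ^ 2 ^ (i + 2) * T (Delta ^ m) +
    Delta ^ 2 ^ i * T (Delta ^ (m + 2 ^ i))) * h2

/-- One statement covers T_3 and T_5, with x the coordinate that is lowered and y the other one.
Removing the top bit of x or y, the leading term comes from Δ^(2^(i+2)) T(Δ^m), and the second term
of the recurrence is negligible by one of the two lemmas above. The exception is x a power of 2,
where lowering x destroys its top bit: the two terms then exchange roles. -/
theorem leading_term (hU : ∀ k, T (Delta ^ k) ∈ fil d (wt k))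
    (hR : ∀ i, i₀ ≤ i → ∀ m, T (Delta ^ (m + 2 ^ (i + 2))) +
      (Delta ^ 2 ^ (i + 2) * T (Delta ^ m) + Delta ^ 2 ^ i * T (Delta ^ (m + 2 ^ i))) ∈
        fil (d + 1) (wt m + wt (2 ^ (i + 2))))
    (hx : ∀ x y s, (E x y).testBit (2 * s + c) = x.testBit s)
    (hy : ∀ x y s, (E x y).testBit (2 * s + c') = y.testBit s)
    (hxa : ∀ x y s, x.testBit s = false → E (x + 2 ^ s) y = E x y + 2 ^ (2 * s + c))
    (hya : ∀ x y s, y.testBit s = false → E x (y + 2 ^ s) = E x y + 2 ^ (2 * s + c'))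
    (hw : ∀ x y, wt (E (x + 1) y) = wt (E x y) + d)
    (hc : i₀ ≤ c) (hc' : i₀ ≤ 2 * s₀ + c')
    (base : ∀ x < 2, ∀ y < 2 ^ (s₀ + 1),
      T (Delta ^ E x y) + lead E x y ∈ fil (d + 1) (wt (E x y))) (x y : ℕ) :
    T (Delta ^ E x y) + lead E x y ∈ fil (d + 1) (wt (E x y)) := by
  induction x using Nat.strong_induction_on with
  | _ x ihx =>
    by_cases hx2 : x < 2 ^ 1
    · clear ihx
      induction y using Nat.strong_induction_on with
      | _ y ihy =>
        by_cases hy2 : y < 2 ^ (s₀ + 1)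
        · exact base x (by simpa using hx2) y hy2
        obtain ⟨s, y, hs, hys, rfl⟩ := exists_two_pow_add (not_lt.1 hy2)
        obtain ⟨r, rfl⟩ := Nat.exists_eq_add_of_le' (show 1 ≤ s by omega)
        have hpow : 2 ^ r < 2 ^ (r + 1) := Nat.pow_lt_pow_right (by norm_num) (by omega)
        have hpos : 0 < 2 ^ (r + 1) := by positivity
        have hbit := testBit_eq_false_of_lt hys
        have ei : 2 * (r + 1) + c' = (2 * r + c') + 2 := by ring
        have e1 := hya x y (r + 1) hbit
        rw [ei] at e1
        have e2 : lead E x (y + 2 ^ (r + 1)) = Delta ^ 2 ^ (2 * r + c' + 2) * lead E x y := by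
          rcases x with _ | x
          · rw [lead_zero, lead_zero, mul_zero]
          · rw [lead_succ, lead_succ, hya x y (r + 1) hbit, ei, ← pow_add, add_comm]
        rw [e1, e2]
        have hmb : (E x y).testBit (2 * r + c' + 2) = false := by rw [← ei, hy, hbit]
        refine add_lead_mem_fil hR (by omega) hmb ?_
        rw [add_right_comm (Delta ^ _ * _), ← mul_add]
        refine Submodule.add_mem _ ?_ ?_
        · rw [add_comm (wt _)]
          exact pow_mul_mem_fil _ (ihy y (by omega))
        · by_cases hb : y.testBit r = true
          · exact second_term_mem_fil hU (by rw [hy, hb])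
          · rw [Bool.not_eq_true] at hb
            have e3 := hya x y r hb
            have h4 := ihy (y + 2 ^ r) (by omega)
            rw [e3] at h4
            refine second_term_mem_fil' h4 ?_
            rcases x with _ | x
            · exact Or.inl (lead_zero _ _)
            · refine Or.inr ⟨_, lead_succ _ _ _, ?_, ?_⟩
              · rw [hy, add_comm, Nat.testBit_two_pow_add_eq, hb]
                rfl
              · rw [← hw, e3]
    · obtain ⟨s, x, hs, hxs, rfl⟩ := exists_two_pow_add (not_lt.1 hx2)
      obtain ⟨r, rfl⟩ := Nat.exists_eq_add_of_le' hs
      have hpow : 2 ^ (r + 1) = 2 ^ r + 2 ^ r := by ring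
      have hpos : 0 < 2 ^ r := by positivity
      have hbit := testBit_eq_false_of_lt hxs
      have ei : 2 * (r + 1) + c = (2 * r + c) + 2 := by ring
      have e1 := hxa x y (r + 1) hbit
      rw [ei] at e1
      have hmb : (E x y).testBit (2 * r + c + 2) = false := by rw [← ei, hx, hbit]
      rw [e1]
      refine add_lead_mem_fil hR (by omega) hmb ?_
      rcases x with _ | x
      -- Here x = 2^(r+1). The term T(Δ^(E 0 y)) has no leading part, and the second one gives
      -- Δ^(2^(2r+c)) Δ^(E (2^r - 1) y) = Δ^(E (2^(r+1) - 1) y).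
      · have hb : (2 ^ r - 1).testBit r = false := testBit_eq_false_of_lt (by omega)
        have e2 : lead E (0 + 2 ^ (r + 1)) y = Delta ^ 2 ^ (2 * r + c) * lead E (0 + 2 ^ r) y := by
          rw [show 0 + 2 ^ (r + 1) = (2 ^ r - 1 + 2 ^ r) + 1 by omega,
            show 0 + 2 ^ r = (2 ^ r - 1) + 1 by omega, lead_succ, lead_succ, hxa _ _ _ hb,
            ← pow_add, add_comm]
        have e3 := hxa 0 y r (Nat.zero_testBit r)
        have h4 := ihx (0 + 2 ^ r) (by omega)
        have h5 := ihx 0 (by omega)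
        rw [lead_zero, add_zero] at h5
        rw [e2, add_assoc (Delta ^ _ * _), ← mul_add, ← e3]
        have h6 := wt_add_le (E 0 y) (2 ^ (2 * r + c))
        have h7 := wt_two_pow_succ_succ (2 * r + c)
        rw [← e3] at h6
        refine Submodule.add_mem _ ?_ ?_
        · rw [add_comm (wt _)]
          exact pow_mul_mem_fil _ h5
        · exact fil_mono (by omega) (pow_mul_mem_fil _ h4)
      · have e2 : lead E (x + 1 + 2 ^ (r + 1)) y =
            Delta ^ 2 ^ (2 * r + c + 2) * lead E (x + 1) y := by
          rw [show x + 1 + 2 ^ (r + 1) = (x + 2 ^ (r + 1)) + 1 by ring, lead_succ, lead_succ,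
            hxa x y (r + 1) (testBit_eq_false_of_lt (by omega)), ei, ← pow_add, add_comm]
        rw [e2, add_right_comm (Delta ^ _ * _), ← mul_add]
        refine Submodule.add_mem _ ?_ ?_
        · rw [add_comm (wt _)]
          exact pow_mul_mem_fil _ (ihx (x + 1) (by omega))
        · by_cases hb : (x + 1).testBit r = true
          · exact second_term_mem_fil hU (by rw [hx, hb])
          · rw [Bool.not_eq_true] at hb
            have hlt : x + 1 < 2 ^ r := by
              by_contra hge
              rw [not_lt] at hge
              rw [Nat.testBit_eq_decide_div_mod_eq,
                Nat.div_eq_of_lt_le (k := 1) (by omega) (by omega)] at hb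
              simp at hb
            have e3 := hxa (x + 1) y r hb
            have h4 := ihx (x + 1 + 2 ^ r) (by omega)
            rw [e3] at h4
            have e4 : x + 1 + 2 ^ r = x + 2 ^ r + 1 := by ring
            refine second_term_mem_fil' h4 (Or.inr ⟨_, by rw [e4, lead_succ], ?_, ?_⟩)
            · rw [hx, add_comm, Nat.testBit_two_pow_add_eq, testBit_eq_false_of_lt (by omega)]
              rfl
            · rw [← hw, ← e4, e3]

end LeadingTerm

theorem expo_small {r t : ℕ} (hr : r < 2) (ht : t < 2) : expo r t = 1 + 2 * (r + 2 * t) := by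
  have := interleave_two_mul_add 0 0 r t hr ht
  simp only [mul_zero, zero_add, interleave_zero] at this
  rw [expo, this]

theorem heckeT_three_add_lead_mem_fil (a b : ℕ) :
    heckeT 3 (Delta ^ expo a b) + lead expo a b ∈ fil 4 (wt (expo a b)) := by
  refine leading_term (i₀ := 0) (c := 1) (c' := 2) (s₀ := 0) heckeT_three_mem_fil
    (fun i _ m => heckeT_three_add_mem_fil i m) testBit_expo_left testBit_expo_right
    (fun x y s h => expo_add_left y h) (fun x y s h => expo_add_right x h)
    (fun x y => by rw [wt_expo, wt_expo]; ring) (by norm_num) (by norm_num) ?_ a b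
  intro x hx y hy
  have h5 : heckeT 3 (Delta ^ 5) = 0 := by
    have := heckeT_three_recurrence 0 1
    norm_num at this
    rw [this, heckeT_three_two, show heckeT 3 Delta = 0 by simpa using heckeT_three_one]
    simp
  have h4 : heckeT 3 (Delta ^ 4) = 0 := by
    have := heckeT_three_recurrence 0 0
    norm_num at this
    rw [this, show heckeT 3 Delta = 0 by simpa using heckeT_three_one, heckeT_one 3 (by norm_num)]
    simp
  have h7 : heckeT 3 (Delta ^ 7) = Delta ^ 5 := by
    have := heckeT_three_recurrence 0 3
    norm_num at this
    rw [this, heckeT_three_three, h4]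
    ring
  interval_cases x <;> interval_cases y <;>
    simp only [lead, one_ne_zero, if_false, Nat.sub_self, expo_small zero_lt_two zero_lt_two,
      expo_small zero_lt_two one_lt_two, expo_small one_lt_two zero_lt_two,
      expo_small one_lt_two one_lt_two]
  · norm_num [show heckeT 3 Delta = 0 by simpa using heckeT_three_one]
  · norm_num [h5]
  · norm_num [heckeT_three_three, CharTwo.add_self_eq_zero]
  · norm_num [h7, CharTwo.add_self_eq_zero]

/-- The coordinates are exchanged, since T_5 lowers b. Its recurrence starts at the bit 2^4, whence
base cases b < 2 and a < 4. -/
theorem heckeT_five_add_lead_mem_fil (a b : ℕ) :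
    heckeT 5 (Delta ^ expo a b) + lead (fun x y => expo y x) b a ∈ fil 5 (wt (expo a b)) := by
  refine leading_term (i₀ := 2) (c := 2) (c' := 1) (s₀ := 1) (E := fun x y => expo y x)
    heckeT_five_mem_fil
    (fun i hi m => heckeT_five_add_mem_fil hi m) (fun x y => testBit_expo_right y x)
    (fun x y => testBit_expo_left y x)
    (fun x y s h => expo_add_right y h) (fun x y s h => expo_add_left x h)
    (fun x y => by simp only [wt_expo]; ring) (by norm_num) (by norm_num) ?_ b a
  intro x hx y hy
  have e2 : ∀ t < 2, expo 2 t = 1 + 2 * (4 + 2 * t) := by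
    intro t ht
    have := interleave_two_mul_add 1 0 0 t (by norm_num) ht
    have e := expo_small one_lt_two zero_lt_two
    norm_num [expo] at this e
    rw [expo, this]
    omega
  have e3 : ∀ t < 2, expo 3 t = 1 + 2 * (5 + 2 * t) := by
    intro t ht
    have := interleave_two_mul_add 1 0 1 t (by norm_num) ht
    have e := expo_small one_lt_two zero_lt_two
    norm_num [expo] at this e
    rw [expo, this]
    omega
  interval_cases x <;> interval_cases y <;>
    simp only [lead, one_ne_zero, if_false, Nat.sub_self,
      expo_small zero_lt_two zero_lt_two,
      expo_small zero_lt_two one_lt_two, expo_small one_lt_two zero_lt_two,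
      expo_small one_lt_two one_lt_two, e2 _ zero_lt_two, e2 _ one_lt_two, e3 _ zero_lt_two,
      e3 _ one_lt_two]
  · norm_num [show heckeT 5 Delta = 0 by simpa using heckeT_five_one]
  · norm_num [heckeT_five_three]
  · norm_num [heckeT_five_nine]
  · norm_num [heckeT_five_eleven]
  · norm_num [heckeT_five_five, CharTwo.add_self_eq_zero]
  · norm_num [heckeT_five_seven, CharTwo.add_self_eq_zero]
  · norm_num [heckeT_five_thirteen, CharTwo.add_self_eq_zero]
  -- The only base case with a remainder: T_5 Δ^15 = Δ^11 + Δ^3, where Δ^3 has lower weight than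
  -- Δ^11.
  · rw [show 1 + 2 * (5 + 2 * 1) = 15 by norm_num, heckeT_five_fifteen,
      show 1 + 2 * (5 + 2 * 0) = 11 by norm_num, add_right_comm, CharTwo.add_self_eq_zero, zero_add]
    exact pow_mem_fil (by norm_num [wt_of_lt_sixteen])

/-! ### Pairing of monomials in `T_3`, `T_5` with powers of `Δ` -/

theorem heckeT_five_pow_add_mem_fil (j a b : ℕ) :
    (heckeT 5 ^ j : Module.End (ZMod 2) (ZMod 2)⟦X⟧) (Delta ^ expo a b) +
      (if j ≤ b then Delta ^ expo a (b - j) else 0) ∈ fil (4 * j + 1) (wt (expo a b)) := by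
  induction j with
  | zero =>
    simp only [pow_zero, Module.End.one_apply, zero_le, if_true, Nat.sub_zero,
      CharTwo.add_self_eq_zero]
    exact Submodule.zero_mem _
  | succ j ih =>
    have h1 := map_mem_fil heckeT_five_mem_fil ih
    rw [map_add, ← Module.End.mul_apply, ← pow_succ'] at h1
    have h2 : heckeT 5 (if j ≤ b then Delta ^ expo a (b - j) else 0) +
        (if j + 1 ≤ b then Delta ^ expo a (b - (j + 1)) else 0) ∈
          fil (4 * (j + 1) + 1) (wt (expo a b)) := by
      by_cases hj : j ≤ b
      · have h3 := heckeT_five_add_lead_mem_fil a (b - j)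
        rw [if_pos hj]
        refine fil_mono ?_ (?_ : _ ∈ fil 5 (wt (expo a (b - j))))
        · rw [wt_expo, wt_expo]
          omega
        · convert h3 using 2
          rw [lead]
          by_cases hj' : j + 1 ≤ b
          · rw [if_pos hj', if_neg (by omega), Nat.sub_sub]
          · rw [if_neg hj', if_pos (by omega)]
      · rw [if_neg hj, if_neg (by omega), map_zero, add_zero]
        exact Submodule.zero_mem _
    have h4 := Submodule.add_mem _ (fil_mono (by omega) h1) h2
    rwa [← add_assoc, add_assoc _ _ (heckeT 5 _), CharTwo.add_self_eq_zero, add_zero] at h4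

theorem heckeT_pow_pow_add_mem_fil (i j a b : ℕ) :
    (heckeT 3 ^ i : Module.End (ZMod 2) (ZMod 2)⟦X⟧)
      ((heckeT 5 ^ j : Module.End (ZMod 2) (ZMod 2)⟦X⟧) (Delta ^ expo a b)) +
      (if i ≤ a ∧ j ≤ b then Delta ^ expo (a - i) (b - j) else 0) ∈
        fil (3 * i + 4 * j + 1) (wt (expo a b)) := by
  induction i with
  | zero =>
    simpa using heckeT_five_pow_add_mem_fil j a b
  | succ i ih =>
    have h1 := map_mem_fil heckeT_three_mem_fil ih
    rw [map_add, ← Module.End.mul_apply, ← pow_succ'] at h1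
    have h2 : heckeT 3 (if i ≤ a ∧ j ≤ b then Delta ^ expo (a - i) (b - j) else 0) +
        (if i + 1 ≤ a ∧ j ≤ b then Delta ^ expo (a - (i + 1)) (b - j) else 0) ∈
          fil (3 * (i + 1) + 4 * j + 1) (wt (expo a b)) := by
      by_cases hj : i ≤ a ∧ j ≤ b
      · have h3 := heckeT_three_add_lead_mem_fil (a - i) (b - j)
        rw [if_pos hj]
        refine fil_mono ?_ (?_ : _ ∈ fil 4 (wt (expo (a - i) (b - j))))
        · rw [wt_expo, wt_expo]
          omega
        · convert h3 using 2
          rw [lead]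
          by_cases hj' : i + 1 ≤ a
          · rw [if_pos ⟨hj', hj.2⟩, if_neg (by omega), Nat.sub_sub]
          · rw [if_neg (by omega), if_pos (by omega)]
      · rw [if_neg hj, if_neg (by omega), map_zero, add_zero]
        exact Submodule.zero_mem _
    have h4 := Submodule.add_mem _ (fil_mono (by omega) h1) h2
    rwa [← add_assoc, add_assoc _ _ (heckeT 3 _), CharTwo.add_self_eq_zero, add_zero] at h4

/-- Nonzero exponents have weight at least 2, so only the constant series can remain. -/
theorem coeff_one_eq_zero_of_mem_fil {d w : ℕ} (h : w < d + 2) {f : (ZMod 2)⟦X⟧}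
    (hf : f ∈ fil d w) : PowerSeries.coeff 1 f = 0 := by
  have : fil d w ≤ LinearMap.ker (PowerSeries.coeff (R := ZMod 2) 1) := by
    rw [fil, Submodule.span_le]
    rintro _ ⟨l, hl, rfl⟩
    rcases eq_or_ne l 0 with rfl | hl0
    · simp [PowerSeries.coeff_one]
    · have := two_le_wt hl0
      omega
  exact this hf

/-- Monomials in `T_3`, `T_5` pair with the powers `Δ^(expo a b)`, ordered by weight, through a
triangular matrix. -/
theorem coeff_one_heckeT_pow_pow {i j a b : ℕ} (h : 3 * a + 4 * b ≤ 3 * i + 4 * j) :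
    PowerSeries.coeff 1 ((heckeT 3 ^ i : Module.End (ZMod 2) (ZMod 2)⟦X⟧)
      ((heckeT 5 ^ j : Module.End (ZMod 2) (ZMod 2)⟦X⟧) (Delta ^ expo a b))) =
      if i = a ∧ j = b then 1 else 0 := by
  have h1 := coeff_one_eq_zero_of_mem_fil (by rw [wt_expo]; omega)
    (heckeT_pow_pow_add_mem_fil i j a b)
  rw [map_add, CharTwo.add_eq_zero] at h1
  rw [h1]
  by_cases hij : i ≤ a ∧ j ≤ b
  · obtain ⟨rfl, rfl⟩ : i = a ∧ j = b := by omega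
    rw [if_pos hij, if_pos ⟨rfl, rfl⟩, Nat.sub_self, Nat.sub_self, expo_zero_zero, pow_one,
      coeff_Delta_one]
  · rw [if_neg hij, if_neg (fun hh => hij ⟨hh.1.le, hh.2.le⟩), map_zero]

theorem heckeT_pow_pow_mem_fil (i j k : ℕ) :
    (heckeT 3 ^ i : Module.End (ZMod 2) (ZMod 2)⟦X⟧)
      ((heckeT 5 ^ j : Module.End (ZMod 2) (ZMod 2)⟦X⟧) (Delta ^ k)) ∈
        fil (3 * i + 4 * j) (wt k) := by
  have h5 : (heckeT 5 ^ j : Module.End (ZMod 2) (ZMod 2)⟦X⟧) (Delta ^ k) ∈ fil (4 * j) (wt k) := by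
    induction j with
    | zero => exact pow_mem_fil (by omega)
    | succ j ih =>
      rw [pow_succ', Module.End.mul_apply]
      exact map_mem_fil heckeT_five_mem_fil ih
  induction i with
  | zero => simpa using h5
  | succ i ih =>
    rw [pow_succ', Module.End.mul_apply]
    exact fil_mono (by omega) (map_mem_fil heckeT_three_mem_fil ih)

theorem fil_eq_bot {d w : ℕ} (h : w < d) : fil d w = ⊥ := by
  rw [fil, Submodule.span_eq_bot]
  rintro _ ⟨l, hl, rfl⟩
  omega

/-- Monomials in `T_3`, `T_5` of large degree vanish on `F n`. -/
theorem exists_heckeT_pow_pow_eq_zero (n : ℕ) : ∃ N : ℕ, ∀ i j, N ≤ i + j → ∀ f ∈ F n,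
    (heckeT 3 ^ i : Module.End (ZMod 2) (ZMod 2)⟦X⟧)
      ((heckeT 5 ^ j : Module.End (ZMod 2) (ZMod 2)⟦X⟧) f) = 0 := by
  -- A crude bound: 3i + 4j ≥ i + j exceeds the weight of every exponent occurring in F n.
  refine ⟨∑ k ∈ Finset.range n, wt (2 * k + 1) + 1, fun i j hij f hf => ?_⟩
  have : F n ≤ LinearMap.ker ((heckeT 3 ^ i : Module.End (ZMod 2) (ZMod 2)⟦X⟧) *
      (heckeT 5 ^ j : Module.End (ZMod 2) (ZMod 2)⟦X⟧)) := by
    rw [F, Submodule.span_le]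
    rintro _ ⟨k, hk, rfl⟩
    have h1 := heckeT_pow_pow_mem_fil i j (2 * k + 1)
    have h2 := Finset.single_le_sum (f := fun k => wt (2 * k + 1)) (fun _ _ => Nat.zero_le _)
      (Finset.mem_range.2 hk)
    rw [fil_eq_bot (by omega)] at h1
    exact (Submodule.mem_bot _).1 h1
  exact this hf

/-! ### Power series in two variables -/

section TwoVariables

open MvPowerSeries

variable {K : Type*} [Field K]

/-- The exponent vector `(i, j)`. -/
noncomputable def expVec (i j : ℕ) : Fin 2 →₀ ℕ := Finsupp.single 0 i + Finsupp.single 1 j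

theorem expVec_zero (i j : ℕ) : expVec i j 0 = i := by simp [expVec]

theorem expVec_one (i j : ℕ) : expVec i j 1 = j := by simp [expVec]

theorem expVec_eta (d : Fin 2 →₀ ℕ) : expVec (d 0) (d 1) = d := by
  ext i
  fin_cases i
  · exact expVec_zero _ _
  · exact expVec_one _ _

theorem expVec_inj {i j i' j' : ℕ} : expVec i j = expVec i' j' ↔ i = i' ∧ j = j' := by
  constructor
  · intro h
    have h0 := congrArg (fun d => d 0) h
    have h1 := congrArg (fun d => d 1) h
    simp only [expVec_zero, expVec_one] at h0 h1
    exact ⟨h0, h1⟩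
  · rintro ⟨rfl, rfl⟩
    rfl

theorem X_pow_mul_X_pow (i j : ℕ) :
    (X 0 ^ i * X 1 ^ j : MvPowerSeries (Fin 2) K) = monomial (expVec i j) 1 := by
  rw [X_pow_eq, X_pow_eq, monomial_mul_monomial, one_mul, expVec]

theorem exists_eq_sum_add (M : ℕ) (s : MvPowerSeries (Fin 2) K) :
    ∃ r₀ r₁ : MvPowerSeries (Fin 2) K, s = ∑ i ∈ Finset.range M, ∑ j ∈ Finset.range M,
      coeff (expVec i j) s • (X 0 ^ i * X 1 ^ j) + X 0 ^ M * r₀ + X 1 ^ M * r₁ := by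
  obtain ⟨r₀, h₀⟩ : ∃ r : MvPowerSeries (Fin 2) K, ∀ d, coeff d r =
    coeff (d + Finsupp.single 0 M) s := ⟨fun d => coeff (d + Finsupp.single 0 M) s, fun d => rfl⟩
  -- The condition d 0 < M keeps the monomials divisible by both M-th powers from being counted
  -- twice.
  obtain ⟨r₁, h₁⟩ : ∃ r : MvPowerSeries (Fin 2) K, ∀ d, coeff d r =
      if d 0 < M then coeff (d + Finsupp.single 1 M) s else 0 :=
    ⟨fun d => if d 0 < M then coeff (d + Finsupp.single 1 M) s else 0, fun d => rfl⟩
  refine ⟨r₀, r₁, ?_⟩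
  ext d
  obtain ⟨a, b, rfl⟩ : ∃ a b, expVec a b = d := ⟨d 0, d 1, expVec_eta d⟩
  have h1 : coeff (expVec a b) (∑ i ∈ Finset.range M, ∑ j ∈ Finset.range M,
      coeff (expVec i j) s • (X 0 ^ i * X 1 ^ j : MvPowerSeries (Fin 2) K)) =
      if a < M ∧ b < M then coeff (expVec a b) s else 0 := by
    classical
    simp only [map_sum, X_pow_mul_X_pow, coeff_smul, coeff_monomial, expVec_inj, mul_ite, mul_one,
      mul_zero]
    by_cases h : a < M ∧ b < M
    · rw [if_pos h, Finset.sum_eq_single a, Finset.sum_eq_single b]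
      · simp
      · intro j _ hj
        rw [if_neg (fun hh => hj hh.2.symm)]
      · intro hh
        exact absurd (Finset.mem_range.2 h.2) hh
      · intro i _ hi
        exact Finset.sum_eq_zero fun j _ => if_neg fun hh => hi hh.1.symm
      · intro hh
        exact absurd (Finset.mem_range.2 h.1) hh
    · rw [if_neg h]
      refine Finset.sum_eq_zero fun i hi => Finset.sum_eq_zero fun j hj => if_neg ?_
      rintro ⟨rfl, rfl⟩
      exact h ⟨Finset.mem_range.1 hi, Finset.mem_range.1 hj⟩
  have e0 : ∀ r : MvPowerSeries (Fin 2) K, coeff (expVec a b) (X 0 ^ M * r) =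
      if M ≤ a then coeff (expVec (a - M) b) r else 0 := by
    intro r
    classical
    rw [X_pow_eq, coeff_monomial_mul, one_mul]
    simp only [Finsupp.single_le_iff, expVec_zero]
    have e : expVec a b - Finsupp.single 0 M = expVec (a - M) b := by
      ext i
      fin_cases i <;> simp [expVec]
    rw [e]
  have e1 : ∀ r : MvPowerSeries (Fin 2) K, coeff (expVec a b) (X 1 ^ M * r) =
      if M ≤ b then coeff (expVec a (b - M)) r else 0 := by
    intro r
    classical
    rw [X_pow_eq, coeff_monomial_mul, one_mul]
    simp only [Finsupp.single_le_iff, expVec_one]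
    have e : expVec a b - Finsupp.single 1 M = expVec a (b - M) := by
      ext i
      fin_cases i <;> simp [expVec]
    rw [e]
  rw [map_add, map_add, h1, e0, e1]
  rw [h₀, h₁, expVec_zero]
  have g0 : M ≤ a → expVec (a - M) b + Finsupp.single 0 M = expVec a b := by
    intro h
    ext i
    fin_cases i
    · simp [expVec, Nat.sub_add_cancel h]
    · simp [expVec]
  have g1 : M ≤ b → expVec a (b - M) + Finsupp.single 1 M = expVec a b := by
    intro h
    ext i
    fin_cases i
    · simp [expVec]
    · simp [expVec, Nat.sub_add_cancel h]
  by_cases ha : M ≤ a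
  · rw [if_neg (by omega), if_pos ha, g0 ha]
    simp [not_lt.2 ha]
  · by_cases hb : M ≤ b
    · rw [if_neg (by omega), if_neg ha, if_pos hb, if_pos (not_le.1 ha), g1 hb]
      simp
    · rw [if_pos ⟨not_le.1 ha, not_le.1 hb⟩, if_neg ha, if_neg hb]
      simp

theorem two_le_ringKrullDim : 2 ≤ ringKrullDim (MvPowerSeries (Fin 2) K) := by
  have e0 := ringKrullDim_eq_of_ringEquiv (isEmptyEquiv (Fin 0) K).toRingEquiv
  have e1 := ringKrullDim_eq_of_ringEquiv (finSuccEquiv K 0).toRingEquiv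
  have e2 := ringKrullDim_eq_of_ringEquiv (finSuccEquiv K 1).toRingEquiv
  have h1 := ringKrullDim_succ_le_ringKrullDim_powerseries (R := MvPowerSeries (Fin 0) K)
  have h2 := ringKrullDim_succ_le_ringKrullDim_powerseries (R := MvPowerSeries (Fin 1) K)
  rw [e0, ringKrullDim_eq_zero_of_field, zero_add, ← e1] at h1
  rw [← e2] at h2
  refine le_trans ?_ h2
  calc (2 : WithBot ℕ∞) = 1 + 1 := by norm_num
    _ ≤ _ := by gcongr

theorem spanFinrank_maximalIdeal_le_two :
    (IsLocalRing.maximalIdeal (MvPowerSeries (Fin 2) K)).spanFinrank ≤ 2 := by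
  have h : IsLocalRing.maximalIdeal (MvPowerSeries (Fin 2) K) = Ideal.span {X 0, X 1} := by
    have hX : ∀ i : Fin 2, (X i : MvPowerSeries (Fin 2) K) ∈
        IsLocalRing.maximalIdeal (MvPowerSeries (Fin 2) K) := by
      intro i
      rw [IsLocalRing.mem_maximalIdeal, mem_nonunits_iff, isUnit_iff_constantCoeff,
        constantCoeff_X]
      exact not_isUnit_zero
    apply le_antisymm
    · intro s hs
      rw [IsLocalRing.mem_maximalIdeal, mem_nonunits_iff, isUnit_iff_constantCoeff,
        isUnit_iff_ne_zero, not_not] at hs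
      obtain ⟨r₀, r₁, hr⟩ := exists_eq_sum_add 1 s
      have e : expVec 0 0 = 0 := by simp [expVec]
      simp only [Finset.range_one, Finset.sum_singleton, e, coeff_zero_eq_constantCoeff_apply, hs,
        zero_smul, zero_add, pow_one] at hr
      rw [hr]
      exact Ideal.add_mem _ (Ideal.mul_mem_right _ _ (Ideal.subset_span (by simp)))
        (Ideal.mul_mem_right _ _ (Ideal.subset_span (by simp)))
    · rw [Ideal.span_le]
      rintro _ (rfl | rfl)
      · exact hX 0
      · exact hX 1
  rw [h]
  exact (Submodule.spanFinrank_span_le_ncard_of_finite (by simp)).trans 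
    ((Set.ncard_insert_le _ _).trans (by rw [Set.ncard_singleton]))

/-- The maximal ideal is generated by the two variables, and the Krull dimension is at least 2
because each variable raises it by at least one. -/
theorem isRegularLocalRing_mvPowerSeries : IsRegularLocalRing (MvPowerSeries (Fin 2) K) := by
  apply IsRegularLocalRing.of_spanFinrank_maximalIdeal_le
  refine le_trans ?_ two_le_ringKrullDim
  exact_mod_cast spanFinrank_maximalIdeal_le_two (K := K)

theorem ringKrullDim_mvPowerSeries : ringKrullDim (MvPowerSeries (Fin 2) K) = 2 := by
  refine le_antisymm ((ringKrullDim_le_spanFinrank_maximalIdeal _).trans ?_) two_le_ringKrullDim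
  exact_mod_cast spanFinrank_maximalIdeal_le_two (K := K)

open scoped Classical in
/-- Evaluation of power series at nilpotent elements. -/
theorem exists_algHom_of_isNilpotent {R : Type*} [CommRing R] [Algebra K R] (a : Fin 2 → R)
    (ha : ∀ i, IsNilpotent (a i)) :
    ∃ φ : MvPowerSeries (Fin 2) K →ₐ[K] R, ∀ i, φ (X i) = a i := by
  -- For discrete topologies nilpotent elements are topologically nilpotent, so evaluation of power
  -- series applies.
  let : UniformSpace K := ⊥
  let : UniformSpace R := ⊥
  have : DiscreteTopology K := ⟨rfl⟩
  have : DiscreteTopology R := ⟨rfl⟩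
  have : DiscreteUniformity K := ⟨rfl⟩
  have : DiscreteUniformity R := ⟨rfl⟩
  have : ContinuousSMul K R := ⟨continuous_of_discreteTopology⟩
  have hev : HasEval a :=
    { hpow := fun i => by
        obtain ⟨N, hN⟩ := ha i
        exact tendsto_atTop_of_eventually_const (i₀ := N) fun n hn => by
          obtain ⟨m, rfl⟩ := Nat.exists_eq_add_of_le hn
          rw [pow_add, hN, zero_mul]
      tendsto_zero := by
        rw [Filter.cofinite_eq_bot]
        exact Filter.tendsto_bot }
  refine ⟨aeval hev, fun i => ?_⟩
  have := aeval_coe hev (MvPolynomial.X i : MvPolynomial (Fin 2) K)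
  simpa using this

end TwoVariables

/-! ### The Hecke algebra -/

/-- The element of `A(n)` given by `T_p`. -/
noncomputable def heckeAlgT (n p : ℕ) (hp : p.Prime) (hp2 : p ≠ 2) : HeckeAlg n :=
  ⟨(heckeT p).restrict (heckeT_mem_F hp hp2 n), Algebra.subset_adjoin ⟨p, hp, hp2, fun _ => rfl⟩⟩

/-- The projection from `A` to `End(F(n))`. -/
noncomputable def componentHom (n : ℕ+) : A →ₐ[ZMod 2] Module.End (ZMod 2) (F n) :=
  (HeckeAlg n).val.comp ((Pi.evalAlgHom (ZMod 2) (fun n : ℕ+ => HeckeAlg n) n).comp A.val)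

theorem componentHom_apply (n : ℕ+) (u : A) : componentHom n u = component u n := rfl

theorem ext_component {u v : A} (h : ∀ (n : ℕ+) (f : F n), component u n f = component v n f) : u = v := by
  apply Subtype.ext
  funext n
  apply Subtype.ext
  exact LinearMap.ext (h n)

theorem coe_pow_apply {n p : ℕ} {u : Module.End (ZMod 2) (F n)}
    (hu : ∀ f : F n, (u f : (ZMod 2)⟦X⟧) = heckeT p f) (i : ℕ) (f : F n) :
    (((u ^ i) f : F n) : (ZMod 2)⟦X⟧) =
      (heckeT p ^ i : Module.End (ZMod 2) (ZMod 2)⟦X⟧) (f : (ZMod 2)⟦X⟧) := by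
  induction i with
  | zero => rfl
  | succ i ih =>
    rw [pow_succ', pow_succ', Module.End.mul_apply, Module.End.mul_apply, hu, ih]

/-- The value of a power series in `T_3`, `T_5` on `F n` is given by a finite sum. -/
theorem exists_algHom_apply_eq_sum (n : ℕ) : ∃ N : ℕ, ∀ M, N ≤ M →
    ∀ χ : MvPowerSeries (Fin 2) (ZMod 2) →ₐ[ZMod 2] Module.End (ZMod 2) (F n),
    (∀ f : F n, (χ (MvPowerSeries.X 0) f : (ZMod 2)⟦X⟧) = heckeT 3 f) →
    (∀ f : F n, (χ (MvPowerSeries.X 1) f : (ZMod 2)⟦X⟧) = heckeT 5 f) →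
    ∀ (s : MvPowerSeries (Fin 2) (ZMod 2)) (f : F n), (χ s f : (ZMod 2)⟦X⟧) =
      ∑ x ∈ Finset.range M ×ˢ Finset.range M, MvPowerSeries.coeff (expVec x.1 x.2) s •
        (heckeT 3 ^ x.1 : Module.End (ZMod 2) (ZMod 2)⟦X⟧)
          ((heckeT 5 ^ x.2 : Module.End (ZMod 2) (ZMod 2)⟦X⟧) (f : (ZMod 2)⟦X⟧)) := by
  obtain ⟨N, hN⟩ := exists_heckeT_pow_pow_eq_zero n
  refine ⟨N, fun M hM χ h3 h5 s f => ?_⟩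
  -- The tail is X_0^M r₀ + X_1^M r₁, and χ kills both M-th powers. No continuity of χ is used,
  -- which is why uniqueness of ψ holds among all algebra homomorphisms.
  obtain ⟨r₀, r₁, hr⟩ := exists_eq_sum_add M s
  have h3' := coe_pow_apply h3
  have h5' := coe_pow_apply h5
  have e0 : ∀ g : F n, (((χ (MvPowerSeries.X 0) ^ M) g : F n) : (ZMod 2)⟦X⟧) = 0 := by
    intro g
    rw [h3']
    simpa using hN M 0 (by omega) g g.2
  have e1 : ∀ g : F n, (((χ (MvPowerSeries.X 1) ^ M) g : F n) : (ZMod 2)⟦X⟧) = 0 := by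
    intro g
    rw [h5']
    simpa using hN 0 M (by omega) g g.2
  have key := congrArg (fun t => ((χ t f : F n) : (ZMod 2)⟦X⟧)) hr
  simp only [map_add, map_sum, map_smul, map_mul, map_pow, LinearMap.add_apply,
    Module.End.mul_apply, Submodule.coe_add, e0, e1, add_zero, LinearMap.sum_apply,
    LinearMap.smul_apply, Submodule.coe_sum, Submodule.coe_smul, h3', h5'] at key
  rw [key, Finset.sum_product]

theorem isNilpotent_heckeAlgT (n p : ℕ) (hp : p.Prime) (hp2 : p ≠ 2)
    (h : ∃ N : ℕ, ∀ f ∈ F n, (heckeT p ^ N : Module.End (ZMod 2) (ZMod 2)⟦X⟧) f = 0) :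
    IsNilpotent (heckeAlgT n p hp hp2) := by
  obtain ⟨N, hN⟩ := h
  refine ⟨N, Subtype.ext (LinearMap.ext fun f => Subtype.ext ?_)⟩
  exact (coe_pow_apply (u := (heckeT p).restrict (heckeT_mem_F hp hp2 n)) (fun _ => rfl) N f).trans
    (hN f f.2)

/-- Evaluation of power series at `T_3`, `T_5` in `A(n)`. -/
theorem exists_evalHom (n : ℕ) : ∃ φ : MvPowerSeries (Fin 2) (ZMod 2) →ₐ[ZMod 2] HeckeAlg n,
    φ (MvPowerSeries.X 0) = heckeAlgT n 3 Nat.prime_three (by norm_num) ∧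
    φ (MvPowerSeries.X 1) = heckeAlgT n 5 Nat.prime_five (by norm_num) := by
  obtain ⟨N, hN⟩ := exists_heckeT_pow_pow_eq_zero n
  obtain ⟨φ, hφ⟩ := exists_algHom_of_isNilpotent (K := ZMod 2)
    ![heckeAlgT n 3 Nat.prime_three (by norm_num), heckeAlgT n 5 Nat.prime_five (by norm_num)] (by
      intro i
      fin_cases i
      · exact isNilpotent_heckeAlgT _ 3 Nat.prime_three (by norm_num)
          ⟨N, fun f hf => by simpa using hN N 0 (by omega) f hf⟩
      · exact isNilpotent_heckeAlgT _ 5 Nat.prime_five (by norm_num)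
          ⟨N, fun f hf => by simpa using hN 0 N (by omega) f hf⟩)
  exact ⟨φ, hφ 0, hφ 1⟩

theorem exists_hom : ∃ ψ : MvPowerSeries (Fin 2) (ZMod 2) →ₐ[ZMod 2] A,
    IsHecke 3 (ψ (MvPowerSeries.X 0)) ∧ IsHecke 5 (ψ (MvPowerSeries.X 1)) := by
  choose φ hφ3 hφ5 using exists_evalHom
  have h3 : ∀ n (f : F n), (((HeckeAlg n).val.comp (φ n)) (MvPowerSeries.X 0) f : (ZMod 2)⟦X⟧) =
      heckeT 3 f := by
    intro n f
    rw [AlgHom.comp_apply, hφ3]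
    rfl
  have h5 : ∀ n (f : F n), (((HeckeAlg n).val.comp (φ n)) (MvPowerSeries.X 1) f : (ZMod 2)⟦X⟧) =
      heckeT 5 f := by
    intro n f
    rw [AlgHom.comp_apply, hφ5]
    rfl
  refine ⟨AlgHom.codRestrict (AlgHom.pi fun n : ℕ+ => φ n) A ?_, ?_, ?_⟩
  · intro s m n _ f g hfg
    obtain ⟨N, hN⟩ := exists_algHom_apply_eq_sum m
    obtain ⟨N', hN'⟩ := exists_algHom_apply_eq_sum n
    -- A common bound makes the components in degrees m and n the same finite sum, whence
    -- compatibility with restriction.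
    have h1 := hN (max N N') (le_max_left _ _) _ (h3 m) (h5 m) s f
    have h2 := hN' (max N N') (le_max_right _ _) _ (h3 n) (h5 n) s g
    rw [← hfg, ← h1] at h2
    exact h2.symm
  · intro n f
    exact h3 n f
  · intro n f
    exact h5 n f

theorem exists_component_apply_eq_sum (n : ℕ+) : ∃ N : ℕ, ∀ M, N ≤ M →
    ∀ ψ : MvPowerSeries (Fin 2) (ZMod 2) →ₐ[ZMod 2] A,
    IsHecke 3 (ψ (MvPowerSeries.X 0)) → IsHecke 5 (ψ (MvPowerSeries.X 1)) →
    ∀ (s : MvPowerSeries (Fin 2) (ZMod 2)) (f : F n),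
      (component (ψ s) n f : (ZMod 2)⟦X⟧) =
      ∑ x ∈ Finset.range M ×ˢ Finset.range M, MvPowerSeries.coeff (expVec x.1 x.2) s •
        (heckeT 3 ^ x.1 : Module.End (ZMod 2) (ZMod 2)⟦X⟧)
          ((heckeT 5 ^ x.2 : Module.End (ZMod 2) (ZMod 2)⟦X⟧) (f : (ZMod 2)⟦X⟧)) := by
  obtain ⟨N, hN⟩ := exists_algHom_apply_eq_sum n
  exact ⟨N, fun M hM ψ h3 h5 s f => hN M hM ((componentHom n).comp ψ) (h3 n) (h5 n) s f⟩

theorem hom_unique {φ ψ : MvPowerSeries (Fin 2) (ZMod 2) →ₐ[ZMod 2] A}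
    (hφ3 : IsHecke 3 (φ (MvPowerSeries.X 0))) (hφ5 : IsHecke 5 (φ (MvPowerSeries.X 1)))
    (hψ3 : IsHecke 3 (ψ (MvPowerSeries.X 0))) (hψ5 : IsHecke 5 (ψ (MvPowerSeries.X 1))) :
    φ = ψ := by
  refine AlgHom.ext fun s => ext_component fun (n : ℕ+) f => Subtype.ext ?_
  obtain ⟨N, hN⟩ := exists_component_apply_eq_sum n
  rw [hN N le_rfl φ hφ3 hφ5, hN N le_rfl ψ hψ3 hψ5]

theorem isContinuousHom {ψ : MvPowerSeries (Fin 2) (ZMod 2) →ₐ[ZMod 2] A}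
    (h3 : IsHecke 3 (ψ (MvPowerSeries.X 0))) (h5 : IsHecke 5 (ψ (MvPowerSeries.X 1))) : IsContinuousHom ψ := by
  intro n
  obtain ⟨N, hN⟩ := exists_component_apply_eq_sum n
  -- Pairs in [0, N)² have coordinate sum below 2N.
  refine ⟨2 * N, fun s hs => LinearMap.ext fun f => Subtype.ext ?_⟩
  rw [hN N le_rfl ψ h3 h5]
  refine Finset.sum_eq_zero fun x hx => ?_
  rw [Finset.mem_product, Finset.mem_range, Finset.mem_range] at hx
  rw [hs _ (by rw [expVec_zero, expVec_one]; omega), zero_smul]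

/-! ### Duality between A and the powers of Δ: bijectivity of ψ -/

theorem Delta_pow_expo_mem_F {a b n : ℕ} (h : interleave a b < n) : Delta ^ expo a b ∈ F n :=
  Submodule.subset_span ⟨_, h, by rw [expo, add_comm]⟩

/-- The coefficient of `q` in `u Δ^(expo a b)`. -/
noncomputable def firstCoeff (u : A) (a b : ℕ) : ZMod 2 :=
  PowerSeries.coeff 1 (component u (interleave a b).succPNat
    ⟨Delta ^ expo a b, Delta_pow_expo_mem_F (Nat.lt_succ_self _)⟩ : (ZMod 2)⟦X⟧)

theorem firstCoeff_eq (u : A) {a b : ℕ} {n : ℕ+} (h : interleave a b < n) :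
    firstCoeff u a b = PowerSeries.coeff 1
      (component u n ⟨Delta ^ expo a b, Delta_pow_expo_mem_F h⟩ : (ZMod 2)⟦X⟧) :=
  congrArg _ (u.2 (interleave a b).succPNat n (Nat.succ_le_of_lt h) _ _ rfl)

/-- The pairs of smaller weight than `(a, b)`. -/
def lowerPairs (a b : ℕ) : Finset (ℕ × ℕ) :=
  (Finset.range (3 * a + 4 * b + 1) ×ˢ Finset.range (3 * a + 4 * b + 1)).filter
    fun x => 3 * x.1 + 4 * x.2 < 3 * a + 4 * b

theorem mem_lowerPairs {a b : ℕ} {x : ℕ × ℕ} :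
    x ∈ lowerPairs a b ↔ 3 * x.1 + 4 * x.2 < 3 * a + 4 * b := by
  rw [lowerPairs, Finset.mem_filter, Finset.mem_product, Finset.mem_range, Finset.mem_range]
  omega

/-- The coefficient of `q` in `T_3^i T_5^j Δ^(expo a b)`. -/
noncomputable def pairing (x : ℕ × ℕ) (a b : ℕ) : ZMod 2 :=
  PowerSeries.coeff 1 ((heckeT 3 ^ x.1 : Module.End (ZMod 2) (ZMod 2)⟦X⟧)
    ((heckeT 5 ^ x.2 : Module.End (ZMod 2) (ZMod 2)⟦X⟧) (Delta ^ expo a b)))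

/-- Unitriangularity of the pairing: monomials of the same or larger weight than (a, b) contribute
only when equal to (a, b). -/
theorem firstCoeff_hom {ψ : MvPowerSeries (Fin 2) (ZMod 2) →ₐ[ZMod 2] A}
    (h3 : IsHecke 3 (ψ (MvPowerSeries.X 0))) (h5 : IsHecke 5 (ψ (MvPowerSeries.X 1)))
    (s : MvPowerSeries (Fin 2) (ZMod 2)) (a b : ℕ) :
    firstCoeff (ψ s) a b = MvPowerSeries.coeff (expVec a b) s +
      ∑ x ∈ lowerPairs a b, MvPowerSeries.coeff (expVec x.1 x.2) s * pairing x a b := by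
  obtain ⟨N, hN⟩ := exists_component_apply_eq_sum (interleave a b).succPNat
  set M := max N (3 * a + 4 * b + 1) with hM
  have hM' : 3 * a + 4 * b + 1 ≤ M := le_max_right _ _
  have e1 : firstCoeff (ψ s) a b = ∑ x ∈ Finset.range M ×ˢ Finset.range M,
      MvPowerSeries.coeff (expVec x.1 x.2) s * pairing x a b := by
    rw [firstCoeff, hN M (le_max_left _ _) ψ h3 h5, map_sum]
    rfl
  have e2 : lowerPairs a b = (Finset.range M ×ˢ Finset.range M).filter
      fun x => 3 * x.1 + 4 * x.2 < 3 * a + 4 * b := by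
    ext x
    rw [mem_lowerPairs, Finset.mem_filter, Finset.mem_product, Finset.mem_range, Finset.mem_range]
    omega
  rw [e1, ← Finset.sum_filter_not_add_sum_filter _
    (fun x : ℕ × ℕ => 3 * x.1 + 4 * x.2 < 3 * a + 4 * b), ← e2]
  congr 1
  rw [Finset.sum_eq_single (a, b)]
  · rw [pairing, coeff_one_heckeT_pow_pow le_rfl, if_pos ⟨rfl, rfl⟩, mul_one]
  · intro x hx hne
    rw [Finset.mem_filter] at hx
    rw [pairing, coeff_one_heckeT_pow_pow (not_lt.1 hx.2), if_neg, mul_zero]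
    rintro ⟨h1, h2⟩
    exact hne (Prod.ext h1 h2)
  · intro hab
    refine absurd (Finset.mem_filter.2 ⟨Finset.mem_product.2 ⟨Finset.mem_range.2 ?_,
      Finset.mem_range.2 ?_⟩, lt_irrefl _⟩) hab
    · simp only
      omega
    · simp only
      omega

theorem hom_injective {ψ : MvPowerSeries (Fin 2) (ZMod 2) →ₐ[ZMod 2] A}
    (h3 : IsHecke 3 (ψ (MvPowerSeries.X 0))) (h5 : IsHecke 5 (ψ (MvPowerSeries.X 1))) : Function.Injective ψ := by
  rw [injective_iff_map_eq_zero]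
  intro s hs
  have key : ∀ w a b, 3 * a + 4 * b = w → MvPowerSeries.coeff (expVec a b) s = 0 := by
    intro w
    induction w using Nat.strong_induction_on with
    | _ w ih =>
      intro a b hab
      have h1 := firstCoeff_hom h3 h5 s a b
      rw [Finset.sum_eq_zero, add_zero, hs] at h1
      · rw [← h1]
        rfl
      · intro x hx
        rw [mem_lowerPairs] at hx
        rw [ih _ (by omega) x.1 x.2 rfl, zero_mul]
  ext d
  rw [← expVec_eta d, key _ _ _ rfl, map_zero]

/-- Recursion along the measure μ, realised by iterating G from a default function: the value at p
is stable after μ p + 1 steps. -/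
theorem exists_recursive {α β : Type*} [Inhabited β] (μ : α → ℕ) (G : α → (α → β) → β)
    (hG : ∀ p s s', (∀ q, μ q < μ p → s q = s' q) → G p s = G p s') :
    ∃ s : α → β, ∀ p, s p = G p s := by
  let t : ℕ → α → β := fun n => Nat.rec (fun _ => default) (fun _ f p => G p f) n
  have ht : ∀ n p, t (n + 1) p = G p (t n) := fun _ _ => rfl
  have hst : ∀ w p, μ p = w → ∀ n, w + 1 ≤ n → t n p = t (w + 1) p := by
    intro w
    induction w using Nat.strong_induction_on with
    | _ w ih =>
      intro p hp n hn
      obtain ⟨m, rfl⟩ := Nat.exists_eq_add_of_le' (show 1 ≤ n by omega)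
      rw [ht, ht]
      refine hG _ _ _ fun q hq => ?_
      rw [ih (μ q) (by omega) q rfl m (by omega), ih (μ q) (by omega) q rfl w (by omega)]
  refine ⟨fun p => t (μ p + 1) p, fun p => ?_⟩
  simp only [ht (μ p) p]
  refine hG _ _ _ fun q hq => ?_
  exact hst _ q rfl _ (by omega)

/-- An element of `F n` is determined by the coefficients of `q` in its images under the
monomials in `T_3`, `T_5`. -/
theorem eq_zero_of_coeff_one_eq_zero {n : ℕ} {g : (ZMod 2)⟦X⟧} (hg : g ∈ F n)
    (h : ∀ i j, PowerSeries.coeff 1 ((heckeT 3 ^ i : Module.End (ZMod 2) (ZMod 2)⟦X⟧)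
      ((heckeT 5 ^ j : Module.End (ZMod 2) (ZMod 2)⟦X⟧) g)) = 0) : g = 0 := by
  have hle : F n ≤ Submodule.span (ZMod 2)
      (Set.range fun x : ℕ × ℕ => Delta ^ expo x.1 x.2) := by
    rw [F, Submodule.span_le]
    rintro _ ⟨i, -, rfl⟩
    obtain ⟨a, b, hab⟩ := exists_expo i
    exact Submodule.subset_span ⟨(a, b), by simp only [hab]⟩
  obtain ⟨c, rfl⟩ := (Finsupp.mem_span_range_iff_exists_finsupp).1 (hle hg)
  by_contra hne
  have hc : c.support.Nonempty := by
    rw [Finset.nonempty_iff_ne_empty]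
    intro h0
    rw [Finsupp.support_eq_empty] at h0
    rw [h0] at hne
    simp at hne
  obtain ⟨x, hx, hmax⟩ := c.support.exists_max_image (fun x => 3 * x.1 + 4 * x.2) hc
  have h1 := h x.1 x.2
  rw [Finsupp.sum, map_sum, map_sum, map_sum, Finset.sum_eq_single x] at h1
  · rw [map_smul, map_smul, PowerSeries.coeff_smul, coeff_one_heckeT_pow_pow le_rfl,
      if_pos ⟨rfl, rfl⟩, smul_eq_mul, mul_one] at h1
    exact Finsupp.mem_support_iff.1 hx h1
  · intro y hy hyx
    rw [map_smul, map_smul, PowerSeries.coeff_smul, coeff_one_heckeT_pow_pow (hmax y hy), if_neg,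
      smul_zero]
    rintro ⟨e1, e2⟩
    exact hyx (Prod.ext e1 e2).symm
  · intro hx'
    exact absurd hx hx'

theorem component_monomial {ψ : MvPowerSeries (Fin 2) (ZMod 2) →ₐ[ZMod 2] A}
    (h3 : IsHecke 3 (ψ (MvPowerSeries.X 0))) (h5 : IsHecke 5 (ψ (MvPowerSeries.X 1)))
    (i j : ℕ) (n : ℕ+) (f : F n) :
    (component (ψ (MvPowerSeries.X 0 ^ i * MvPowerSeries.X 1 ^ j)) n f : (ZMod 2)⟦X⟧) =
      (heckeT 3 ^ i : Module.End (ZMod 2) (ZMod 2)⟦X⟧)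
        ((heckeT 5 ^ j : Module.End (ZMod 2) (ZMod 2)⟦X⟧) (f : (ZMod 2)⟦X⟧)) := by
  have h3' : ∀ f : F n, (componentHom n (ψ (MvPowerSeries.X 0)) f : (ZMod 2)⟦X⟧) = heckeT 3 f :=
    h3 n
  have h5' : ∀ f : F n, (componentHom n (ψ (MvPowerSeries.X 1)) f : (ZMod 2)⟦X⟧) = heckeT 5 f :=
    h5 n
  have e : componentHom n (ψ (MvPowerSeries.X 0 ^ i * MvPowerSeries.X 1 ^ j)) =
      componentHom n (ψ (MvPowerSeries.X 0)) ^ i * componentHom n (ψ (MvPowerSeries.X 1)) ^ j := by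
    simp only [map_mul, map_pow]
  rw [← componentHom_apply, e, Module.End.mul_apply, coe_pow_apply h3', coe_pow_apply h5']

/-- The hypothesis says that v f has no coefficient of q for every f. Applied to T_3^i T_5^j f, and
with v commuting past the monomial, it shows that v f pairs to 0 with all monomials, hence vanishes.
-/
theorem eq_zero_of_firstCoeff_eq_zero {ψ : MvPowerSeries (Fin 2) (ZMod 2) →ₐ[ZMod 2] A}
    (h3 : IsHecke 3 (ψ (MvPowerSeries.X 0))) (h5 : IsHecke 5 (ψ (MvPowerSeries.X 1)))
    {v : A} (hv : ∀ a b, firstCoeff v a b = 0) : v = 0 := by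
  have h1 : ∀ (n : ℕ+) (f : (ZMod 2)⟦X⟧) (hf : f ∈ F n),
      PowerSeries.coeff 1 (component v n ⟨f, hf⟩ : (ZMod 2)⟦X⟧) = 0 := by
    intro n f hf
    refine Submodule.span_induction (p := fun f hf =>
      PowerSeries.coeff 1 (component v n ⟨f, hf⟩ : (ZMod 2)⟦X⟧) = 0) ?_ ?_ ?_ ?_ hf
    · rintro _ ⟨i, hi, rfl⟩
      obtain ⟨a, b, hab⟩ := exists_expo i
      have hi' : interleave a b < n := by
        rw [expo] at hab
        omega
      have := (firstCoeff_eq v hi').symm.trans (hv a b)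
      simpa only [hab] using this
    · have : component v n ⟨0, (F n).zero_mem⟩ = 0 := map_zero (component v n)
      rw [this]
      simp
    · intro x y hx hy ex ey
      have : component v n ⟨x + y, (F n).add_mem hx hy⟩ =
          component v n ⟨x, hx⟩ + component v n ⟨y, hy⟩ :=
        map_add (component v n) ⟨x, hx⟩ ⟨y, hy⟩
      rw [this, Submodule.coe_add, map_add, ex, ey, add_zero]
    · intro c x hx ex
      have : component v n ⟨c • x, (F n).smul_mem c hx⟩ = c • component v n ⟨x, hx⟩ :=
        map_smul (component v n) c ⟨x, hx⟩
      rw [this, Submodule.coe_smul, PowerSeries.coeff_smul, ex, smul_zero]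
  refine ext_component fun (n : ℕ+) f => Subtype.ext ?_
  refine (eq_zero_of_coeff_one_eq_zero (component v n f).2 fun i j => ?_).trans rfl
  rw [← component_monomial h3 h5 i j n (component v n f)]
  set w := ψ (MvPowerSeries.X 0 ^ i * MvPowerSeries.X 1 ^ j) with hw
  have hcomm : component w n (component v n f) = component v n (component w n f) := by
    have := congrArg (fun u => componentHom n u f) (mul_comm w v)
    simp only [map_mul, Module.End.mul_apply] at this
    exact this
  rw [hcomm]
  exact h1 n _ (component w n f).2

/-- The triangular system of `firstCoeff_hom` is solved weight by weight for the coefficients of s,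
so that ψ(s) and u have the same first coefficients and therefore agree. -/
theorem hom_surjective {ψ : MvPowerSeries (Fin 2) (ZMod 2) →ₐ[ZMod 2] A}
    (h3 : IsHecke 3 (ψ (MvPowerSeries.X 0))) (h5 : IsHecke 5 (ψ (MvPowerSeries.X 1))) : Function.Surjective ψ := by
  intro u
  obtain ⟨t, ht⟩ := exists_recursive (β := ZMod 2) (fun x : ℕ × ℕ => 3 * x.1 + 4 * x.2)
    (fun x s => firstCoeff u x.1 x.2 - ∑ y ∈ lowerPairs x.1 x.2, s y * pairing y x.1 x.2) (by
      intro p s s' hss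
      congr 1
      refine Finset.sum_congr rfl fun y hy => ?_
      rw [hss y (mem_lowerPairs.1 hy)])
  obtain ⟨s, hs⟩ : ∃ s : MvPowerSeries (Fin 2) (ZMod 2), ∀ a b,
      MvPowerSeries.coeff (expVec a b) s = t (a, b) :=
    ⟨fun d => t (d 0, d 1), fun a b => by
      change t (expVec a b 0, expVec a b 1) = t (a, b)
      rw [expVec_zero, expVec_one]⟩
  refine ⟨s, ?_⟩
  rw [← sub_eq_zero]
  refine eq_zero_of_firstCoeff_eq_zero h3 h5 fun a b => ?_
  have e1 : firstCoeff (ψ s - u) a b = firstCoeff (ψ s) a b - firstCoeff u a b := by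
    simp only [firstCoeff, ← componentHom_apply, map_sub, LinearMap.sub_apply, Submodule.coe_sub]
  rw [e1, firstCoeff_hom h3 h5]
  simp only [hs]
  rw [ht (a, b)]
  simp

end HeckeModTwo

theorem mainTheorem1 :
    -- the operators `T_p` preserve the spaces `F(n)`
    (∀ p : ℕ, p.Prime → p ≠ 2 → ∀ n : ℕ, ∀ f ∈ HeckeModTwo.F n,
      HeckeModTwo.heckeT p f ∈ HeckeModTwo.F n) ∧
    -- there is exactly one `ψ` with `ψ(x) = T_3`, `ψ(y) = T_5`; it is continuous and bijective
    (∃ ψ : MvPowerSeries (Fin 2) (ZMod 2) →ₐ[ZMod 2] HeckeModTwo.A,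
      (HeckeModTwo.IsHecke 3 (ψ (MvPowerSeries.X 0)) ∧
        HeckeModTwo.IsHecke 5 (ψ (MvPowerSeries.X 1))) ∧
      (∀ φ : MvPowerSeries (Fin 2) (ZMod 2) →ₐ[ZMod 2] HeckeModTwo.A,
        HeckeModTwo.IsHecke 3 (φ (MvPowerSeries.X 0)) ∧
          HeckeModTwo.IsHecke 5 (φ (MvPowerSeries.X 1)) → φ = ψ) ∧
      HeckeModTwo.IsContinuousHom ψ ∧
      Function.Bijective ψ) ∧
    -- consequences for the ring `A`
    IsRegularLocalRing HeckeModTwo.A ∧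
    ringKrullDim HeckeModTwo.A = 2 ∧
    IsDomain HeckeModTwo.A := by
  obtain ⟨ψ, h3, h5⟩ := HeckeModTwo.exists_hom
  have hbij : Function.Bijective ψ :=
    ⟨HeckeModTwo.hom_injective h3 h5, HeckeModTwo.hom_surjective h3 h5⟩
  have e : MvPowerSeries (Fin 2) (ZMod 2) ≃+* HeckeModTwo.A :=
    (AlgEquiv.ofBijective ψ hbij).toRingEquiv
  refine ⟨fun p hp hp2 n f hf => HeckeModTwo.heckeT_mem_F hp hp2 n f hf,
    ⟨ψ, ⟨h3, h5⟩, fun φ hφ => HeckeModTwo.hom_unique hφ.1 hφ.2 h3 h5,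
      HeckeModTwo.isContinuousHom h3 h5, hbij⟩, ?_, ?_, ?_⟩
  · have := HeckeModTwo.isRegularLocalRing_mvPowerSeries (K := ZMod 2)
    exact IsRegularLocalRing.of_ringEquiv e
  · rw [← ringKrullDim_eq_of_ringEquiv e]
    exact HeckeModTwo.ringKrullDim_mvPowerSeries
  · have : IsDomain (MvPowerSeries (Fin 2) (ZMod 2)) := NoZeroDivisors.to_isDomain _
    exact e.symm.toMulEquiv.isDomain _
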